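/- Let $\mathfrak S$ be a site with a final object $S_0$ and let $\mathcal U=\{u_i:T_i\to S_0\}_{i\in I}$ be a covering. Let $\mathcal B\to\mathfrak S$ be a category fibred in abelian tensor categories: each fibre $\mathcal B_S$ is an abelian category with a symmetric monoidal structure such that every functor $x\mapsto y\otimes x$ is additive and preserves small colimits, the pull-back functors $f^*$ are symmetric strong monoidal and preserve small colimits, and the isomorphisms $\mathrm{id}^*\cong\mathrm{id}$ and $(gf)^*\cong f^*g^*$ are monoidal. Suppose that $\mathcal B$ is a stack, i.e. satisfies effective descent for all coverings. A tensor functor is a symmetric strong monoidal functor preserving small colimits; for an abelian tensor category $A$ let $\underline A(\mathcal B)$ be the category fibred in groupoids over $\mathfrak S$ whose fibre over $S$ is the groupoid of tensor functors $F:A\to\mathcal B_S$ and monoidal natural isomorphisms, with pull-backs $F\mapsto f^*\circ F$. Write $\mathcal B_{/T_i}$ for the restriction of $\mathcal B$ to $\mathfrak S_{/T_i}$, write $T_{ij}=T_i\times T_j$ and so on, and write $|_{ij}$ etc. for restrictions to $\mathfrak S_{/T_{ij}}$ etc. (If these products do not exist in $\mathfrak S$, then $\mathfrak S_{/T_{ij}}$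 etc. means the category of objects $S$ with morphisms to $T_i$ and $T_j$, etc.) Let $k$ be a field, let $G$ be a finite group, and let $A_G$ be the category of finite-dimensional representations of $G$ over $k$ with the usual tensor product. For $\beta\in G$ let $\iota(\beta)\in\mathrm{Aut}(G)$ be $x\mapsto\beta^{-1}x\beta$, and for $\alpha\in\mathrm{Aut}(G)$ let $\kappa(\alpha):A_G\to A_G$ be the tensor functor $\rho\mapsto\rho\circ\alpha$. Let $\alpha_{ij}\in\mathrm{Aut}(G)$ and $\beta_{ijk}\in G$ ($i,j,k\in I$) satisfy $$\alpha_{jk}\circ\alpha_{ij}=\alpha_{ik}\circ\iota(\beta_{ijk}),\qquad \alpha_{ij}^{-1}(\beta_{jkl})\,\beta_{ijl}=\beta_{ijk}\,\beta_{ikl}$$ for all $i,j,k,l$. Put $\lambda_{ij}=\kappa(\alpha_{ij})$, and let $\mu_{ijk}:\lambda_{ij}\circ\lambda_{jk}\Rightarrow\lambda_{ik}$ be the isomorphism of tensor functors given by $(\mu_{ijk})_\rho=\rho(\alpha_{ik}(\beta_{ijk}))$. Let $\mathscr X_i=\underline{A_G}(\mathcal B_{/T_i})$, let $\chi_{ij}:\mathscr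 X_i|_{ij}\to\mathscr X_j|_{ij}$ be $F\mapsto F\circ\lambda_{ij}$, and let $\phi_{ijk}:\chi_{jk}\circ\chi_{ij}\Rightarrow\chi_{ik}$ over $\mathfrak S_{/T_{ijk}}$ be given on $F$ by $F(\mu_{ijk})$. Then $(\mathscr X_i,\chi_{ij},\phi_{ijk})$ is a 2-descent datum of stacks over $\mathfrak S$ with respect to $\mathcal U$. That is: the $\mathscr X_i$ are stacks in groupoids over $\mathfrak S_{/T_i}$, the $\chi_{ij}$ are equivalences of stacks over $\mathfrak S_{/T_{ij}}$, the $\phi_{ijk}$ are natural isomorphisms over $\mathfrak S_{/T_{ijk}}$ (compatible with pull-backs), and for all $i,j,k,l$ the two natural isomorphisms $\phi_{ikl}\cdot\chi_{kl}(\phi_{ijk})$ and $\phi_{ijl}\cdot(\phi_{jkl}\circ\chi_{ij})$ from $\chi_{kl}\circ\chi_{jk}\circ\chi_{ij}$ to $\chi_{il}$ over $\mathfrak S_{/T_{ijkl}}$ coincide. Consequently there is a stack in groupoids $\mathscr Y$ over $\mathfrak S$ obtained by gluing this datum: there are equivalences $\psi_i:u_i^{-1}\mathscr Y\to\underline{A_G}(\mathcal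 B_{/T_i})$ of stacks over $\mathfrak S_{/T_i}$ and natural isomorphisms $\theta_{ij}:\chi_{ij}\circ\psi_i\Rightarrow\psi_j$ over $\mathfrak S_{/T_{ij}}$ such that, for all $i,j,k$, $\theta_{jk}\cdot\chi_{jk}(\theta_{ij})=\theta_{ik}\cdot(\phi_{ijk}\circ\psi_i)$ over $\mathfrak S_{/T_{ijk}}$. -/

import Mathlib

universe w wι uk uG vB uB v u v₁ v₂ v₃ u₁ u₂ u₃ vX uX vY uY

open CategoryTheory Opposite Limits

set_option linter.checkUnivs false

namespace TensorStack

/-! ### Abelian tensor categories and tensor functors -/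

section TensorFunctors

/-- An abelian tensor category: an abelian category with a symmetric monoidal structure such that
every functor `x ↦ y ⊗ x` is additive and preserves small colimits.  Smallness refers to a
universe `w`. -/
class AbelianTensorCategory (A : Type u₁) [Category.{v₁} A] [Abelian A] [MonoidalCategory A]
    [SymmetricCategory A] : Prop where
  tensor_additive : ∀ y : A, (MonoidalCategory.tensorLeft y).Additive
  tensor_preservesColimits : ∀ y : A,
    PreservesColimitsOfSize.{w, w} (MonoidalCategory.tensorLeft y)

/-- A tensor functor: a symmetric strong monoidal functor preserving small colimits. -/
structure TensorFunctor (A : Type u₁) [Category.{v₁} A] [MonoidalCategory A] [SymmetricCategory A]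
    (B : Type u₂) [Category.{v₂} B] [MonoidalCategory B] [SymmetricCategory B] where
  toFunctor : A ⥤ B
  braided : toFunctor.Braided
  preservesColimits : PreservesColimitsOfSize.{w, w} toFunctor

attribute [instance] TensorFunctor.braided TensorFunctor.preservesColimits

variable {A : Type u₁} [Category.{v₁} A] [MonoidalCategory A] [SymmetricCategory A]
  {B : Type u₂} [Category.{v₂} B] [MonoidalCategory B] [SymmetricCategory B]
  {B' : Type u₃} [Category.{v₃} B'] [MonoidalCategory B'] [SymmetricCategory B']

namespace TensorFunctor

/-- A morphism of tensor functors is a (symmetric) monoidal natural isomorphism. -/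
@[ext]
structure Hom (F G : TensorFunctor.{w} A B) where
  iso : F.toFunctor ≅ G.toFunctor
  isMonoidal : NatTrans.IsMonoidal iso.hom

attribute [instance] Hom.isMonoidal

/-- The category (in fact groupoid) of tensor functors from `A` to `B`. -/
instance : Category (TensorFunctor.{w} A B) where
  Hom F G := Hom F G
  id F := ⟨Iso.refl _, inferInstanceAs (NatTrans.IsMonoidal (𝟙 F.toFunctor))⟩
  comp f g := ⟨f.iso ≪≫ g.iso, inferInstanceAs (NatTrans.IsMonoidal (f.iso.hom ≫ g.iso.hom))⟩
  id_comp f := Hom.ext (Iso.ext (Category.id_comp f.iso.hom))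
  comp_id f := Hom.ext (Iso.ext (Category.comp_id f.iso.hom))
  assoc f g h := Hom.ext (Iso.ext (Category.assoc f.iso.hom g.iso.hom h.iso.hom))

theorem hom_ext {F G : TensorFunctor.{w} A B} {f g : F ⟶ G}
    (h : ∀ a, f.iso.hom.app a = g.iso.hom.app a) : f = g :=
  Hom.ext (Iso.ext (NatTrans.ext (funext h)))

/-- Every morphism of tensor functors is an isomorphism. -/
def isoMk {F G : TensorFunctor.{w} A B} (f : F ⟶ G) : F ≅ G where
  hom := f
  inv := ⟨f.iso.symm, inferInstanceAs (NatTrans.IsMonoidal f.iso.inv)⟩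
  hom_inv_id := hom_ext fun a => f.iso.hom_inv_id_app a
  inv_hom_id := hom_ext fun a => f.iso.inv_hom_id_app a

/-- The composite tensor functor `H ∘ F`. -/
def comp (F : TensorFunctor.{w} A B) (H : TensorFunctor.{w} B B') : TensorFunctor.{w} A B' where
  toFunctor := F.toFunctor ⋙ H.toFunctor
  braided := inferInstance
  preservesColimits := inferInstance

variable (A) in
/-- The functor `F ↦ H ∘ F`. -/
def postcomp (H : TensorFunctor.{w} B B') : TensorFunctor.{w} A B ⥤ TensorFunctor.{w} A B' where
  obj F := F.comp H
  map f := ⟨Functor.isoWhiskerRight f.iso H.toFunctor,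
    inferInstanceAs (NatTrans.IsMonoidal (Functor.whiskerRight f.iso.hom H.toFunctor))⟩
  map_id F := hom_ext fun a => H.toFunctor.map_id (F.toFunctor.obj a)
  map_comp f g := hom_ext fun a => H.toFunctor.map_comp (f.iso.hom.app a) (g.iso.hom.app a)

variable (B') in
/-- The functor `F ↦ F ∘ H`. -/
def precomp (H : TensorFunctor.{w} A B) : TensorFunctor.{w} B B' ⥤ TensorFunctor.{w} A B' where
  obj F := H.comp F
  map f := ⟨Functor.isoWhiskerLeft H.toFunctor f.iso,
    inferInstanceAs (NatTrans.IsMonoidal (Functor.whiskerLeft H.toFunctor f.iso.hom))⟩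

/-- A morphism `m : K ∘ H ⟶ L` of tensor functors induces the natural isomorphism
`F ∘ K ∘ H ≅ F ∘ L`, with components `F(m_a)`, in the tensor functor `F`. -/
def precompComp {A' : Type u₃} [Category.{v₃} A'] [MonoidalCategory A'] [SymmetricCategory A']
    {H : TensorFunctor.{w} A B} {K : TensorFunctor.{w} B A'} {L : TensorFunctor.{w} A A'}
    (m : H.comp K ⟶ L) (D : Type uX) [Category.{vX} D] [MonoidalCategory D]
    [SymmetricCategory D] : precomp D K ⋙ precomp D H ≅ precomp D L :=
  NatIso.ofComponents (fun F => isoMk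
    { iso := (Functor.associator H.toFunctor K.toFunctor F.toFunctor).symm ≪≫
        Functor.isoWhiskerRight m.iso F.toFunctor
      isMonoidal :=
        have := NatTrans.IsMonoidal.whiskerRight (F₁ := (H.comp K).toFunctor)
          (F₂ := L.toFunctor) m.iso.hom (G₁ := F.toFunctor)
        @NatTrans.IsMonoidal.comp _ _ _ _ _ _ _ _ _
          (Functor.associator H.toFunctor K.toFunctor F.toFunctor).inv _ _ _
          (Functor.whiskerRight (G := (H.comp K).toFunctor) (H := L.toFunctor) m.iso.hom
            F.toFunctor) inferInstance this })
    (fun {_ _} t => hom_ext fun a =>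
      (congrArg (_ ≫ ·) (Category.id_comp _)).trans
        ((t.iso.hom.naturality (m.iso.hom.app a)).symm.trans
          (congrArg (· ≫ _) (Category.id_comp _).symm)))

theorem precompComp_hom_app {A' : Type u₃} [Category.{v₃} A'] [MonoidalCategory A']
    [SymmetricCategory A'] {H : TensorFunctor.{w} A B} {K : TensorFunctor.{w} B A'}
    {L : TensorFunctor.{w} A A'} (m : H.comp K ⟶ L) (D : Type uX) [Category.{vX} D]
    [MonoidalCategory D] [SymmetricCategory D] (F : TensorFunctor.{w} A' D) (a : A) :
    ((precompComp m D).hom.app F).iso.hom.app a = F.toFunctor.map (m.iso.hom.app a) :=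
  Category.id_comp _

/-- Composition on the left commutes with composition on the right. -/
def precompPostcomp {A' : Type u₃} [Category.{v₃} A'] [MonoidalCategory A'] [SymmetricCategory A']
    (H : TensorFunctor.{w} A B) {D : Type uX} [Category.{vX} D] [MonoidalCategory D]
    [SymmetricCategory D] (P : TensorFunctor.{w} A' D) :
    postcomp B P ⋙ precomp D H ≅ precomp A' H ⋙ postcomp A P :=
  NatIso.ofComponents (fun F => isoMk
    { iso := (Functor.associator H.toFunctor F.toFunctor P.toFunctor).symm
      isMonoidal := inferInstanceAs (NatTrans.IsMonoidal
        (Functor.associator H.toFunctor F.toFunctor P.toFunctor).inv) })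
    (fun {_ _} _ => hom_ext fun _ => (Category.comp_id _).trans (Category.id_comp _).symm)

end TensorFunctor

end TensorFunctors

/-! ### Categories fibred in abelian tensor categories -/

section Fibrations

variable (C : Type u) [Category.{v} C]

/-- A (cloven) category fibred in abelian tensor categories over `C`, given by its pseudofunctor
of fibres: every fibre is an abelian tensor category, the pull-back functors are tensor functors
and the coherence isomorphisms `id^* ≅ id`, `(g ∘ f)^* ≅ f^* ∘ g^*` are monoidal. -/
structure AbTensorFibration where
  fib : Pseudofunctor (LocallyDiscrete Cᵒᵖ) Cat.{vB, uB}
  abelian : ∀ S, Abelian (fib.obj S)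
  monoidal : ∀ S, MonoidalCategory (fib.obj S)
  symmetric : ∀ S, SymmetricCategory (fib.obj S)
  tensor : ∀ S, AbelianTensorCategory.{w} (fib.obj S)
  braided : ∀ {S S'} (f : S ⟶ S'), (fib.map f).toFunctor.Braided
  preservesColimits : ∀ {S S'} (f : S ⟶ S'), PreservesColimitsOfSize.{w, w} (fib.map f).toFunctor
  mapId_isMonoidal : ∀ S, NatTrans.IsMonoidal (F₁ := (fib.map (𝟙 S)).toFunctor)
    (F₂ := 𝟭 (fib.obj S)) (Cat.Hom.toNatIso (fib.mapId S)).hom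
  mapComp_isMonoidal : ∀ {S S' S''} (f : S ⟶ S') (g : S' ⟶ S''),
    NatTrans.IsMonoidal (F₁ := (fib.map (f ≫ g)).toFunctor)
      (F₂ := (fib.map f).toFunctor ⋙ (fib.map g).toFunctor)
      (Cat.Hom.toNatIso (fib.mapComp f g)).hom

variable {C}
namespace AbTensorFibration

attribute [instance] abelian monoidal symmetric tensor braided
  preservesColimits mapId_isMonoidal mapComp_isMonoidal

variable (B : AbTensorFibration.{w, vB, uB} C)

/-- The pull-back functor along `f`, as a tensor functor. -/
def pullback {S S' : LocallyDiscrete Cᵒᵖ} (f : S ⟶ S') :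
    TensorFunctor.{w} (B.fib.obj S) (B.fib.obj S') where
  toFunctor := (B.fib.map f).toFunctor
  braided := inferInstance
  preservesColimits := inferInstance

theorem map₂_isMonoidal {S S' : LocallyDiscrete Cᵒᵖ} {f g : S ⟶ S'} (η : f ⟶ g) :
    NatTrans.IsMonoidal (F₁ := (B.fib.map f).toFunctor) (F₂ := (B.fib.map g).toFunctor)
      (B.fib.map₂ η).toNatTrans := by
  obtain rfl := LocallyDiscrete.eq_of_hom η
  have : η = 𝟙 f := Subsingleton.elim _ _
  subst this
  rw [PrelaxFunctor.map₂_id]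
  exact inferInstanceAs (NatTrans.IsMonoidal (𝟙 (B.fib.map f).toFunctor))

variable (A : Type u₁) [Category.{v₁} A] [MonoidalCategory A] [SymmetricCategory A]

/-- The natural transformation `f^* ∘ F ⟶ g^* ∘ F` induced by an equality `f = g`. -/
def homMap₂ {S S' : LocallyDiscrete Cᵒᵖ} {f g : S ⟶ S'} (η : f ⟶ g) :
    TensorFunctor.postcomp A (B.pullback f) ⟶ TensorFunctor.postcomp A (B.pullback g) where
  app F :=
    { iso := Functor.isoWhiskerLeft F.toFunctor (Cat.Hom.toNatIso (B.fib.map₂Iso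
        (eqToIso (LocallyDiscrete.eq_of_hom η))))
      isMonoidal :=
        have := B.map₂_isMonoidal (eqToHom (LocallyDiscrete.eq_of_hom η))
        NatTrans.IsMonoidal.whiskerLeft (F₁ := F.toFunctor) (G₁ := (B.fib.map f).toFunctor)
          (G₂ := (B.fib.map g).toFunctor) (B.fib.map₂ (eqToHom (LocallyDiscrete.eq_of_hom η))).toNatTrans }
  naturality _ _ t := TensorFunctor.hom_ext fun a =>
    (B.fib.map₂ (eqToHom (LocallyDiscrete.eq_of_hom η))).toNatTrans.naturality (t.iso.hom.app a)

theorem homMap₂_app {S S' : LocallyDiscrete Cᵒᵖ} {f g : S ⟶ S'} (η : f ⟶ g)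
    (F : TensorFunctor.{w} A (B.fib.obj S)) (a : A) :
    ((B.homMap₂ A η).app F).iso.hom.app a = (B.fib.map₂ η).toNatTrans.app (F.toFunctor.obj a) := by
  have : η = eqToHom (LocallyDiscrete.eq_of_hom η) := Subsingleton.elim _ _
  rw [this]; rfl

/-- The natural isomorphism `id^* ∘ F ≅ F`. -/
def homMapId (S : LocallyDiscrete Cᵒᵖ) :
    TensorFunctor.postcomp A (B.pullback (𝟙 S)) ≅ 𝟭 (TensorFunctor.{w} A (B.fib.obj S)) :=
  NatIso.ofComponents (fun F => TensorFunctor.isoMk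
    { iso := Functor.isoWhiskerLeft F.toFunctor (Cat.Hom.toNatIso (B.fib.mapId S)) ≪≫
        F.toFunctor.rightUnitor
      isMonoidal :=
        have := NatTrans.IsMonoidal.whiskerLeft (F₁ := F.toFunctor)
          (G₁ := (B.fib.map (𝟙 S)).toFunctor) (G₂ := 𝟭 (B.fib.obj S))
          (Cat.Hom.toNatIso (B.fib.mapId S)).hom
        NatTrans.IsMonoidal.comp (F₂ := F.toFunctor ⋙ 𝟭 (B.fib.obj S))
          (Functor.whiskerLeft F.toFunctor (G := (B.fib.map (𝟙 S)).toFunctor)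
            (H := 𝟭 (B.fib.obj S)) (Cat.Hom.toNatIso (B.fib.mapId S)).hom)
          F.toFunctor.rightUnitor.hom })
    (fun {_ _} t => TensorFunctor.hom_ext fun a =>
      (congrArg (_ ≫ ·) (Category.comp_id _)).trans
        (((B.fib.mapId S).hom.toNatTrans.naturality (t.iso.hom.app a)).trans
          (congrArg (· ≫ _) (Category.comp_id _).symm)))

theorem homMapId_app {S : LocallyDiscrete Cᵒᵖ} (F : TensorFunctor.{w} A (B.fib.obj S)) (a : A) :
    ((B.homMapId A S).hom.app F).iso.hom.app a =
      (B.fib.mapId S).hom.toNatTrans.app (F.toFunctor.obj a) :=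
  Category.comp_id _

theorem homMapId_inv_app {S : LocallyDiscrete Cᵒᵖ} (F : TensorFunctor.{w} A (B.fib.obj S)) (a : A) :
    ((B.homMapId A S).inv.app F).iso.hom.app a =
      (B.fib.mapId S).inv.toNatTrans.app (F.toFunctor.obj a) :=
  Category.id_comp _

/-- The natural isomorphism `(g ∘ f)^* ∘ F ≅ f^* ∘ (g^* ∘ F)`. -/
def homMapComp {S S' S'' : LocallyDiscrete Cᵒᵖ} (f : S ⟶ S') (g : S' ⟶ S'') :
    TensorFunctor.postcomp A (B.pullback (f ≫ g)) ≅
      TensorFunctor.postcomp A (B.pullback f) ⋙ TensorFunctor.postcomp A (B.pullback g) :=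
  NatIso.ofComponents (fun F => TensorFunctor.isoMk
    { iso := Functor.isoWhiskerLeft F.toFunctor (Cat.Hom.toNatIso (B.fib.mapComp f g)) ≪≫
        (Functor.associator F.toFunctor (B.fib.map f).toFunctor (B.fib.map g).toFunctor).symm
      isMonoidal :=
        have := NatTrans.IsMonoidal.whiskerLeft (F₁ := F.toFunctor)
          (G₁ := (B.fib.map (f ≫ g)).toFunctor)
          (G₂ := (B.fib.map f).toFunctor ⋙ (B.fib.map g).toFunctor)
          (Cat.Hom.toNatIso (B.fib.mapComp f g)).hom
        NatTrans.IsMonoidal.comp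
          (F₂ := F.toFunctor ⋙ (B.fib.map f).toFunctor ⋙ (B.fib.map g).toFunctor)
          (Functor.whiskerLeft F.toFunctor (G := (B.fib.map (f ≫ g)).toFunctor)
            (H := (B.fib.map f).toFunctor ⋙ (B.fib.map g).toFunctor)
            (Cat.Hom.toNatIso (B.fib.mapComp f g)).hom)
          (Functor.associator F.toFunctor (B.fib.map f).toFunctor (B.fib.map g).toFunctor).inv })
    (fun {_ _} t => TensorFunctor.hom_ext fun a =>
      (congrArg (_ ≫ ·) (Category.comp_id _)).trans
        (((B.fib.mapComp f g).hom.toNatTrans.naturality (t.iso.hom.app a)).trans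
          (congrArg (· ≫ _) (Category.comp_id _).symm)))

theorem homMapComp_app {S S' S'' : LocallyDiscrete Cᵒᵖ} (f : S ⟶ S') (g : S' ⟶ S'')
    (F : TensorFunctor.{w} A (B.fib.obj S)) (a : A) :
    ((B.homMapComp A f g).hom.app F).iso.hom.app a =
      (B.fib.mapComp f g).hom.toNatTrans.app (F.toFunctor.obj a) :=
  Category.comp_id _

theorem homMapComp_inv_app {S S' S'' : LocallyDiscrete Cᵒᵖ} (f : S ⟶ S') (g : S' ⟶ S'')
    (F : TensorFunctor.{w} A (B.fib.obj S)) (a : A) :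
    ((B.homMapComp A f g).inv.app F).iso.hom.app a =
      (B.fib.mapComp f g).inv.toNatTrans.app (F.toFunctor.obj a) :=
  Category.id_comp _

/-- The fibred category `A(B)` of tensor functors from `A` to the fibres of `B`: its fibre over `S`
is the groupoid of tensor functors `A ⟶ B_S` and monoidal natural isomorphisms, and the pull-back
of `F` along `f` is `f^* ∘ F`. -/
def homFib :
    Pseudofunctor (LocallyDiscrete Cᵒᵖ) Cat.{max u₁ vB, max u₁ v₁ vB uB} where
  obj S := Cat.of (TensorFunctor.{w} A (B.fib.obj S))
  map f := (TensorFunctor.postcomp A (B.pullback f)).toCatHom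
  map₂ η := NatTrans.toCatHom₂ (B.homMap₂ A η)
  mapId S := Cat.Hom.isoMk (B.homMapId A S)
  mapComp f g := Cat.Hom.isoMk (B.homMapComp A f g)
  map₂_id {S S'} f := Cat.Hom₂.ext (NatTrans.ext (funext fun F => TensorFunctor.hom_ext fun a =>
    (B.homMap₂_app A (𝟙 f) F a).trans
      (congrArg (fun t => t.toNatTrans.app (F.toFunctor.obj a)) (B.fib.map₂_id f))))
  map₂_comp {S S' f g h} η θ := Cat.Hom₂.ext (NatTrans.ext (funext fun F =>
    TensorFunctor.hom_ext fun a => by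
      refine (B.homMap₂_app A (η ≫ θ) F a).trans
        ((congrArg (fun t => t.toNatTrans.app (F.toFunctor.obj a)) (B.fib.map₂_comp η θ)).trans ?_)
      exact (congrArg₂ (· ≫ ·) (B.homMap₂_app A η F a) (B.homMap₂_app A θ F a)).symm))
  map₂_whisker_left {S S' S''} f {g h} η := Cat.Hom₂.ext (NatTrans.ext (funext fun F =>
    TensorFunctor.hom_ext fun a => by
      refine (B.homMap₂_app A (Bicategory.whiskerLeft f η) F a).trans
        ((congrArg (fun t => t.toNatTrans.app (F.toFunctor.obj a))
          (B.fib.map₂_whisker_left f η)).trans ?_)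
      exact (congrArg₂ (· ≫ ·) (B.homMapComp_app A f g F a) (congrArg₂ (· ≫ ·)
        (B.homMap₂_app A η (F.comp (B.pullback f)) a) (B.homMapComp_inv_app A f h F a))).symm))
  map₂_whisker_right {S S' S'' f g} η h := Cat.Hom₂.ext (NatTrans.ext (funext fun F =>
    TensorFunctor.hom_ext fun a => by
      refine (B.homMap₂_app A (Bicategory.whiskerRight η h) F a).trans
        ((congrArg (fun t => t.toNatTrans.app (F.toFunctor.obj a))
          (B.fib.map₂_whisker_right η h)).trans ?_)
      exact (congrArg₂ (· ≫ ·) (B.homMapComp_app A f h F a) (congrArg₂ (· ≫ ·)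
        (congrArg (B.fib.map h).toFunctor.map (B.homMap₂_app A η F a))
        (B.homMapComp_inv_app A g h F a))).symm))
  map₂_associator {S₀ S₁ S₂ S₃} f g h := Cat.Hom₂.ext (NatTrans.ext (funext fun F =>
    TensorFunctor.hom_ext fun a => by
      refine (B.homMap₂_app A (Bicategory.associator f g h).hom F a).trans
        ((congrArg (fun t => t.toNatTrans.app (F.toFunctor.obj a))
          (B.fib.map₂_associator f g h)).trans ?_)
      exact (congrArg₂ (· ≫ ·) (B.homMapComp_app A (f ≫ g) h F a) (congrArg₂ (· ≫ ·)
        (congrArg (B.fib.map h).toFunctor.map (B.homMapComp_app A f g F a))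
        (congrArg (𝟙 _ ≫ ·) (congrArg₂ (· ≫ ·)
          (B.homMapComp_inv_app A g h (F.comp (B.pullback f)) a)
          (B.homMapComp_inv_app A f (g ≫ h) F a))))).symm))
  map₂_left_unitor {S S'} f := Cat.Hom₂.ext (NatTrans.ext (funext fun F =>
    TensorFunctor.hom_ext fun a => by
      refine (B.homMap₂_app A (Bicategory.leftUnitor f).hom F a).trans
        ((congrArg (fun t => t.toNatTrans.app (F.toFunctor.obj a))
          (B.fib.map₂_left_unitor f)).trans ?_)
      exact (congrArg₂ (· ≫ ·) (B.homMapComp_app A (𝟙 S) f F a) (congrArg (· ≫ 𝟙 _)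
        (congrArg (B.fib.map f).toFunctor.map (B.homMapId_app A F a)))).symm))
  map₂_right_unitor {S S'} f := Cat.Hom₂.ext (NatTrans.ext (funext fun F =>
    TensorFunctor.hom_ext fun a => by
      refine (B.homMap₂_app A (Bicategory.rightUnitor f).hom F a).trans
        ((congrArg (fun t => t.toNatTrans.app (F.toFunctor.obj a))
          (B.fib.map₂_right_unitor f)).trans ?_)
      exact (congrArg₂ (· ≫ ·) (B.homMapComp_app A f (𝟙 S') F a) (congrArg (· ≫ 𝟙 _)
        (B.homMapId_app A (F.comp (B.pullback f)) a))).symm))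

/-- The base change of a category fibred in abelian tensor categories along a functor `p`. -/
def restrict {D : Type uX} [Category.{vX} D] (p : D ⥤ C) : AbTensorFibration.{w, vB, uB} D where
  fib := p.op.toPseudofunctor.comp B.fib
  abelian S := B.abelian (p.op.toPseudofunctor.obj S)
  monoidal S := B.monoidal (p.op.toPseudofunctor.obj S)
  symmetric S := B.symmetric (p.op.toPseudofunctor.obj S)
  tensor S := B.tensor (p.op.toPseudofunctor.obj S)
  braided f := B.braided (p.op.toPseudofunctor.map f)
  preservesColimits f := B.preservesColimits (p.op.toPseudofunctor.map f)
  mapId_isMonoidal S := by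
    have h₁ := B.map₂_isMonoidal (p.op.toPseudofunctor.mapId S).hom
    have h₂ := B.mapId_isMonoidal (p.op.toPseudofunctor.obj S)
    exact NatTrans.IsMonoidal.comp (τ := (B.fib.map₂ (p.op.toPseudofunctor.mapId S).hom).toNatTrans)
      (τ' := (Cat.Hom.toNatIso (B.fib.mapId (p.op.toPseudofunctor.obj S))).hom)
      (F₁ := (B.fib.map (p.op.toPseudofunctor.map (𝟙 S))).toFunctor)
      (F₂ := (B.fib.map (𝟙 (p.op.toPseudofunctor.obj S))).toFunctor)
      (F₃ := 𝟭 (B.fib.obj (p.op.toPseudofunctor.obj S)))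
  mapComp_isMonoidal f g := by
    have h₁ := B.map₂_isMonoidal (p.op.toPseudofunctor.mapComp f g).hom
    have h₂ := B.mapComp_isMonoidal (p.op.toPseudofunctor.map f) (p.op.toPseudofunctor.map g)
    exact NatTrans.IsMonoidal.comp (τ := (B.fib.map₂ (p.op.toPseudofunctor.mapComp f g).hom).toNatTrans)
      (τ' := (Cat.Hom.toNatIso (B.fib.mapComp (p.op.toPseudofunctor.map f)
        (p.op.toPseudofunctor.map g))).hom)
      (F₁ := (B.fib.map (p.op.toPseudofunctor.map (f ≫ g))).toFunctor)
      (F₂ := (B.fib.map (p.op.toPseudofunctor.map f ≫ p.op.toPseudofunctor.map g)).toFunctor)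
      (F₃ := (B.fib.map (p.op.toPseudofunctor.map f)).toFunctor ⋙
        (B.fib.map (p.op.toPseudofunctor.map g)).toFunctor)

end AbTensorFibration

end Fibrations

/-! ### Fibred categories, stacks and 2-descent data -/

section Descent

/-- The base change `p⁻¹ X` of a fibred category along a functor `p` between the bases. -/
abbrev baseChange {C : Type u} [Category.{v} C] {D : Type uY} [Category.{vY} D] (p : D ⥤ C)
    (X : Pseudofunctor (LocallyDiscrete Cᵒᵖ) Cat.{vX, uX}) :
    Pseudofunctor (LocallyDiscrete Dᵒᵖ) Cat.{vX, uX} :=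
  p.op.toPseudofunctor.comp X

/-- The fibre category `X_S`. -/
abbrev Fibre {C : Type u} [Category.{v} C]
    (X : Pseudofunctor (LocallyDiscrete Cᵒᵖ) Cat.{vX, uX}) (S : C) : Type uX :=
  X.obj (.mk (op S))

/-- The pull-back functor `f^* : X_S ⥤ X_S'`. -/
abbrev pull {C : Type u} [Category.{v} C]
    (X : Pseudofunctor (LocallyDiscrete Cᵒᵖ) Cat.{vX, uX}) {S S' : C} (f : S' ⟶ S) :
    Fibre X S ⥤ Fibre X S' :=
  (X.map f.op.toLoc).toFunctor

/-- A stack (in groupoids) for the topology `J`. -/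
structure IsStackInGroupoids {C : Type u} [Category.{v} C] (J : GrothendieckTopology C)
    (X : Pseudofunctor (LocallyDiscrete Cᵒᵖ) Cat.{vX, uX}) : Prop where
  isStack : X.IsStack J
  isGroupoid : ∀ S : C, IsGroupoid (Fibre X S)

/-- A morphism of fibred categories over `D` (a cartesian functor over `D`): functors between the
fibres, commuting with the pull-backs up to coherent natural isomorphisms. -/
structure FibredFunctor {D : Type u} [Category.{v} D]
    (X : Pseudofunctor (LocallyDiscrete Dᵒᵖ) Cat.{vX, uX})
    (Y : Pseudofunctor (LocallyDiscrete Dᵒᵖ) Cat.{vY, uY}) where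
  app : ∀ Z : D, Fibre X Z ⥤ Fibre Y Z
  nat : ∀ {Z Z' : D} (g : Z' ⟶ Z), pull X g ⋙ app Z' ≅ app Z ⋙ pull Y g
  nat_id : ∀ (Z : D) (x : Fibre X Z), (nat (𝟙 Z)).hom.app x =
    (app Z).map ((X.mapId (.mk (op Z))).hom.toNatTrans.app x) ≫
      (Y.mapId (.mk (op Z))).inv.toNatTrans.app ((app Z).obj x)
  nat_comp : ∀ {Z Z' Z'' : D} (g : Z' ⟶ Z) (g' : Z'' ⟶ Z') (x : Fibre X Z),
    (nat (g' ≫ g)).hom.app x =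
      (app Z'').map ((X.mapComp g.op.toLoc g'.op.toLoc).hom.toNatTrans.app x) ≫
        (nat g').hom.app ((pull X g).obj x) ≫
          (pull Y g').map ((nat g).hom.app x) ≫
            (Y.mapComp g.op.toLoc g'.op.toLoc).inv.toNatTrans.app ((app Z).obj x)

/-- A morphism of fibred categories is an equivalence if it is so on all fibres. -/
def FibredFunctor.IsEquiv {D : Type u} [Category.{v} D]
    {X : Pseudofunctor (LocallyDiscrete Dᵒᵖ) Cat.{vX, uX}}
    {Y : Pseudofunctor (LocallyDiscrete Dᵒᵖ) Cat.{vY, uY}} (F : FibredFunctor X Y) : Prop :=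
  ∀ Z : D, (F.app Z).IsEquivalence

variable {C : Type u} [Category.{v} C]

/-- Objects over both `T₁` and `T₂`.  As soon as the product `T₁ × T₂` exists this is the
category of objects over `T₁ × T₂`, see `Over₂.equivOver`. -/
structure Over₂ (T₁ T₂ : C) where
  pt : C
  fst : pt ⟶ T₁
  snd : pt ⟶ T₂

namespace Over₂

variable {T₁ T₂ : C}

@[ext]
structure Hom (Z' Z : Over₂ T₁ T₂) where
  hom : Z'.pt ⟶ Z.pt
  w₁ : hom ≫ Z.fst = Z'.fst
  w₂ : hom ≫ Z.snd = Z'.snd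

instance : Category (Over₂ T₁ T₂) where
  Hom := Hom
  id Z := ⟨𝟙 _, Category.id_comp _, Category.id_comp _⟩
  comp f g := ⟨f.hom ≫ g.hom, by rw [Category.assoc, g.w₁, f.w₁],
    by rw [Category.assoc, g.w₂, f.w₂]⟩
  id_comp f := Hom.ext (Category.id_comp f.hom)
  comp_id f := Hom.ext (Category.comp_id f.hom)
  assoc f g h := Hom.ext (Category.assoc f.hom g.hom h.hom)

/-- The morphism `(S', a ∘ g, b ∘ g) ⟶ (S, a, b)` given by `g : S' ⟶ S`. -/
def homMk {S S' : C} (g : S' ⟶ S) (a : S ⟶ T₁) (b : S ⟶ T₂) :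
    (⟨S', g ≫ a, g ≫ b⟩ : Over₂ T₁ T₂) ⟶ ⟨S, a, b⟩ :=
  Hom.mk g rfl rfl

variable (T₁ T₂)

/-- The functor induced by the first projection. -/
def pr₁ : Over₂ T₁ T₂ ⥤ Over T₁ where
  obj Z := Over.mk Z.fst
  map f := Over.homMk f.hom f.w₁

/-- The functor induced by the second projection. -/
def pr₂ : Over₂ T₁ T₂ ⥤ Over T₂ where
  obj Z := Over.mk Z.snd
  map f := Over.homMk f.hom f.w₂

/-- If the product exists, then `Over₂ T₁ T₂` is the category of objects over it. -/
noncomputable def equivOver [HasBinaryProduct T₁ T₂] : Over₂ T₁ T₂ ≌ Over (T₁ ⨯ T₂) where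
  functor :=
    { obj := fun Z => Over.mk (prod.lift Z.fst Z.snd)
      map := fun f => Over.homMk f.hom (by
        change f.hom ≫ prod.lift _ _ = prod.lift _ _
        rw [prod.comp_lift, f.w₁, f.w₂]) }
  inverse :=
    { obj := fun Z => ⟨Z.left, Z.hom ≫ prod.fst, Z.hom ≫ prod.snd⟩
      map := fun f => Hom.mk f.left (Over.w_assoc f _) (Over.w_assoc f _) }
  unitIso := NatIso.ofComponents (fun Z =>
    { hom := Hom.mk (𝟙 _) ((Category.id_comp _).trans (prod.lift_fst _ _))
        ((Category.id_comp _).trans (prod.lift_snd _ _))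
      inv := Hom.mk (𝟙 _) ((Category.id_comp _).trans (prod.lift_fst _ _).symm)
        ((Category.id_comp _).trans (prod.lift_snd _ _).symm)
      hom_inv_id := Hom.ext (Category.id_comp _)
      inv_hom_id := Hom.ext (Category.id_comp _) })
    (fun f => Hom.ext ((Category.comp_id _).trans (Category.id_comp _).symm))
  counitIso := NatIso.ofComponents (fun Z => Over.isoMk (Iso.refl _) (by
    apply Limits.prod.hom_ext
    · simpa using (prod.lift_fst (Z.hom ≫ prod.fst) (Z.hom ≫ prod.snd)).symm
    · simpa using (prod.lift_snd (Z.hom ≫ prod.fst) (Z.hom ≫ prod.snd)).symm)) (fun f => by ext; simp)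
  functor_unitIso_comp Z := by ext; simp

end Over₂

/-- The data of a triple `(X_i, χ_ij, φ_ijk)` with respect to a family of objects `T_i`
(thought of as a covering of a final object): fibred categories `X_i` over `C/T_i`, morphisms
`χ_ij : X_i|_ij ⟶ X_j|_ij` of fibred categories over `C/T_ij`, and, over every object `S` with
morphisms `a, b, c` to `T_i, T_j, T_k` (that is, an object over `T_ijk`), natural isomorphisms
`φ_ijk : χ_jk ∘ χ_ij ⇒ χ_ik`. -/
structure PreDescentDatum {ι : Type wι} (T : ι → C) where
  X : ∀ i, Pseudofunctor (LocallyDiscrete (Over (T i))ᵒᵖ) Cat.{vX, uX}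
  χ : ∀ i j, FibredFunctor (baseChange (Over₂.pr₁ (T i) (T j)) (X i))
    (baseChange (Over₂.pr₂ (T i) (T j)) (X j))
  φ : ∀ (i j k) {S : C} (a : S ⟶ T i) (b : S ⟶ T j) (c : S ⟶ T k),
    (χ i j).app ⟨S, a, b⟩ ⋙ (χ j k).app ⟨S, b, c⟩ ≅ (χ i k).app ⟨S, a, c⟩

/-- The triple `(X_i, χ_ij, φ_ijk)` is a 2-descent datum of stacks: the `X_i` are stacks over
`C/T_i`, the `χ_ij` are equivalences of stacks over `C/T_ij`, the `φ_ijk` are compatible with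
pull-backs (so that they are 2-isomorphisms over `C/T_ijk`), and over `C/T_ijkl` the two natural
isomorphisms `χ_kl ∘ χ_jk ∘ χ_ij ⇒ χ_il` obtained from the `φ` coincide. -/
structure IsTwoDescentDatum (J : GrothendieckTopology C) {ι : Type wι} {T : ι → C}
    (𝒟 : PreDescentDatum.{wι, v, u, vX, uX} T) : Prop where
  stack : ∀ i, IsStackInGroupoids (J.over (T i)) (𝒟.X i)
  equiv : ∀ i j, (𝒟.χ i j).IsEquiv
  pullback : ∀ (i j k) {S S' : C} (g : S' ⟶ S) (a : S ⟶ T i) (b : S ⟶ T j) (c : S ⟶ T k)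
    (x : Fibre (𝒟.X i) (Over.mk a)),
    (𝒟.φ i j k (g ≫ a) (g ≫ b) (g ≫ c)).hom.app
        ((pull (𝒟.X i) (Over.homMk g : Over.mk (g ≫ a) ⟶ Over.mk a)).obj x) ≫
        ((𝒟.χ i k).nat (Over₂.homMk g a c)).hom.app x =
      ((𝒟.χ j k).app ⟨S', g ≫ b, g ≫ c⟩).map (((𝒟.χ i j).nat (Over₂.homMk g a b)).hom.app x) ≫
        ((𝒟.χ j k).nat (Over₂.homMk g b c)).hom.app (((𝒟.χ i j).app ⟨S, a, b⟩).obj x) ≫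
        (pull (𝒟.X k) (Over.homMk g : Over.mk (g ≫ c) ⟶ Over.mk c)).map
          ((𝒟.φ i j k a b c).hom.app x)
  tetrahedron : ∀ (i j k l) {S : C} (a : S ⟶ T i) (b : S ⟶ T j) (c : S ⟶ T k) (d : S ⟶ T l)
    (x : Fibre (𝒟.X i) (Over.mk a)),
    ((𝒟.χ k l).app ⟨S, c, d⟩).map ((𝒟.φ i j k a b c).hom.app x) ≫ (𝒟.φ i k l a c d).hom.app x =
      (𝒟.φ j k l b c d).hom.app (((𝒟.χ i j).app ⟨S, a, b⟩).obj x) ≫ (𝒟.φ i j l a b d).hom.app x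

/-- A fibred category `Y` over `C` is glued from the triple `(X_i, χ_ij, φ_ijk)`: there are
equivalences `ψ_i : Y|_i ⟶ X_i` of fibred categories over `C/T_i`, together with 2-isomorphisms
`θ_ij : χ_ij ∘ ψ_i ⇒ ψ_j` over `C/T_ij` which are compatible with the `φ_ijk` over `C/T_ijk`. -/
structure Gluing {ι : Type wι} {T : ι → C} (𝒟 : PreDescentDatum.{wι, v, u, vX, uX} T)
    (Y : Pseudofunctor (LocallyDiscrete Cᵒᵖ) Cat.{vY, uY}) where
  ψ : ∀ i, FibredFunctor (baseChange (Over.forget (T i)) Y) (𝒟.X i)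
  ψ_equiv : ∀ i, (ψ i).IsEquiv
  θ : ∀ (i j) {S : C} (a : S ⟶ T i) (b : S ⟶ T j),
    (ψ i).app (Over.mk a) ⋙ (𝒟.χ i j).app ⟨S, a, b⟩ ≅ (ψ j).app (Over.mk b)
  θ_pullback : ∀ (i j) {S S' : C} (g : S' ⟶ S) (a : S ⟶ T i) (b : S ⟶ T j) (y : Fibre Y S),
    (θ i j (g ≫ a) (g ≫ b)).hom.app ((pull Y g).obj y) ≫
        ((ψ j).nat (Over.homMk g : Over.mk (g ≫ b) ⟶ Over.mk b)).hom.app y =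
      ((𝒟.χ i j).app ⟨S', g ≫ a, g ≫ b⟩).map
          (((ψ i).nat (Over.homMk g : Over.mk (g ≫ a) ⟶ Over.mk a)).hom.app y) ≫
        ((𝒟.χ i j).nat (Over₂.homMk g a b)).hom.app (((ψ i).app (Over.mk a)).obj y) ≫
        (pull (𝒟.X j) (Over.homMk g : Over.mk (g ≫ b) ⟶ Over.mk b)).map ((θ i j a b).hom.app y)
  θ_comp : ∀ (i j k) {S : C} (a : S ⟶ T i) (b : S ⟶ T j) (c : S ⟶ T k) (y : Fibre Y S),
    ((𝒟.χ j k).app ⟨S, b, c⟩).map ((θ i j a b).hom.app y) ≫ (θ j k b c).hom.app y =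
      (𝒟.φ i j k a b c).hom.app (((ψ i).app (Over.mk a)).obj y) ≫ (θ i k a c).hom.app y

end Descent

/-! ### Gluing the stacks of tensor functors out of `Rep G` -/

section Gerbe

section Precomposition

variable {D : Type u} [Category.{v} D] {D' : Type uY} [Category.{vY} D']
  (B : AbTensorFibration.{w, vB, uB} D) (p : D' ⥤ D)
  (A : Type u₁) [Category.{v₁} A] [MonoidalCategory A] [SymmetricCategory A]

theorem baseChange_mapId_hom_app (S : LocallyDiscrete D'ᵒᵖ)
    (F : TensorFunctor.{w} A (B.fib.obj (p.op.toPseudofunctor.obj S))) (a : A) :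
    (((baseChange p (B.homFib A)).mapId S).hom.toNatTrans.app F).iso.hom.app a =
      ((baseChange p B.fib).mapId S).hom.toNatTrans.app (F.toFunctor.obj a) :=
  congrArg₂ (· ≫ ·) (B.homMap₂_app A (p.op.toPseudofunctor.mapId S).hom F a)
    (B.homMapId_app A F a)

theorem baseChange_mapId_inv_app (S : LocallyDiscrete D'ᵒᵖ)
    (F : TensorFunctor.{w} A (B.fib.obj (p.op.toPseudofunctor.obj S))) (a : A) :
    (((baseChange p (B.homFib A)).mapId S).inv.toNatTrans.app F).iso.hom.app a =
      ((baseChange p B.fib).mapId S).inv.toNatTrans.app (F.toFunctor.obj a) :=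
  congrArg₂ (· ≫ ·) (B.homMapId_inv_app A F a)
    (B.homMap₂_app A (p.op.toPseudofunctor.mapId S).inv F a)

theorem baseChange_mapComp_hom_app {S S' S'' : LocallyDiscrete D'ᵒᵖ} (f : S ⟶ S') (g : S' ⟶ S'')
    (F : TensorFunctor.{w} A (B.fib.obj (p.op.toPseudofunctor.obj S))) (a : A) :
    (((baseChange p (B.homFib A)).mapComp f g).hom.toNatTrans.app F).iso.hom.app a =
      ((baseChange p B.fib).mapComp f g).hom.toNatTrans.app (F.toFunctor.obj a) :=
  congrArg₂ (· ≫ ·) (B.homMap₂_app A (p.op.toPseudofunctor.mapComp f g).hom F a)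
    (B.homMapComp_app A _ _ F a)

theorem baseChange_mapComp_inv_app {S S' S'' : LocallyDiscrete D'ᵒᵖ} (f : S ⟶ S') (g : S' ⟶ S'')
    (F : TensorFunctor.{w} A (B.fib.obj (p.op.toPseudofunctor.obj S))) (a : A) :
    (((baseChange p (B.homFib A)).mapComp f g).inv.toNatTrans.app F).iso.hom.app a =
      ((baseChange p B.fib).mapComp f g).inv.toNatTrans.app (F.toFunctor.obj a) :=
  congrArg₂ (· ≫ ·) (B.homMapComp_inv_app A _ _ F a)
    (B.homMap₂_app A (p.op.toPseudofunctor.mapComp f g).inv F a)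

end Precomposition

variable {C : Type u} [Category.{v} C] (B : AbTensorFibration.{w, vB, uB} C)

/-- The fibred category `A(B|_T)` over `C/T` of tensor functors from `A` to the fibres of the
restriction `B|_T` of `B` to `C/T`. -/
abbrev localHom (A : Type u₁) [Category.{v₁} A] [MonoidalCategory A] [SymmetricCategory A] (T : C) :
    Pseudofunctor (LocallyDiscrete (Over T)ᵒᵖ) Cat.{max u₁ vB, max u₁ v₁ vB uB} :=
  (B.restrict (Over.forget T)).homFib A

/-- For a tensor functor `H : A ⟶ A'`, the morphism `A'(B|_T₁)|_T₁₂ ⟶ A(B|_T₂)|_T₁₂` of fibred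
categories over `C/T₁₂` sending a tensor functor `F : A' ⟶ B_S` to `F ∘ H`. -/
def localPrecomp {A : Type u₁} [Category.{v₁} A] [MonoidalCategory A] [SymmetricCategory A]
    {A' : Type u₂} [Category.{v₂} A'] [MonoidalCategory A'] [SymmetricCategory A']
    (H : TensorFunctor.{w} A A') (T₁ T₂ : C) :
    FibredFunctor (baseChange (Over₂.pr₁ T₁ T₂) (localHom B A' T₁))
      (baseChange (Over₂.pr₂ T₁ T₂) (localHom B A T₂)) where
  app Z := TensorFunctor.precomp (B.fib.obj (.mk (op Z.pt))) H
  nat {Z Z'} g := TensorFunctor.precompPostcomp H (B.pullback g.hom.op.toLoc)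
  nat_id Z F := TensorFunctor.hom_ext fun a => by
    refine Eq.trans ?_ (congrArg₂ (· ≫ ·)
      (baseChange_mapId_hom_app (B.restrict (Over.forget T₁)) (Over₂.pr₁ T₁ T₂) A'
        (.mk (op Z)) F (H.toFunctor.obj a))
      (baseChange_mapId_inv_app (B.restrict (Over.forget T₂)) (Over₂.pr₂ T₁ T₂) A
        (.mk (op Z)) (H.comp F) a)).symm
    exact (congrArg (fun t => t.toNatTrans.app (F.toFunctor.obj (H.toFunctor.obj a)))
      ((baseChange (Over₂.pr₁ T₁ T₂) (B.restrict (Over.forget T₁)).fib).mapId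
        (.mk (op Z))).hom_inv_id).symm
  nat_comp {Z Z' Z''} g g' F := TensorFunctor.hom_ext fun a => by
    refine Eq.trans ?_ (congrArg₂ (· ≫ ·)
      (baseChange_mapComp_hom_app (B.restrict (Over.forget T₁)) (Over₂.pr₁ T₁ T₂) A'
        g.op.toLoc g'.op.toLoc F (H.toFunctor.obj a))
      (congrArg (𝟙 _ ≫ ·) (congrArg₂ (· ≫ ·) ((B.fib.map g'.hom.op.toLoc).toFunctor.map_id _)
        (baseChange_mapComp_inv_app (B.restrict (Over.forget T₂)) (Over₂.pr₂ T₁ T₂) A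
        g.op.toLoc g'.op.toLoc (H.comp F) a)))).symm
    exact ((congrArg (_ ≫ ·) ((Category.id_comp _).trans (Category.id_comp _))).trans
      (congrArg (fun t => t.toNatTrans.app (F.toFunctor.obj (H.toFunctor.obj a)))
        ((baseChange (Over₂.pr₁ T₁ T₂) (B.restrict (Over.forget T₁)).fib).mapComp
          g.op.toLoc g'.op.toLoc).hom_inv_id)).symm

/-! The tensor category of finite-dimensional representations of a finite group. -/

open MonoidalCategory in
/-- Restriction of actions along a homomorphism is a symmetric monoidal functor, the structure
isomorphisms being identities. -/
instance resBraided {V : Type u₁} [Category.{v₁} V] [MonoidalCategory V] [BraidedCategory V]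
    {G : Type u₂} {H : Type u₃} [Monoid G] [Monoid H] (f : G →* H) : (Action.res V f).Braided where
  __ := Functor.CoreMonoidal.toMonoidal (F := Action.res V f)
    { εIso := Action.mkIso (Iso.refl _)
        (fun _ => (Category.comp_id _).trans (Category.id_comp _).symm)
      μIso := fun _ _ => Action.mkIso (Iso.refl _)
        (fun _ => (Category.comp_id _).trans (Category.id_comp _).symm)
      μIso_hom_natural_left := fun _ _ =>
        Action.Hom.ext ((Category.comp_id _).trans (Category.id_comp _).symm)
      μIso_hom_natural_right := fun _ _ =>
        Action.Hom.ext ((Category.comp_id _).trans (Category.id_comp _).symm)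
      associativity := fun X Y Z => Action.Hom.ext
        (((congrArg₂ (· ≫ ·) (id_whiskerRight (X.V ⊗ Y.V) Z.V)
          (Category.id_comp _)).trans
            ((Category.id_comp _).trans (Action.associator_hom_hom X Y Z))).trans
          ((congrArg₂ (· ≫ ·) (Action.associator_hom_hom ((Action.res V f).obj X)
            ((Action.res V f).obj Y) ((Action.res V f).obj Z)) (congrArg (· ≫ 𝟙 _)
            (whiskerLeft_id X.V (Y.V ⊗ Z.V)))).trans
            ((congrArg (_ ≫ ·) (Category.id_comp _)).trans (Category.comp_id _))).symm)
      left_unitality := fun X => Action.Hom.ext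
        ((Action.leftUnitor_hom_hom ((Action.res V f).obj X)).trans
          ((congrArg₂ (· ≫ ·) (id_whiskerRight _ X.V) (Category.id_comp _)).trans
            ((Category.id_comp _).trans (Action.leftUnitor_hom_hom X))).symm)
      right_unitality := fun X => Action.Hom.ext
        ((Action.rightUnitor_hom_hom ((Action.res V f).obj X)).trans
          ((congrArg₂ (· ≫ ·) (whiskerLeft_id X.V _) (Category.id_comp _)).trans
            ((Category.id_comp _).trans (Action.rightUnitor_hom_hom X))).symm) }
  braided _ _ := Action.Hom.ext ((Category.id_comp _).trans (Category.comp_id _).symm)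

section Rep

variable (k : Type uk) [Field k] {G : Type uG} [Group G] [Finite G]

instance : AbelianTensorCategory.{w} (FDRep k G) where
  tensor_additive _ := inferInstance
  tensor_preservesColimits y :=
    have := BraidedCategory.exactPairing_swap y (yᘁ)
    (tensorLeftAdjunction (yᘁ) y).leftAdjoint_preservesColimits

/-- The tensor functor `κ(α) : ρ ↦ ρ ∘ α`. -/
def kappa (α : MulAut G) : TensorFunctor.{w} (FDRep k G) (FDRep k G) where
  toFunctor := Action.res (FGModuleCat k) (α : G →* G)
  braided := resBraided _
  preservesColimits :=
    inferInstanceAs (PreservesColimitsOfSize.{w, w} (Action.resEquiv (FGModuleCat k) α).functor)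

/-- If `α₂ ∘ α₁ = α₃ ∘ ι(β)` with `ι(β)(x) = β⁻¹xβ`, the isomorphism of representations
`ρ ∘ α₂ ∘ α₁ ⟶ ρ ∘ α₃` given by `ρ(α₃(β))`. -/
def muIso {α₁ α₂ α₃ : MulAut G} {β : G} (h : α₂ * α₁ = α₃ * MulAut.conj β⁻¹) (ρ : FDRep k G) :
    ((kappa.{w} k α₂).comp (kappa.{w} k α₁)).toFunctor.obj ρ ≅ (kappa.{w} k α₃).toFunctor.obj ρ :=
  Action.mkIso (Action.ρAut ρ (α₃ β)) fun g => by
    have h' : α₂ (α₁ g) = α₃ (β⁻¹ * g * β) := by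
      have := DFunLike.congr_fun h g
      simpa using this
    have e : α₃ β * α₂ (α₁ g) = α₃ g * α₃ β := by
      rw [h', ← map_mul, ← map_mul]; congr 1; group
    exact ((Action.ρ ρ).map_mul _ _).symm.trans
      ((congrArg (Action.ρ ρ) e).trans ((Action.ρ ρ).map_mul _ _))

/-- If `α₂ ∘ α₁ = α₃ ∘ ι(β)` with `ι(β)(x) = β⁻¹xβ`, the isomorphism of tensor functors
`κ(α₁) ∘ κ(α₂) ⟶ κ(α₃)` given on `ρ` by `ρ(α₃(β))`. -/
def mu {α₁ α₂ α₃ : MulAut G} {β : G} (h : α₂ * α₁ = α₃ * MulAut.conj β⁻¹) :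
    (kappa.{w} k α₂).comp (kappa.{w} k α₁) ⟶ kappa.{w} k α₃ where
  iso := NatIso.ofComponents (muIso.{w} k h) fun f => Action.Hom.ext (f.comm (α₃ β)).symm
  isMonoidal :=
    { unit := Action.Hom.ext
        ((congrArg (· ≫ _) (Category.comp_id _)).trans (Category.comp_id _))
      tensor := fun _ _ => Action.Hom.ext
        (((congrArg (· ≫ _) (Category.comp_id _)).trans (Category.id_comp _)).trans
          (Category.comp_id _).symm) }

/-- The triple `(A_G(B|_{T_i}), λ_ij, μ_ijk)` with `A_G` the tensor category of finite-dimensional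
representations of `G`: the morphism `χ_ij` sends a tensor functor `F : A_G ⟶ B_S` to
`F ∘ λ_ij`, where `λ_ij = κ(α_ij)`, and `φ_ijk` is given on `F` by
`F(μ_ijk) : F ∘ λ_ij ∘ λ_jk ⟶ F ∘ λ_ik`, where `(μ_ijk)_ρ = ρ(α_ik(β_ijk))`. -/
def gerbeDatum {ι : Type wι} (T : ι → C) (α : ι → ι → MulAut G) (β : ι → ι → ι → G)
    (h : ∀ a b c, α b c * α a b = α a c * MulAut.conj (β a b c)⁻¹) : PreDescentDatum T where
  X i := localHom B (FDRep k G) (T i)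
  χ i j := localPrecomp B (kappa.{w} k (α i j)) (T i) (T j)
  φ i j l {S} _ _ _ :=
    TensorFunctor.precompComp (mu.{w} k (h i j l)) (B.fib.obj (.mk (op S)))

end Rep

end Gerbe

end TensorStack

/-!
Write `λ_ij = κ(α_ij)` and `μ_ijk` for the functors and isomorphisms attached to `(α, β)`. The
conditions on `(α, β)` say that the `λ_ij` form a cocycle of tensor endofunctors of the category of
representations with multiplications `μ_ijk` (`groupCocycle`): the relation between the four
elements `β` is associativity of `μ`, and its instances with repeated indices say that `ρ(β_iii)`
is a unit `λ_ii ≅ id`. All further arguments work for any such cocycle `(H, m, u)` on any symmetric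
monoidal category `A`.

*The datum.* Tensor functors from `A` to a stack of tensor categories satisfy descent
(`homFib_isStackFor`): the values `F(a)` and the structure isomorphisms of `F` are glued separately,
the axioms of a monoidal functor can be checked after pull-back (`Detects`), and a cocone is a
colimit as soon as its pull-backs are (`isColimitOfSieve`). Composition with `H i j` has
composition with `H j i` as a quasi-inverse, because of the multiplications and the units, and the
two isomorphisms over quadruple products agree by associativity
(`cocycleDatum_isTwoDescentDatum`).

*The glued stack.* It is written down directly. A chart is an object `e` of the site together with
an index `i` and a morphism `e ⟶ T i`; a morphism of charts is any morphism of the underlying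
objects. On the category of charts there is a twisted fibred category, whose fibre at `e` consists
of the tensor functors `F : A ⟶ B_e` and in which the pull-back of `F` along `f : e' ⟶ e` is
`f^* ∘ F ∘ H i i'`; the cocycle provides the coherence isomorphisms. The glued stack is its
push-forward to the site: an object over `S` is a cartesian section over the charts with a morphism
to `S`.

*Descent.* After the choice of an index `i₀`, the functors `F ↦ F ∘ H i₀ i` identify the untwisted
fibred category with the twisted one (`frame`), so the latter satisfies descent for all sieves with
covering image. Push-forward along the functor `j` that forgets the chart preserves this
(`push_isStackFor`): a section of `j_* Z` over a sieve `R` on `S` is a section of `Z` over the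
restriction of `R` to charts (`expand_isEquivalence`), and such a section extends uniquely to all
charts over `S` because every morphism from a chart to `S` is covered by morphisms in `R`
(`Extend.isEquivalence`).

*The equivalences.* An object `p : S ⟶ T i` over `T i` is a chart through which every chart over `S`
factors, so by the Yoneda lemma a section over `S` is determined by its value at this chart
(`eval_yoneda_isEquivalence`). Evaluation is `ψ_i`. Two charts `S ⟶ T i` and `S ⟶ T j` on the same
object are connected by `id_S`, and the transition isomorphism of a section along it is `θ_ij`
(`Sec.theta`). The cocycle condition for the transition isomorphisms of a section then becomes the
required relation between `θ_ij`, `θ_jk`, `θ_ik` and `φ_ijk` (`Sec.theta_theta`).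
-/

namespace TensorStack

/-! ### Pull-back functors of a fibred category -/

section Pull

universe t
variable {D : Type u} [Category.{v} D] (F : Pseudofunctor (LocallyDiscrete Dᵒᵖ) Cat.{vX, uX})

/-- The coherence isomorphism `h^* x ≅ g^* f^* x` for a composite `h = f ∘ g`.  Allowing `h` to be
only propositionally equal to the composite spares all transports along associativity. -/
def pullComp {S S' S'' : D} (f : S' ⟶ S) (g : S'' ⟶ S') (h : S'' ⟶ S) (w : g ≫ f = h)
    (x : Fibre F S) : (pull F h).obj x ≅ (pull F g).obj ((pull F f).obj x) where
  hom := (F.mapComp' f.op.toLoc g.op.toLoc h.op.toLoc (by rw [← w]; rfl)).hom.toNatTrans.app x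
  inv := (F.mapComp' f.op.toLoc g.op.toLoc h.op.toLoc (by rw [← w]; rfl)).inv.toNatTrans.app x
  hom_inv_id := Cat.Hom.hom_inv_id_toNatTrans_app _ _
  inv_hom_id := Cat.Hom.inv_hom_id_toNatTrans_app _ _

/-- The coherence isomorphism `id^* x ≅ x`. -/
def pullId (S : D) (x : Fibre F S) : (pull F (𝟙 S)).obj x ≅ x where
  hom := (F.mapId (.mk (op S))).hom.toNatTrans.app x
  inv := (F.mapId (.mk (op S))).inv.toNatTrans.app x
  hom_inv_id := Cat.Hom.hom_inv_id_toNatTrans_app _ _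
  inv_hom_id := Cat.Hom.inv_hom_id_toNatTrans_app _ _

variable {F}

theorem pullComp_hom_eq {S S' S'' : D} (f : S' ⟶ S) (g : S'' ⟶ S') (x : Fibre F S) :
    (pullComp F f g (g ≫ f) rfl x).hom =
      (F.mapComp f.op.toLoc g.op.toLoc).hom.toNatTrans.app x :=
  congrArg (fun e => e.hom.toNatTrans.app x) (F.mapComp'_eq_mapComp f.op.toLoc g.op.toLoc)

theorem pullComp_inv_eq {S S' S'' : D} (f : S' ⟶ S) (g : S'' ⟶ S') (x : Fibre F S) :
    (pullComp F f g (g ≫ f) rfl x).inv =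
      (F.mapComp f.op.toLoc g.op.toLoc).inv.toNatTrans.app x :=
  congrArg (fun e => e.inv.toNatTrans.app x) (F.mapComp'_eq_mapComp f.op.toLoc g.op.toLoc)

theorem pullComp_hom_naturality {S S' S'' : D} (f : S' ⟶ S) (g : S'' ⟶ S') (h : S'' ⟶ S)
    (w : g ≫ f = h) {x y : Fibre F S} (a : x ⟶ y) :
    (pull F h).map a ≫ (pullComp F f g h w y).hom =
      (pullComp F f g h w x).hom ≫ (pull F g).map ((pull F f).map a) :=
  F.mapComp'_hom_naturality f.op.toLoc g.op.toLoc h.op.toLoc (by rw [← w]; rfl) a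

theorem pullComp_hom_naturality_assoc {S S' S'' : D} (f : S' ⟶ S) (g : S'' ⟶ S') (h : S'' ⟶ S)
    (w : g ≫ f = h) {x y : Fibre F S} (a : x ⟶ y) {z : Fibre F S''}
    (b : (pull F g).obj ((pull F f).obj y) ⟶ z) :
    (pull F h).map a ≫ (pullComp F f g h w y).hom ≫ b =
      (pullComp F f g h w x).hom ≫ (pull F g).map ((pull F f).map a) ≫ b :=
  (reassoc_of% (pullComp_hom_naturality f g h w a)) b

theorem pullComp_inv_naturality {S S' S'' : D} (f : S' ⟶ S) (g : S'' ⟶ S') (h : S'' ⟶ S)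
    (w : g ≫ f = h) {x y : Fibre F S} (a : x ⟶ y) :
    (pull F g).map ((pull F f).map a) ≫ (pullComp F f g h w y).inv =
      (pullComp F f g h w x).inv ≫ (pull F h).map a := by
  rw [Iso.comp_inv_eq, Category.assoc, pullComp_hom_naturality, Iso.inv_hom_id_assoc]

theorem pullComp_inv_naturality_assoc {S S' S'' : D} (f : S' ⟶ S) (g : S'' ⟶ S') (h : S'' ⟶ S)
    (w : g ≫ f = h) {x y : Fibre F S} (a : x ⟶ y) {z : Fibre F S''}
    (b : (pull F h).obj y ⟶ z) :
    (pull F g).map ((pull F f).map a) ≫ (pullComp F f g h w y).inv ≫ b =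
      (pullComp F f g h w x).inv ≫ (pull F h).map a ≫ b :=
  (reassoc_of% (pullComp_inv_naturality f g h w a)) b

theorem pullId_hom_naturality (S : D) {x y : Fibre F S} (a : x ⟶ y) :
    (pull F (𝟙 S)).map a ≫ (pullId F S y).hom = (pullId F S x).hom ≫ a :=
  (F.mapId (.mk (op S))).hom.toNatTrans.naturality a

theorem pullId_hom_naturality_assoc (S : D) {x y : Fibre F S} (a : x ⟶ y) {z : Fibre F S}
    (b : y ⟶ z) :
    (pull F (𝟙 S)).map a ≫ (pullId F S y).hom ≫ b = (pullId F S x).hom ≫ a ≫ b :=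
  (reassoc_of% (pullId_hom_naturality S a)) b

theorem pullId_inv_naturality (S : D) {x y : Fibre F S} (a : x ⟶ y) :
    a ≫ (pullId F S y).inv = (pullId F S x).inv ≫ (pull F (𝟙 S)).map a :=
  (F.mapId (.mk (op S))).inv.toNatTrans.naturality a

theorem pullId_inv_naturality_assoc (S : D) {x y : Fibre F S} (a : x ⟶ y) {z : Fibre F S}
    (b : (pull F (𝟙 S)).obj y ⟶ z) :
    a ≫ (pullId F S y).inv ≫ b = (pullId F S x).inv ≫ (pull F (𝟙 S)).map a ≫ b :=
  (reassoc_of% (pullId_inv_naturality S a)) b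

/-- The cocycle condition for the coherence isomorphisms. -/
theorem pullComp_assoc {S₀ S₁ S₂ S₃ : D} (f : S₁ ⟶ S₀) (g : S₂ ⟶ S₁) (k : S₃ ⟶ S₂)
    (gf : S₂ ⟶ S₀) (kg : S₃ ⟶ S₁) (h : S₃ ⟶ S₀) (w₁ : g ≫ f = gf) (w₂ : k ≫ g = kg)
    (w₃ : kg ≫ f = h) (w₄ : k ≫ gf = h) (x : Fibre F S₀) :
    (pullComp F f kg h w₃ x).hom ≫ (pullComp F g k kg w₂ ((pull F f).obj x)).hom =
      (pullComp F gf k h w₄ x).hom ≫ (pull F k).map (pullComp F f g gf w₁ x).hom :=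
  F.mapComp'₀₁₃_hom_comp_whiskerLeft_mapComp'_hom_app f.op.toLoc g.op.toLoc k.op.toLoc
    gf.op.toLoc kg.op.toLoc h.op.toLoc (by rw [← w₁]; rfl) (by rw [← w₂]; rfl)
    (by rw [← w₃]; rfl) x

theorem pullComp_comp_id {S S' : D} (f : S' ⟶ S) (w : 𝟙 S' ≫ f = f) (x : Fibre F S) :
    (pullComp F f (𝟙 S') f w x).hom = (pullId F S' ((pull F f).obj x)).inv :=
  F.mapComp'_comp_id_hom_app f.op.toLoc x

theorem pullComp_id_comp {S S' : D} (f : S' ⟶ S) (w : f ≫ 𝟙 S = f) (x : Fibre F S) :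
    (pullComp F (𝟙 S) f f w x).hom = (pull F f).map (pullId F S x).inv :=
  F.mapComp'_id_comp_hom_app f.op.toLoc x

theorem pullComp_comp_id_inv {S S' : D} (f : S' ⟶ S) (w : 𝟙 S' ≫ f = f) (x : Fibre F S) :
    (pullComp F f (𝟙 S') f w x).inv = (pullId F S' ((pull F f).obj x)).hom := by
  exact (Iso.inv_eq_inv (pullComp F f (𝟙 S') f w x) (pullId F S' ((pull F f).obj x)).symm).2
    (pullComp_comp_id f w x)

theorem pullComp_id_comp_inv {S S' : D} (f : S' ⟶ S) (w : f ≫ 𝟙 S = f) (x : Fibre F S) :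
    (pullComp F (𝟙 S) f f w x).inv = (pull F f).map (pullId F S x).hom :=
  (Iso.inv_eq_inv (pullComp F (𝟙 S) f f w x) ((pull F f).mapIso (pullId F S x)).symm).2
    (pullComp_id_comp f w x)

theorem pullComp_assoc_inv {S₀ S₁ S₂ S₃ : D} (f : S₁ ⟶ S₀) (g : S₂ ⟶ S₁) (k : S₃ ⟶ S₂)
    (gf : S₂ ⟶ S₀) (kg : S₃ ⟶ S₁) (h : S₃ ⟶ S₀) (w₁ : g ≫ f = gf) (w₂ : k ≫ g = kg)
    (w₃ : kg ≫ f = h) (w₄ : k ≫ gf = h) (x : Fibre F S₀) :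
    (pullComp F f kg h w₃ x).inv = (pullComp F g k kg w₂ ((pull F f).obj x)).hom ≫
      (pull F k).map (pullComp F f g gf w₁ x).inv ≫ (pullComp F gf k h w₄ x).inv := by
  symm
  rw [← Iso.hom_comp_eq_id, reassoc_of% (pullComp_assoc f g k gf kg h w₁ w₂ w₃ w₄ x),
    ← Functor.map_comp_assoc,
    Iso.hom_inv_id]
  simp

end Pull

/-! ### Cartesian sections -/

section Sections

universe t
variable {D : Type u} [Category.{v} D] (F : Pseudofunctor (LocallyDiscrete Dᵒᵖ) Cat.{vX, uX})

/-- A cartesian section of the fibred category `F` over the category of elements of a presheaf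
`Q`: an object `obj e q` of `F_e` for every `q ∈ Q(e)`, together with isomorphisms
`g^* (obj e q) ≅ obj e' q'` for all `g : e' ⟶ e` with `q' = g^* q`. -/
structure Sec (Q : Dᵒᵖ ⥤ Type t) where
  obj : ∀ e : D, Q.obj (op e) → Fibre F e
  tr : ∀ {e e' : D} (g : e' ⟶ e) (q : Q.obj (op e)) (q' : Q.obj (op e'))
    (_ : Q.map g.op q = q'), (pull F g).obj (obj e q) ≅ obj e' q'
  tr_id : ∀ (e : D) (q : Q.obj (op e)) (w : Q.map (𝟙 e).op q = q),
    (tr (𝟙 e) q q w).hom = (pullId F e (obj e q)).hom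
  tr_comp : ∀ {e e' e'' : D} (g : e' ⟶ e) (g' : e'' ⟶ e') (h : e'' ⟶ e) (w : g' ≫ g = h)
    (q : Q.obj (op e)) (q' : Q.obj (op e')) (q'' : Q.obj (op e''))
    (w₁ : Q.map g.op q = q') (w₂ : Q.map g'.op q' = q'') (w₃ : Q.map h.op q = q''),
    (tr h q q'' w₃).hom = (pullComp F g g' h w (obj e q)).hom ≫
      (pull F g').map (tr g q q' w₁).hom ≫ (tr g' q' q'' w₂).hom

namespace Sec

variable {F} {Q : Dᵒᵖ ⥤ Type t}

/-- A morphism of cartesian sections: morphisms of the values, compatible with the transition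
isomorphisms. -/
@[ext]
structure Hom (s s' : Sec F Q) where
  hom : ∀ (e : D) (q : Q.obj (op e)), s.obj e q ⟶ s'.obj e q
  comm : ∀ {e e' : D} (g : e' ⟶ e) (q : Q.obj (op e)) (q' : Q.obj (op e'))
    (w : Q.map g.op q = q'),
    (s.tr g q q' w).hom ≫ hom e' q' = (pull F g).map (hom e q) ≫ (s'.tr g q q' w).hom

instance : Category (Sec F Q) where
  Hom := Hom
  id s := ⟨fun _ _ => 𝟙 _, fun g q q' w => by
    rw [Category.comp_id, CategoryTheory.Functor.map_id, Category.id_comp]⟩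
  comp f f' := ⟨fun e q => f.hom e q ≫ f'.hom e q, fun g q q' w => by
    rw [reassoc_of% (f.comm g q q' w), f'.comm, Functor.map_comp, Category.assoc]⟩
  id_comp f := Hom.ext (funext fun e => funext fun q => Category.id_comp (f.hom e q))
  comp_id f := Hom.ext (funext fun e => funext fun q => Category.comp_id (f.hom e q))
  assoc f g h := Hom.ext (funext fun e => funext fun q =>
    Category.assoc (f.hom e q) (g.hom e q) (h.hom e q))

@[ext]
theorem hom_ext {s s' : Sec F Q} {f f' : s ⟶ s'} (h : ∀ e q, f.hom e q = f'.hom e q) : f = f' :=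
  Hom.ext (funext fun e => funext fun q => h e q)

/-- An isomorphism of cartesian sections is given by compatible isomorphisms. -/
def isoMk {s s' : Sec F Q} (i : ∀ (e : D) (q : Q.obj (op e)), s.obj e q ≅ s'.obj e q)
    (comm : ∀ {e e' : D} (g : e' ⟶ e) (q : Q.obj (op e)) (q' : Q.obj (op e'))
      (w : Q.map g.op q = q'),
      (s.tr g q q' w).hom ≫ (i e' q').hom =
        (pull F g).map (i e q).hom ≫ (s'.tr g q q' w).hom) : s ≅ s' where
  hom := ⟨fun e q => (i e q).hom, comm⟩
  inv := ⟨fun e q => (i e q).inv, fun g q q' w => by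
    rw [Iso.comp_inv_eq, Category.assoc, comm, ← Category.assoc, ← Functor.map_comp,
      Iso.inv_hom_id, CategoryTheory.Functor.map_id, Category.id_comp]⟩
  hom_inv_id := hom_ext fun e q => (i e q).hom_inv_id
  inv_hom_id := hom_ext fun e q => (i e q).inv_hom_id

variable (F Q) in
/-- Evaluation of cartesian sections at an element of the presheaf. -/
def eval (e : D) (q : Q.obj (op e)) : Sec F Q ⥤ Fibre F e where
  obj s := s.obj e q
  map f := f.hom e q

/-- The components of an isomorphism of cartesian sections. -/
abbrev isoApp {s s' : Sec F Q} (i : s ≅ s') (e : D) (q : Q.obj (op e)) :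
    s.obj e q ≅ s'.obj e q := (eval F Q e q).mapIso i

theorem hom_eqToHom {s s' : Sec F Q} (f : s ⟶ s') {e : D} {q q' : Q.obj (op e)} (h : q = q') :
    f.hom e q ≫ eqToHom (by rw [h]) = eqToHom (by rw [h]) ≫ f.hom e q' := by
  subst h; simp

/-- The inverses of the transition isomorphisms satisfy the cocycle condition too. -/
theorem tr_comp_inv (s : Sec F Q) {e e' e'' : D} (g : e' ⟶ e) (g' : e'' ⟶ e') (h : e'' ⟶ e)
    (w : g' ≫ g = h) (q : Q.obj (op e)) (q' : Q.obj (op e')) (q'' : Q.obj (op e''))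
    (w₁ : Q.map g.op q = q') (w₂ : Q.map g'.op q' = q'') (w₃ : Q.map h.op q = q'') :
    (s.tr h q q'' w₃).inv = (s.tr g' q' q'' w₂).inv ≫ (pull F g').map (s.tr g q q' w₁).inv ≫
      (pullComp F g g' h w (s.obj e q)).inv := by
  rw [Iso.inv_eq_inv _ ((pullComp F g g' h w (s.obj e q)) ≪≫ (pull F g').mapIso (s.tr g q q' w₁) ≪≫
    s.tr g' q' q'' w₂) |>.2 (s.tr_comp g g' h w q q' q'' w₁ w₂ w₃)]
  simp

/-- Transition along an identity, for equal but possibly not syntactically equal elements. -/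
theorem tr_id' (s : Sec F Q) {e : D} (q q' : Q.obj (op e)) (w : Q.map (𝟙 e).op q = q')
    (h : q = q') :
    (s.tr (𝟙 e) q q' w).hom = (pullId F e (s.obj e q)).hom ≫ eqToHom (by rw [h]) := by
  subst h
  rw [tr_id, eqToHom_refl, Category.comp_id]

theorem tr_eqToHom (s : Sec F Q) {e e' : D} (g : e' ⟶ e) (q : Q.obj (op e)) (q' q'' : Q.obj (op e'))
    (w : Q.map g.op q = q') (h : q' = q'') :
    (s.tr g q q' w).hom ≫ eqToHom (by rw [h]) = (s.tr g q q'' (w.trans h)).hom := by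
  subst h; simp

theorem eqToHom_tr (s : Sec F Q) {e e' : D} (g : e' ⟶ e) (q₁ q : Q.obj (op e))
    (q' : Q.obj (op e')) (w : Q.map g.op q = q') (h : q₁ = q) :
    (pull F g).map (eqToHom (by rw [h])) ≫ (s.tr g q q' w).hom =
      (s.tr g q₁ q' (by rw [h, w])).hom := by
  subst h; simp

end Sec

/-- An arrow of a sieve, as an element of the corresponding presheaf. -/
def sieveElt {S : D} (R : Sieve S) {X : D} (f : X ⟶ S) (hf : R f) : R.functor.obj (op X) := ⟨f, hf⟩

/-- The arrow underlying an element of the presheaf defined by a sieve. -/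
def arrow {S : D} {R : Sieve S} {X : D} (q : R.functor.obj (op X)) : X ⟶ S :=
  Subtype.val (p := fun g : X ⟶ S => R g) q

theorem arrow_mem {S : D} {R : Sieve S} {X : D} (q : R.functor.obj (op X)) : R (arrow q) :=
  Subtype.property (p := fun g : X ⟶ S => R g) q

theorem arrow_map {S : D} {R : Sieve S} {X Y : D} {g : Y ⟶ X} {q : R.functor.obj (op X)}
    {q' : R.functor.obj (op Y)} (w : R.functor.map g.op q = q') : g ≫ arrow q = arrow q' :=
  congrArg arrow w

theorem map_sieveElt {S : D} {R : Sieve S} {X Y : D} {g : Y ⟶ X} {f : X ⟶ S} (hf : R f)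
    {f' : Y ⟶ S} (w : g ≫ f = f') :
    R.functor.map g.op (sieveElt R f hf) = sieveElt R f' (w ▸ R.downward_closed hf g) :=
  Subtype.ext w

variable {F} in
/-- The cartesian section over a sieve on `S` formed by the pull-backs of an object of the fibre
over `S`. Effective descent for the sieve means that this functor is an equivalence, see
`isStackFor_iff`. -/
def toSec {S : D} (R : Sieve S) : Fibre F S ⥤ Sec F R.functor where
  obj x :=
    { obj := fun _ f => (pull F (arrow f)).obj x
      tr := fun g f f' w => (pullComp F (arrow f) g (arrow f') (arrow_map w) x).symm
      tr_id := fun _ f w => pullComp_comp_id_inv (arrow f) (arrow_map w) x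
      tr_comp := fun g g' h w f f' f'' w₁ w₂ w₃ =>
        pullComp_assoc_inv (arrow f) g g' (arrow f') h (arrow f'') (arrow_map w₁) w
          (arrow_map w₃) (arrow_map w₂) x }
  map a :=
    { hom := fun _ f => (pull F (arrow f)).map a
      comm := fun g f f' w => (pullComp_inv_naturality (arrow f) g (arrow f') (arrow_map w)
        a).symm }
  map_id _ := Sec.hom_ext fun _ f => (pull F (arrow f)).map_id _
  map_comp _ _ := Sec.hom_ext fun _ f => (pull F (arrow f)).map_comp _ _

end Sections

/-! ### Comparison with descent data -/

section Comparison

open Pseudofunctor.LocallyDiscreteOpToCat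

universe t
variable {D : Type u} [Category.{v} D] {F : Pseudofunctor (LocallyDiscrete Dᵒᵖ) Cat.{vX, uX}}

/-- Mathlib's pull-back of morphisms in descent data, in terms of `pullComp`. -/
theorem pullHom_eq {X₁ X₂ : D} {M₁ : Fibre F X₁} {M₂ : Fibre F X₂} {Y : D} {f₁ : Y ⟶ X₁}
    {f₂ : Y ⟶ X₂} (φ : (pull F f₁).obj M₁ ⟶ (pull F f₂).obj M₂) {Y' : D} (g : Y' ⟶ Y)
    (gf₁ : Y' ⟶ X₁) (gf₂ : Y' ⟶ X₂) (h₁ : g ≫ f₁ = gf₁) (h₂ : g ≫ f₂ = gf₂) :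
    pullHom φ g gf₁ gf₂ h₁ h₂ = (pullComp F f₁ g gf₁ h₁ M₁).hom ≫ (pull F g).map φ ≫
      (pullComp F f₂ g gf₂ h₂ M₂).inv := rfl

variable {S : D} {R : Sieve S}

namespace Sec

/-- The value of a section at an element of a sieve. -/
abbrev val (s : Sec F R.functor) {X : D} (f : X ⟶ S) (hf : R f) : Fibre F X :=
    s.obj X (sieveElt R f hf)

/-- The transition isomorphism of a section over a sieve. -/
abbrev trans (s : Sec F R.functor) {X Y : D} (g : Y ⟶ X) (f : X ⟶ S) (hf : R f) (f' : Y ⟶ S)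
    (w : g ≫ f = f') :
    (pull F g).obj (s.val f hf) ≅ s.val f' (w ▸ R.downward_closed hf g) :=
  s.tr g (sieveElt R f hf) (sieveElt R f' (w ▸ R.downward_closed hf g)) (map_sieveElt hf w)

theorem trans_comp (s : Sec F R.functor) {X Y Z : D} (g : Y ⟶ X) (g' : Z ⟶ Y) (h : Z ⟶ X)
    (w : g' ≫ g = h) (f : X ⟶ S) (hf : R f) (f' : Y ⟶ S) (hf' : R f') (f'' : Z ⟶ S)
    (w₁ : g ≫ f = f') (w₂ : g' ≫ f' = f'') (w₃ : h ≫ f = f'') :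
    (s.trans h f hf f'' w₃).hom = (pullComp F g g' h w _).hom ≫
      (pull F g').map (s.trans g f hf f' w₁).hom ≫ (s.trans g' f' hf' f'' w₂).hom :=
  s.tr_comp g g' h w _ _ _ _ _ _

theorem trans_comp_inv (s : Sec F R.functor) {X Y Z : D} (g : Y ⟶ X) (g' : Z ⟶ Y) (h : Z ⟶ X)
    (w : g' ≫ g = h) (f : X ⟶ S) (hf : R f) (f' : Y ⟶ S) (hf' : R f') (f'' : Z ⟶ S)
    (w₁ : g ≫ f = f') (w₂ : g' ≫ f' = f'') (w₃ : h ≫ f = f'') :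
    (s.trans h f hf f'' w₃).inv = (s.trans g' f' hf' f'' w₂).inv ≫
      (pull F g').map (s.trans g f hf f' w₁).inv ≫ (pullComp F g g' h w _).inv :=
  s.tr_comp_inv g g' h w _ _ _ _ _ _

end Sec

/-- The descent datum defined by a cartesian section over a sieve. -/
def Sec.toDescentData (s : Sec F R.functor) :
    F.DescentData (fun f : R.arrows.category => f.obj.hom) where
  obj f := s.val f.obj.hom f.property
  hom Y q f f' g g' w w' := (s.trans g f.obj.hom f.property q w).hom ≫
    (s.trans g' f'.obj.hom f'.property q w').inv
  pullHom_hom Y' Y g q q' hq f f' f₁ f₂ w₁ w₂ gf₁ gf₂ h₁ h₂ := by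
    rw [pullHom_eq]
    rw [s.trans_comp f₁ g gf₁ h₁ _ f.property q (w₁ ▸ R.downward_closed f.property f₁) q' w₁ hq
        (by rw [← h₁, Category.assoc, w₁, hq]),
      s.trans_comp_inv f₂ g gf₂ h₂ _ f'.property q (w₁ ▸ R.downward_closed f.property f₁) q' w₂ hq
        (by rw [← h₂, Category.assoc, w₂, hq])]
    simp
  hom_self Y q f g w := Iso.hom_inv_id _
  hom_comp Y q f f' f'' g g' g'' w w' w'' := by simp

variable (F R) in
/-- The functor from cartesian sections over a sieve to descent data for the arrows of the sieve. It
is an equivalence. -/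
def secToDescentData : Sec F R.functor ⥤
    F.DescentData (fun f : R.arrows.category => f.obj.hom) where
  obj s := s.toDescentData
  map {s s'} a :=
    { hom := fun f => a.hom _ (sieveElt R f.obj.hom f.property)
      comm := fun Y q f f' g g' w w' => by
        have h₁ := a.comm g (sieveElt R f.obj.hom f.property)
          (sieveElt R q (w ▸ R.downward_closed f.property g)) (map_sieveElt f.property w)
        have h₂ := a.comm g' (sieveElt R f'.obj.hom f'.property)
          (sieveElt R q (w' ▸ R.downward_closed f'.property g')) (map_sieveElt f'.property w')
        change (pull F g).map _ ≫ (s'.trans g _ f.property q w).hom ≫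
          (s'.trans g' _ f'.property q w').inv
          = ((s.trans g _ f.property q w).hom ≫ (s.trans g' _ f'.property q w').inv) ≫
            (pull F g').map _
        rw [← reassoc_of% h₁, Category.assoc]
        refine congrArg (_ ≫ ·) ?_
        rw [Iso.eq_inv_comp, reassoc_of% h₂, Iso.hom_inv_id, Category.comp_id] }

instance : (secToDescentData F R).Faithful where
  map_injective {s s'} _ _ h := Sec.hom_ext fun _ q =>
    congrArg (fun c : s.toDescentData ⟶ s'.toDescentData =>
      c.hom ⟨Over.mk (arrow q), arrow_mem q⟩) h

instance : (secToDescentData F R).Full where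
  map_surjective {s s'} b := by
    obtain ⟨β, hβ⟩ : ∃ β : ∀ e (q : R.functor.obj (op e)), s.obj e q ⟶ s'.obj e q,
      ∀ e q, β e q = b.hom ⟨Over.mk (arrow q), arrow_mem q⟩ := ⟨_, fun _ _ => rfl⟩
    refine ⟨⟨β, fun {_ e'} g q q' w => ?_⟩, ?_⟩
    · have h := b.comm (Y := e') (arrow q') (i₁ := ⟨Over.mk (arrow q), arrow_mem q⟩)
        (i₂ := ⟨Over.mk (arrow q'), arrow_mem q'⟩) g (𝟙 e') (arrow_map w) (Category.id_comp _)
      have w' : R.functor.map (𝟙 e').op q' = q' :=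
        map_sieveElt (arrow_mem q') (Category.id_comp _)
      replace h : (pull F g).map (β _ q) ≫ (s'.tr g q q' w).hom ≫ (s'.tr (𝟙 e') q' q' w').inv =
          ((s.tr g q q' w).hom ≫ (s.tr (𝟙 e') q' q' w').inv) ≫ (pull F (𝟙 e')).map (β _ q') := by
        rw [hβ, hβ]; exact h
      rw [← cancel_mono (s'.tr (𝟙 e') q' q' w').inv, Category.assoc, Category.assoc, h,
        Category.assoc]
      refine congrArg (_ ≫ ·) ?_
      rw [Iso.comp_inv_eq, Category.assoc, Iso.eq_inv_comp, Sec.tr_id, Sec.tr_id,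
        pullId_hom_naturality]
    · exact Pseudofunctor.DescentData.hom_ext fun f => hβ f.obj.left _

theorem pullHom_eq_of_id {X Y : D} {M₁ : Fibre F X} {M₂ : Fibre F Y} (f : Y ⟶ X)
    (φ : (pull F f).obj M₁ ⟶ (pull F (𝟙 Y)).obj M₂) {Y' : D} (g : Y' ⟶ Y) (h : Y' ⟶ X)
    (w : g ≫ f = h) :
    pullHom φ g h g w (Category.comp_id g) =
      (pullComp F f g h w M₁).hom ≫ (pull F g).map (φ ≫ (pullId F Y M₂).hom) := by
  rw [pullHom_eq, pullComp_id_comp_inv, Functor.map_comp]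

/-- The cartesian section defined by a descent datum for the arrows of a sieve. -/
def secOfDescentData (d : F.DescentData (fun f : R.arrows.category => f.obj.hom)) :
    Sec F R.functor where
  obj e q := d.obj ⟨Over.mk (arrow q), arrow_mem q⟩
  -- the isomorphism of the descent datum for the pair `(g, id)`
  tr {e e'} g q q' w := d.iso (i₁ := ⟨Over.mk (arrow q), arrow_mem q⟩)
    (i₂ := ⟨Over.mk (arrow q'), arrow_mem q'⟩) (arrow q') g (𝟙 e') (arrow_map w)
    (Category.id_comp _) ≪≫ pullId F e' (d.obj ⟨Over.mk (arrow q'), arrow_mem q'⟩)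
  tr_id e q w := (congrArg (· ≫ _) (d.hom_self _ _ (Category.id_comp _))).trans (Category.id_comp _)
  tr_comp {e e' e''} g g' h w q q' q'' w₁ w₂ w₃ := by
    have H := (pullHom_eq_of_id g _ g' h w).symm.trans
      (d.pullHom_hom g' (arrow q') (arrow q'') (arrow_map w₂)
        (i₁ := ⟨Over.mk (arrow q), arrow_mem q⟩) (i₂ := ⟨Over.mk (arrow q'), arrow_mem q'⟩)
        g (𝟙 e') (arrow_map w₁) (Category.id_comp _) h g' w (Category.comp_id _))
    have H' := d.hom_comp (arrow q'') (i₁ := ⟨Over.mk (arrow q), arrow_mem q⟩)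
      (i₂ := ⟨Over.mk (arrow q'), arrow_mem q'⟩) (i₃ := ⟨Over.mk (arrow q''), arrow_mem q''⟩)
      h g' (𝟙 e'') (arrow_map w₃) (arrow_map w₂) (Category.id_comp _)
    refine (congrArg (· ≫ _) (H'.symm.trans (congrArg (· ≫ _) H.symm))).trans ?_
    exact (Category.assoc _ _ _).trans (Category.assoc _ _ _)

instance : (secToDescentData F R).EssSurj where
  mem_essImage d := by
    refine ⟨secOfDescentData d, ⟨Pseudofunctor.DescentData.isoMk (fun f => Iso.refl (d.obj f)) ?_⟩⟩
    intro Y q f f' g g' w w'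
    have hq : R q := w ▸ R.downward_closed f.property g
    have H := d.hom_comp q (i₁ := f) (i₂ := ⟨Over.mk q, hq⟩)
      (i₃ := f') g (𝟙 Y) g' w (Category.id_comp _) w'
    refine (congrArg (· ≫ _) ((pull F g).map_id _)).trans ((Category.id_comp _).trans ?_)
    refine Eq.trans ?_ (congrArg (_ ≫ ·) ((pull F g').map_id _)).symm
    refine Eq.trans ?_ (Category.comp_id _).symm
    refine H.symm.trans ?_
    change _ = (d.hom q (i₂ := ⟨Over.mk q, hq⟩) g (𝟙 Y) w (Category.id_comp _) ≫
      (pullId F Y (d.obj ⟨Over.mk q, hq⟩)).hom) ≫ (pullId F Y (d.obj ⟨Over.mk q, hq⟩)).inv ≫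
        d.hom q (i₁ := ⟨Over.mk q, hq⟩) (𝟙 Y) g' (Category.id_comp _) w'
    refine Eq.trans ?_ (Category.assoc _ _ _).symm
    exact congrArg (_ ≫ ·) (Iso.hom_inv_id_assoc (pullId F Y _) _).symm

instance : (secToDescentData F R).IsEquivalence where

/-- A fibred category has effective descent for a sieve if and only if its objects are the same as
the cartesian sections over the sieve. -/
theorem isStackFor_iff : F.IsStackFor R.arrows ↔ (toSec (F := F) R).IsEquivalence := by
  rw [Pseudofunctor.isStackFor_iff]
  have e : toSec (F := F) R ⋙ secToDescentData F R ≅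
      F.toDescentData (fun f : R.arrows.category => f.obj.hom) := Iso.refl _
  rw [← Functor.isEquivalence_iff_of_iso e]
  exact ⟨fun _ => Functor.isEquivalence_of_comp_right _ (secToDescentData F R),
    fun _ => inferInstance⟩

end Comparison

/-! ### Base change of stacks along local equivalences -/

section BaseChange

open Pseudofunctor Pseudofunctor.LocallyDiscreteOpToCat

universe t
variable {C : Type u} [Category.{v} C] {D : Type u₁} [Category.{v₁} D]

/-- A functor `p : D ⥤ C` is a local equivalence if it is faithful and induces equivalences
`Over d ⥤ Over (p d)`. -/
structure IsLocalEquiv (p : D ⥤ C) : Prop where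
  faithful : p.Faithful
  lift_obj : ∀ {d : D} {Y : C} (q : Y ⟶ p.obj d),
    ∃ (d' : D) (q' : d' ⟶ d) (r : Y ≅ p.obj d'), r.hom ≫ p.map q' = q
  lift_map : ∀ {d d₁ d₂ : D} (g₁ : d₁ ⟶ d) (g₂ : d₂ ⟶ d) (h : p.obj d₁ ⟶ p.obj d₂),
    h ≫ p.map g₂ = p.map g₁ → ∃ g : d₁ ⟶ d₂, p.map g = h ∧ g ≫ g₂ = g₁

theorem isLocalEquiv_overForget (T : C) : IsLocalEquiv (Over.forget T) where
  faithful := inferInstance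
  lift_obj {d Y} q := ⟨Over.mk (q ≫ d.hom), Over.homMk q, Iso.refl Y, Category.id_comp _⟩
  lift_map g₁ g₂ h w := ⟨Over.homMk h (by
    rw [← Over.w g₂, ← Over.w g₁]
    exact (Category.assoc _ _ _).symm.trans (congrArg (· ≫ _) w)), rfl, Over.OverMorphism.ext w⟩

variable {p : D ⥤ C} {F : Pseudofunctor (LocallyDiscrete Cᵒᵖ) Cat.{vX, uX}}

theorem baseChange_pullComp_hom {S S' S'' : D} (f : S' ⟶ S) (g : S'' ⟶ S') (h : S'' ⟶ S)
    (w : g ≫ f = h) (w' : p.map g ≫ p.map f = p.map h) (x : Fibre F (p.obj S)) :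
    (pullComp (baseChange p F) f g h w x).hom =
      (pullComp F (p.map f) (p.map g) (p.map h) w' x).hom := by
  subst w
  refine (pullComp_hom_eq f g (F := baseChange p F) x).trans ?_
  exact congrArg (fun t => (F.map₂ t).toNatTrans.app x ≫
    (F.mapComp (p.map f).op.toLoc (p.map g).op.toLoc).hom.toNatTrans.app x) (Subsingleton.elim
      (α := (p.map (g ≫ f)).op.toLoc ⟶ (p.map f).op.toLoc ≫ (p.map g).op.toLoc) _ _)

theorem baseChange_pullComp_inv {S S' S'' : D} (f : S' ⟶ S) (g : S'' ⟶ S') (h : S'' ⟶ S)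
    (w : g ≫ f = h) (w' : p.map g ≫ p.map f = p.map h) (x : Fibre F (p.obj S)) :
    (pullComp (baseChange p F) f g h w x).inv =
      (pullComp F (p.map f) (p.map g) (p.map h) w' x).inv :=
  (Iso.inv_eq_inv (pullComp (baseChange p F) f g h w x)
    (pullComp F (p.map f) (p.map g) (p.map h) w' x)).2 (baseChange_pullComp_hom f g h w w' x)

theorem baseChange_pullHom {X₁ X₂ : D} {M₁ : Fibre F (p.obj X₁)} {M₂ : Fibre F (p.obj X₂)} {Y : D}
    {f₁ : Y ⟶ X₁} {f₂ : Y ⟶ X₂}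
    (φ : (pull F (p.map f₁)).obj M₁ ⟶ (pull F (p.map f₂)).obj M₂) {Y' : D} (g : Y' ⟶ Y)
    (gf₁ : Y' ⟶ X₁) (gf₂ : Y' ⟶ X₂) (h₁ : g ≫ f₁ = gf₁) (h₂ : g ≫ f₂ = gf₂) :
    pullHom (F := baseChange p F) (f₁ := f₁) (f₂ := f₂) φ g gf₁ gf₂ h₁ h₂ =
      pullHom (F := F) φ (p.map g) (p.map gf₁) (p.map gf₂) (by rw [← h₁, p.map_comp])
        (by rw [← h₂, p.map_comp]) :=
  congrArg₂ (fun a b => a ≫ (pull F (p.map g)).map φ ≫ b)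
    (baseChange_pullComp_hom f₁ g gf₁ h₁ (by rw [← h₁, p.map_comp]) M₁)
    (baseChange_pullComp_inv f₂ g gf₂ h₂ (by rw [← h₂, p.map_comp]) M₂)

theorem pullHom_naturality {X₁ X₂ : C} {M₁ N₁ : Fibre F X₁} {M₂ N₂ : Fibre F X₂} {Y : C}
    {f₁ : Y ⟶ X₁} {f₂ : Y ⟶ X₂} {φ : (pull F f₁).obj M₁ ⟶ (pull F f₂).obj M₂}
    {ψ : (pull F f₁).obj N₁ ⟶ (pull F f₂).obj N₂} {a : M₁ ⟶ N₁} {b : M₂ ⟶ N₂}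
    (H : (pull F f₁).map a ≫ ψ = φ ≫ (pull F f₂).map b) {Y' : C} (g : Y' ⟶ Y)
    (gf₁ : Y' ⟶ X₁) (gf₂ : Y' ⟶ X₂) (h₁ : g ≫ f₁ = gf₁) (h₂ : g ≫ f₂ = gf₂) :
    (pull F gf₁).map a ≫ pullHom ψ g gf₁ gf₂ h₁ h₂ =
      pullHom φ g gf₁ gf₂ h₁ h₂ ≫ (pull F gf₂).map b := by
  rw [pullHom_eq, pullHom_eq, pullComp_hom_naturality_assoc, ← Functor.map_comp_assoc, H,
    Functor.map_comp_assoc, pullComp_inv_naturality]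
  simp only [Category.assoc]

theorem pullHom_one {X : C} {M : Fibre F X} {Y : C} {f : Y ⟶ X} {Y' : C} (g : Y' ⟶ Y)
    (gf : Y' ⟶ X) (h : g ≫ f = gf) :
    pullHom (𝟙 ((pull F f).obj M)) g gf gf h h = 𝟙 _ := by
  rw [pullHom_eq, CategoryTheory.Functor.map_id, Category.id_comp, Iso.hom_inv_id]

theorem pullHom_comp {X₁ X₂ X₃ : C} {M₁ : Fibre F X₁} {M₂ : Fibre F X₂} {M₃ : Fibre F X₃} {Y : C}
    {f₁ : Y ⟶ X₁} {f₂ : Y ⟶ X₂} {f₃ : Y ⟶ X₃} (φ : (pull F f₁).obj M₁ ⟶ (pull F f₂).obj M₂)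
    (ψ : (pull F f₂).obj M₂ ⟶ (pull F f₃).obj M₃) {Y' : C} (g : Y' ⟶ Y) (gf₁ : Y' ⟶ X₁)
    (gf₂ : Y' ⟶ X₂) (gf₃ : Y' ⟶ X₃) (h₁ : g ≫ f₁ = gf₁) (h₂ : g ≫ f₂ = gf₂) (h₃ : g ≫ f₃ = gf₃) :
    pullHom φ g gf₁ gf₂ h₁ h₂ ≫ pullHom ψ g gf₂ gf₃ h₂ h₃ = pullHom (φ ≫ ψ) g gf₁ gf₃ h₁ h₃ := by
  simp only [pullHom_eq, Functor.map_comp, Category.assoc, Iso.inv_hom_id_assoc]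

variable {ι : Type t} {d : D} {X : ι → D} (f : ∀ i, X i ⟶ d)

/-- The descent datum for `p⁻¹ F` given by a descent datum for `F`. -/
def baseChangeDatum (s : F.DescentData (fun i => p.map (f i))) :
    (baseChange p F).DescentData f where
  obj := s.obj
  hom Y q i j a b w w' := s.hom (p.map q) (p.map a) (p.map b) (by rw [← p.map_comp, w])
    (by rw [← p.map_comp, w'])
  pullHom_hom Y' Y g q q' hq i j a b ha hb ga gb hga hgb :=
    (baseChange_pullHom _ g ga gb hga hgb).trans
      (s.pullHom_hom (p.map g) (p.map q) (p.map q') (by rw [← p.map_comp, hq]) (p.map a) (p.map b)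
        (by rw [← p.map_comp, ha]) (by rw [← p.map_comp, hb]) (p.map ga) (p.map gb)
        (by rw [← p.map_comp, hga]) (by rw [← p.map_comp, hgb]))
  hom_self _ q i g w := s.hom_self (p.map q) (p.map g) (by rw [← p.map_comp, w])
  hom_comp _ q i j l a b c ha hb hc := s.hom_comp (p.map q) (p.map a) (p.map b) (p.map c)
    (by rw [← p.map_comp, ha]) (by rw [← p.map_comp, hb]) (by rw [← p.map_comp, hc])

variable (F) in
/-- Restriction of descent data along `p`. -/
def baseChangeDescentData : F.DescentData (fun i => p.map (f i)) ⥤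
    (baseChange p F).DescentData f where
  obj s := baseChangeDatum f s
  map c :=
    { hom := fun i => c.hom i
      comm := fun Y q i j a b ha hb => c.comm (p.map q) (p.map a) (p.map b)
        (by rw [← p.map_comp, ha]) (by rw [← p.map_comp, hb]) }

instance : (baseChangeDescentData (p := p) F f).Faithful where
  map_injective {s s'} _ _ h := Pseudofunctor.DescentData.hom_ext fun i =>
    congrArg (fun c : baseChangeDatum f s ⟶ baseChangeDatum f s' => c.hom i) h

/-- Arrows over `p d` lift to arrows over `d`, together with factorisations. -/
theorem IsLocalEquiv.exists_lift (hp : IsLocalEquiv p) {Y : C} {q : Y ⟶ p.obj d} {i j : ι}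
    {a : Y ⟶ p.obj (X i)} {b : Y ⟶ p.obj (X j)} (ha : a ≫ p.map (f i) = q)
    (hb : b ≫ p.map (f j) = q) :
    ∃ (Y' : D) (q' : Y' ⟶ d) (r : Y ≅ p.obj Y') (a' : Y' ⟶ X i) (b' : Y' ⟶ X j),
      r.hom ≫ p.map q' = q ∧ a' ≫ f i = q' ∧ b' ≫ f j = q' ∧ r.hom ≫ p.map a' = a ∧
        r.hom ≫ p.map b' = b := by
  obtain ⟨Y', q', r, h⟩ := hp.lift_obj q
  obtain ⟨a', h₁, h₂⟩ := hp.lift_map q' (f i) (r.inv ≫ a) (by rw [Category.assoc, ha, ← h]; simp)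
  obtain ⟨b', h₃, h₄⟩ := hp.lift_map q' (f j) (r.inv ≫ b) (by rw [Category.assoc, hb, ← h]; simp)
  exact ⟨Y', q', r, a', b', h, h₂, h₄, by simp [h₁], by simp [h₃]⟩

/-- Every morphism of descent data over `p⁻¹ F` is compatible with the transition morphisms over all
objects of `C`, since these come from objects of `D`. -/
theorem IsLocalEquiv.full (hp : IsLocalEquiv p) : (baseChangeDescentData (p := p) F f).Full where
  map_surjective {s s'} c := by
    refine ⟨⟨fun i => c.hom i, fun Y q i j a b ha hb => ?_⟩, rfl⟩
    obtain ⟨Y', q', r, a', b', h, h₁, h₂, rfl, rfl⟩ := hp.exists_lift f ha hb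
    have ha' : p.map a' ≫ p.map (f i) = p.map q' := by rw [← p.map_comp, h₁]
    have hb' : p.map b' ≫ p.map (f j) = p.map q' := by rw [← p.map_comp, h₂]
    rw [← s.pullHom_hom r.hom (p.map q') q h (p.map a') (p.map b') ha' hb' _ _ rfl rfl,
      ← s'.pullHom_hom r.hom (p.map q') q h (p.map a') (p.map b') ha' hb' _ _ rfl rfl]
    exact pullHom_naturality (F := F) (f₁ := p.map a') (f₂ := p.map b') (c.comm q' a' b' h₁ h₂)
      r.hom _ _ rfl rfl

/-- A descent datum for `p⁻¹ F` determines transition morphisms over all objects `Y` of `C`: an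
object `Y` over `p d` is isomorphic to the image of an object of `D`, and the transition morphism
obtained from it does not depend on the choice. -/
theorem IsLocalEquiv.exists_hom (hp : IsLocalEquiv p) (s : (baseChange p F).DescentData f) {Y : C}
    (q : Y ⟶ p.obj d) {i j : ι}
    (a : Y ⟶ p.obj (X i)) (b : Y ⟶ p.obj (X j)) (ha : a ≫ p.map (f i) = q)
    (hb : b ≫ p.map (f j) = q) :
    ∃ φ : (pull F a).obj (s.obj i) ⟶ (pull F b).obj (s.obj j),
      ∀ (Y' : D) (q' : Y' ⟶ d) (r : Y ⟶ p.obj Y') (a' : Y' ⟶ X i) (b' : Y' ⟶ X j)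
        (ha' : a' ≫ f i = q') (hb' : b' ≫ f j = q') (_ : r ≫ p.map q' = q)
        (h₁ : r ≫ p.map a' = a) (h₂ : r ≫ p.map b' = b),
        pullHom (F := F) (f₁ := p.map a') (f₂ := p.map b') (s.hom q' a' b' ha' hb') r a b h₁ h₂ =
          φ := by
  obtain ⟨Y', q', r, a', b', h, h₁, h₂, h₃, h₄⟩ := hp.exists_lift f ha hb
  refine ⟨pullHom (F := F) (f₁ := p.map a') (f₂ := p.map b') (s.hom q' a' b' h₁ h₂) r.hom a b h₃ h₄,
    fun Z q'' r' a'' b'' ha'' hb'' h' h₁' h₂' => ?_⟩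
  obtain ⟨k, hk, hk'⟩ := hp.lift_map q' q'' (r.inv ≫ r') (by
    rw [Category.assoc, h', ← h, Iso.inv_hom_id_assoc])
  have := hp.faithful
  have ka : k ≫ a'' = a' := p.map_injective (by
    rw [p.map_comp, hk, Category.assoc, h₁', ← h₃, Iso.inv_hom_id_assoc])
  have kb : k ≫ b'' = b' := p.map_injective (by
    rw [p.map_comp, hk, Category.assoc, h₂', ← h₄, Iso.inv_hom_id_assoc])
  have e := (baseChange_pullHom _ k a' b' ka kb).symm.trans
    (s.pullHom_hom k q'' q' hk' a'' b'' ha'' hb'' a' b' ka kb)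
  have e' : r.hom ≫ p.map k = r' := by rw [hk, Iso.hom_inv_id_assoc]
  subst e'
  exact (pullHom_pullHom (F := F) (f₁ := p.map a'') (f₂ := p.map b'') (s.hom q'' a'' b'' ha'' hb'')
    (p.map k) (p.map a') (p.map b') r.hom a b (by rw [← p.map_comp, ka]) (by rw [← p.map_comp, kb])
    h₃ h₄).symm.trans
      (congrArg (fun t => pullHom (F := F) (f₁ := p.map a') (f₂ := p.map b') t r.hom a b h₃ h₄) e)

theorem IsLocalEquiv.essSurj (hp : IsLocalEquiv p) :
    (baseChangeDescentData (p := p) F f).EssSurj where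
  mem_essImage s := by
    choose φ hφ using fun (Y : C) (q : Y ⟶ p.obj d) (i j : ι) (a : Y ⟶ p.obj (X i))
      (b : Y ⟶ p.obj (X j)) (ha : a ≫ p.map (f i) = q) (hb : b ≫ p.map (f j) = q) =>
      hp.exists_hom f s q a b ha hb
    let s' : F.DescentData (fun i => p.map (f i)) :=
      { obj := s.obj
        hom := fun Y q i j a b ha hb => φ Y q i j a b ha hb
        pullHom_hom := fun Y' Y g q q' hq i j a b ha hb ga gb hga hgb => by
          obtain ⟨Z, q'', r, a', b', h, h₁, h₂, h₃, h₄⟩ := hp.exists_lift f ha hb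
          rw [← hφ Y q i j a b ha hb Z q'' r.hom a' b' h₁ h₂ h h₃ h₄]
          refine (pullHom_pullHom (F := F) (f₁ := p.map a') (f₂ := p.map b')
            (s.hom q'' a' b' h₁ h₂) r.hom a b g ga gb h₃ h₄ hga hgb).trans ?_
          exact hφ Y' q' i j ga gb _ _ Z q'' (g ≫ r.hom) a' b' h₁ h₂
            (by rw [Category.assoc, h, hq]) _ _
        hom_self := fun Y q i g w => by
          obtain ⟨Z, q', r, a', b', h, h₁, h₂, h₃, h₄⟩ := hp.exists_lift f w w
          rw [← hφ Y q i i g g w w Z q' r.hom a' a' h₁ h₁ h h₃ h₃, s.hom_self q' a' h₁]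
          exact pullHom_one _ _ _
        hom_comp := fun Y q i j l a b c ha hb hc => by
          obtain ⟨Z, q', r, a', b', h, h₁, h₂, h₃, h₄⟩ := hp.exists_lift f ha hb
          obtain ⟨c', h₅, h₆⟩ := hp.lift_map q' (f l) (r.inv ≫ c) (by
            rw [Category.assoc, hc, ← h]; simp)
          have h₇ : r.hom ≫ p.map c' = c := by simp [h₅]
          rw [← hφ Y q i j a b ha hb Z q' r.hom a' b' h₁ h₂ h h₃ h₄,
            ← hφ Y q j l b c hb hc Z q' r.hom b' c' h₂ h₆ h h₄ h₇,
            ← hφ Y q i l a c ha hc Z q' r.hom a' c' h₁ h₆ h h₃ h₇,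
            ← s.hom_comp q' a' b' c' h₁ h₂ h₆]
          exact pullHom_comp _ _ _ _ _ _ _ _ _ }
    refine ⟨s', ⟨Pseudofunctor.DescentData.isoMk (fun i => Iso.refl _) ?_⟩⟩
    intro Y q i j a b ha hb
    have H := hφ (p.obj Y) (p.map q) i j (p.map a) (p.map b) (by rw [← p.map_comp, ha])
      (by rw [← p.map_comp, hb]) Y q (𝟙 _) a b ha hb (Category.id_comp _) (Category.id_comp _)
      (Category.id_comp _)
    replace H := (pullHom_id (F := F) (f₁ := p.map a) (f₂ := p.map b)
      (s.hom q a b ha hb)).symm.trans H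
    refine (congrArg (· ≫ _) ((pull F (p.map a)).map_id _)).trans ((Category.id_comp _).trans ?_)
    refine Eq.trans ?_ (congrArg (_ ≫ ·) ((pull F (p.map b)).map_id _)).symm
    exact H.trans (Category.comp_id _).symm

/-- Restriction along a local equivalence preserves effectivity of descent. -/
theorem IsLocalEquiv.isStackFor (hp : IsLocalEquiv p) (R : Sieve d)
    (h : (F.toDescentData (fun g : R.arrows.category => p.map g.obj.hom)).IsEquivalence) :
    (baseChange p F).IsStackFor R.arrows := by
  rw [Pseudofunctor.isStackFor_iff]
  have := hp.full (F := F) (fun g : R.arrows.category => g.obj.hom)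
  have := hp.essSurj (F := F) (fun g : R.arrows.category => g.obj.hom)
  have : (baseChangeDescentData (p := p) F
      (fun g : R.arrows.category => g.obj.hom)).IsEquivalence := { }
  have : (F.toDescentData (fun g : R.arrows.category => p.map g.obj.hom) ⋙
      baseChangeDescentData (p := p) F (fun g : R.arrows.category => g.obj.hom)).IsEquivalence :=
    Functor.isEquivalence_trans _ _
  refine Functor.isEquivalence_of_iso (F := F.toDescentData (fun g : R.arrows.category =>
    p.map g.obj.hom) ⋙ baseChangeDescentData (p := p) F (fun g : R.arrows.category => g.obj.hom))
    (NatIso.ofComponents (fun x => Pseudofunctor.DescentData.isoMk (fun i => Iso.refl _) ?_) ?_)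
  · intro Y q i j a b ha hb
    refine (congrArg (· ≫ _) ((pull F (p.map a)).map_id _)).trans ((Category.id_comp _).trans ?_)
    refine Eq.trans ?_ (congrArg (_ ≫ ·) ((pull F (p.map b)).map_id _)).symm
    refine Eq.trans ?_ (Category.comp_id _).symm
    exact congrArg₂ (· ≫ ·)
      (baseChange_pullComp_inv (F := F) i.obj.hom a q ha (by rw [← p.map_comp, ha]) x)
      (baseChange_pullComp_hom (F := F) j.obj.hom b q hb (by rw [← p.map_comp, hb]) x)
  · intro x y c
    exact Pseudofunctor.DescentData.hom_ext fun i =>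
      (Category.comp_id _).trans (Category.id_comp _).symm

/-- The base change of a stack along a local equivalence has effective descent for all sieves
whose image is covering. -/
theorem IsLocalEquiv.isStackFor_of_isStack (hp : IsLocalEquiv p) (J : GrothendieckTopology C)
    (hF : F.IsStack J) (R : Sieve d) (hR : R.functorPushforward p ∈ J (p.obj d)) :
    (baseChange p F).IsStackFor R.arrows := by
  refine hp.isStackFor R (F.isEquivalence_toDescentData (J := J) _ (J.superset_covering ?_ hR))
  rintro Y _ ⟨Z, g, h, hg, rfl⟩
  exact Sieve.downward_closed _ (Sieve.ofArrows_mk _ (fun g : R.arrows.category => p.map g.obj.hom)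
    ⟨Over.mk g, hg⟩) h

end BaseChange

/-! ### Descent for tensor functors -/

section Hom

variable {D : Type u} [Category.{v} D] (B : AbTensorFibration.{w, vB, uB} D)
  {A : Type u₁} [Category.{v₁} A] [MonoidalCategory A] [SymmetricCategory A]

theorem TensorFunctor.iso_inv_app {A' : Type u₂} [Category.{v₂} A'] [MonoidalCategory A']
    [SymmetricCategory A'] {H K : TensorFunctor.{w} A A'} (i : H ≅ K) (a : A) :
    i.inv.iso.hom.app a = i.hom.iso.inv.app a := by
  rw [← cancel_epi (i.hom.iso.hom.app a), Iso.hom_inv_id_app]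
  exact congrArg (fun t : H ⟶ H => t.iso.hom.app a) i.hom_inv_id

theorem homFib_pullComp_hom_app {S S' S'' : D} (f : S' ⟶ S) (g : S'' ⟶ S') (h : S'' ⟶ S)
    (w : g ≫ f = h) (x : Fibre (B.homFib A) S) (a : A) :
    (pullComp (B.homFib A) f g h w x).hom.iso.hom.app a =
      (pullComp B.fib f g h w (x.toFunctor.obj a)).hom := by
  subst w
  refine (congrArg (fun t => TensorFunctor.Hom.iso t |>.hom.app a)
    (pullComp_hom_eq (F := B.homFib A) f g x)).trans ?_
  exact (B.homMapComp_app A _ _ x a).trans (pullComp_hom_eq (F := B.fib) f g _).symm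

theorem homFib_pullId_hom_app (S : D) (x : Fibre (B.homFib A) S) (a : A) :
    (pullId (B.homFib A) S x).hom.iso.hom.app a = (pullId B.fib S (x.toFunctor.obj a)).hom :=
  B.homMapId_app A x a

theorem homFib_pullComp_inv_app {S S' S'' : D} (f : S' ⟶ S) (g : S'' ⟶ S') (h : S'' ⟶ S)
    (w : g ≫ f = h) (x : Fibre (B.homFib A) S) (a : A) :
    (pullComp (B.homFib A) f g h w x).inv.iso.hom.app a =
      (pullComp B.fib f g h w (x.toFunctor.obj a)).inv := by
  refine (TensorFunctor.iso_inv_app (pullComp (B.homFib A) f g h w x) a).trans ?_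
  exact (Iso.inv_eq_inv ((pullComp (B.homFib A) f g h w x).hom.iso.app a)
    (pullComp B.fib f g h w (x.toFunctor.obj a))).2 (homFib_pullComp_hom_app B f g h w x a)

variable {B}

/-- A section of tensor functors sends every object to a section. -/
def Sec.evalAt {Q : Dᵒᵖ ⥤ Type uX} (s : Sec (B.homFib A) Q) : A ⥤ Sec B.fib Q where
  obj a :=
    { obj := fun e q => (s.obj e q).toFunctor.obj a
      tr := fun g q q' w => (s.tr g q q' w).hom.iso.app a
      tr_id := fun e q w => (congrArg (fun t => TensorFunctor.Hom.iso t |>.hom.app a)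
        (s.tr_id e q w)).trans (homFib_pullId_hom_app B e _ a)
      tr_comp := fun g g' h w q q' q'' w₁ w₂ w₃ =>
        (congrArg (fun t => TensorFunctor.Hom.iso t |>.hom.app a)
          (s.tr_comp g g' h w q q' q'' w₁ w₂ w₃)).trans
            (congrArg (· ≫ _) (homFib_pullComp_hom_app B g g' h w _ a)) }
  map f :=
    { hom := fun e q => (s.obj e q).toFunctor.map f
      comm := fun g q q' w => ((s.tr g q q' w).hom.iso.hom.naturality f).symm }
  map_id a := Sec.hom_ext fun e q => (s.obj e q).toFunctor.map_id a
  map_comp f g := Sec.hom_ext fun e q => (s.obj e q).toFunctor.map_comp f g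

open Functor.LaxMonoidal Functor.OplaxMonoidal MonoidalCategory

theorem pullComp_tensor {S S' S'' : D} (f : S' ⟶ S) (g : S'' ⟶ S') (h : S'' ⟶ S)
    (w : g ≫ f = h) (x y : Fibre B.fib S) :
    μ (pull B.fib h) x y ≫ (pullComp B.fib f g h w (x ⊗ y)).hom =
      ((pullComp B.fib f g h w x).hom ⊗ₘ (pullComp B.fib f g h w y).hom) ≫
        μ (pull B.fib g) _ _ ≫ (pull B.fib g).map (μ (pull B.fib f) x y) := by
  subst w
  have := (B.mapComp_isMonoidal f.op.toLoc g.op.toLoc).tensor x y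
  rw [pullComp_hom_eq, pullComp_hom_eq, pullComp_hom_eq]
  exact this

theorem pullComp_unit {S S' S'' : D} (f : S' ⟶ S) (g : S'' ⟶ S') (h : S'' ⟶ S)
    (w : g ≫ f = h) :
    ε (pull B.fib h) ≫ (pullComp B.fib f g h w (𝟙_ _)).hom =
      ε (pull B.fib g) ≫ (pull B.fib g).map (ε (pull B.fib f)) := by
  subst w
  have := (B.mapComp_isMonoidal f.op.toLoc g.op.toLoc).unit
  rw [pullComp_hom_eq]
  exact this

end Hom

/-! ### Monoidal structures detected by a monoidal functor -/

section Detect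

open Functor.LaxMonoidal Functor.OplaxMonoidal Functor.Monoidal MonoidalCategory

variable {A : Type u₁} [Category.{v₁} A] [MonoidalCategory A]
  {M : Type u₂} [Category.{v₂} M] [MonoidalCategory M]
  {N : Type u₃} [Category.{v₃} N] [MonoidalCategory N]
  (F : A ⥤ M) (P : M ⥤ N) [P.Monoidal] (G : A ⥤ N)
  (c : ∀ a, P.obj (F.obj a) ≅ G.obj a)
  (e : 𝟙_ M ⟶ F.obj (𝟙_ A))
  (m : ∀ a b, F.obj a ⊗ F.obj b ⟶ F.obj (a ⊗ b))

/-- The compatibility of an isomorphism `c : P ∘ F ≅ G` with candidates `e` and `m` for the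
structure morphisms of a monoidal functor `F`. It implies that `e` and `m` satisfy the axioms of a
monoidal functor after application of `P`. -/
structure Detects [G.LaxMonoidal] : Prop where
  nat : ∀ {a b : A} (f : a ⟶ b), P.map (F.map f) ≫ (c b).hom = (c a).hom ≫ G.map f
  unit : ε P ≫ P.map e ≫ (c (𝟙_ A)).hom = ε G
  tensor : ∀ a b, μ P (F.obj a) (F.obj b) ≫ P.map (m a b) ≫ (c (a ⊗ b)).hom =
    ((c a).hom ⊗ₘ (c b).hom) ≫ μ G a b

namespace Detects

variable {F P G c e m} [G.LaxMonoidal]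

theorem tensor_assoc (h : Detects F P G c e m) (a b : A) {n : N} (f : G.obj (a ⊗ b) ⟶ n) :
    μ P (F.obj a) (F.obj b) ≫ P.map (m a b) ≫ (c (a ⊗ b)).hom ≫ f =
      ((c a).hom ⊗ₘ (c b).hom) ≫ μ G a b ≫ f := by
  simpa only [Category.assoc] using congrArg (· ≫ f) (h.tensor a b)

theorem map_natural_left (h : Detects F P G c e m) {a b : A} (f : a ⟶ b) (x : A) :
    P.map (F.map f ▷ F.obj x ≫ m b x) = P.map (m a x ≫ F.map (f ▷ x)) := by
  rw [← cancel_epi (μ P (F.obj a) (F.obj x)), ← cancel_mono (c (b ⊗ x)).hom]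
  simp only [Functor.map_comp, Category.assoc]
  rw [h.nat, h.tensor_assoc, ← μ_natural_left, ← μ_natural_left_assoc, h.tensor]
  rw [← tensorHom_id, ← tensorHom_id, tensorHom_comp_tensorHom_assoc,
    tensorHom_comp_tensorHom_assoc, h.nat]
  simp

theorem map_natural_right (h : Detects F P G c e m) (x : A) {a b : A} (f : a ⟶ b) :
    P.map (F.obj x ◁ F.map f ≫ m x b) = P.map (m x a ≫ F.map (x ◁ f)) := by
  rw [← cancel_epi (μ P (F.obj x) (F.obj a)), ← cancel_mono (c (x ⊗ b)).hom]
  simp only [Functor.map_comp, Category.assoc]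
  rw [h.nat, h.tensor_assoc, ← μ_natural_right, ← μ_natural_right_assoc, h.tensor]
  rw [← id_tensorHom, ← id_tensorHom, tensorHom_comp_tensorHom_assoc,
    tensorHom_comp_tensorHom_assoc, h.nat]
  simp

theorem map_associativity (h : Detects F P G c e m) (x y z : A) :
    P.map (m x y ▷ F.obj z ≫ m (x ⊗ y) z ≫ F.map (α_ x y z).hom) =
      P.map ((α_ (F.obj x) (F.obj y) (F.obj z)).hom ≫ F.obj x ◁ m y z ≫ m x (y ⊗ z)) := by
  rw [← cancel_epi (μ P (F.obj x ⊗ F.obj y) (F.obj z)),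
    ← cancel_epi (μ P (F.obj x) (F.obj y) ▷ P.obj (F.obj z)),
    ← cancel_mono (c (x ⊗ y ⊗ z)).hom]
  simp only [Functor.map_comp, Category.assoc]
  rw [h.nat, Functor.LaxMonoidal.associativity_assoc, ← μ_natural_left_assoc,
    ← μ_natural_right_assoc,
    h.tensor_assoc, h.tensor, ← tensorHom_id, ← tensorHom_id, tensorHom_comp_tensorHom_assoc,
    tensorHom_comp_tensorHom_assoc, ← id_tensorHom, ← id_tensorHom, tensorHom_comp_tensorHom_assoc,
    tensorHom_comp_tensorHom_assoc, Category.assoc, h.tensor,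
    Category.assoc (μ P (F.obj y) (F.obj z)),
    h.tensor]
  have h₁ := tensorHom_comp_tensorHom ((c x).hom ⊗ₘ (c y).hom) (c z).hom (μ G x y) (𝟙 _)
  have h₂ := tensorHom_comp_tensorHom (c x).hom ((c y).hom ⊗ₘ (c z).hom) (𝟙 _) (μ G y z)
  simp only [Category.id_comp, Category.comp_id] at h₁ h₂ ⊢
  rw [← h₁, ← h₂, tensorHom_id, id_tensorHom, Category.assoc, Category.assoc,
    Functor.LaxMonoidal.associativity,
    associator_naturality_assoc]

theorem map_left_unitality (h : Detects F P G c e m) (x : A) :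
    P.map ((λ_ (F.obj x)).hom) = P.map (e ▷ F.obj x ≫ m (𝟙_ A) x ≫ F.map (λ_ x).hom) := by
  rw [← cancel_epi (μ P (𝟙_ M) (F.obj x)), ← cancel_epi (ε P ▷ P.obj (F.obj x)),
    ← cancel_mono (c x).hom]
  simp only [Functor.map_comp, Category.assoc]
  rw [h.nat, ← Functor.LaxMonoidal.left_unitality_assoc, ← μ_natural_left_assoc, h.tensor_assoc,
    ← tensorHom_id, ← tensorHom_id, tensorHom_comp_tensorHom_assoc,
    tensorHom_comp_tensorHom_assoc, Category.assoc (ε P), h.unit]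
  simp [tensorHom_def', Functor.LaxMonoidal.left_unitality]

theorem map_right_unitality (h : Detects F P G c e m) (x : A) :
    P.map ((ρ_ (F.obj x)).hom) = P.map (F.obj x ◁ e ≫ m x (𝟙_ A) ≫ F.map (ρ_ x).hom) := by
  rw [← cancel_epi (μ P (F.obj x) (𝟙_ M)), ← cancel_epi (P.obj (F.obj x) ◁ ε P),
    ← cancel_mono (c x).hom]
  simp only [Functor.map_comp, Category.assoc]
  rw [h.nat, ← Functor.LaxMonoidal.right_unitality_assoc, ← μ_natural_right_assoc, h.tensor_assoc,
    ← id_tensorHom, ← id_tensorHom, tensorHom_comp_tensorHom_assoc,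
    tensorHom_comp_tensorHom_assoc, Category.assoc (ε P), h.unit]
  simp [MonoidalCategory.tensorHom_def, Functor.LaxMonoidal.right_unitality]

end Detects

theorem Detects.map_braided {A : Type u₁} [Category.{v₁} A] [MonoidalCategory A]
    [BraidedCategory A] {M : Type u₂} [Category.{v₂} M] [MonoidalCategory M] [BraidedCategory M]
    {N : Type u₃} [Category.{v₃} N] [MonoidalCategory N] [BraidedCategory N] {F : A ⥤ M}
    {P : M ⥤ N} [P.Braided] {G : A ⥤ N} [G.Braided] {c : ∀ a, P.obj (F.obj a) ≅ G.obj a}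
    {e : 𝟙_ M ⟶ F.obj (𝟙_ A)} {m : ∀ a b, F.obj a ⊗ F.obj b ⟶ F.obj (a ⊗ b)}
    (h : Detects F P G c e m) (x y : A) :
    P.map (m x y ≫ F.map (β_ x y).hom) = P.map ((β_ (F.obj x) (F.obj y)).hom ≫ m y x) := by
  rw [← cancel_epi (μ P (F.obj x) (F.obj y)), ← cancel_mono (c (y ⊗ x)).hom]
  simp only [Functor.map_comp, Category.assoc]
  rw [h.nat, h.tensor_assoc, Functor.LaxBraided.braided, Functor.LaxBraided.braided_assoc, h.tensor,
    BraidedCategory.braiding_naturality_assoc]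

end Detect

/-! ### Gluing tensor functors -/

section Glue

open Functor.LaxMonoidal Functor.OplaxMonoidal Functor.Monoidal MonoidalCategory

variable {D : Type u} [Category.{v} D] {B : AbTensorFibration.{w, vB, uB} D}
  {A : Type u₁} [Category.{v₁} A] [MonoidalCategory A] [SymmetricCategory A]

section Square

variable {S X Y : D} (f : X ⟶ S) (F : A ⥤ Fibre B.fib S) (G : TensorFunctor.{w} A (Fibre B.fib X))
  (c : ∀ a, (pull B.fib f).obj (F.obj a) ≅ G.toFunctor.obj a)

/-- The isomorphism `f^* 1 ≅ f^* F(1)` induced by an isomorphism of `f^* ∘ F` with a tensor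
functor. -/
def unitIsoOf : (pull B.fib f).obj (𝟙_ _) ≅ (pull B.fib f).obj (F.obj (𝟙_ A)) :=
  (εIso (pull B.fib f)).symm ≪≫ εIso G.toFunctor ≪≫ (c _).symm

/-- The isomorphism `f^* (F(a) ⊗ F(b)) ≅ f^* F(a ⊗ b)` induced by an isomorphism of `f^* ∘ F` with
a tensor functor. -/
def tensorIsoOf (a b : A) :
    (pull B.fib f).obj (F.obj a ⊗ F.obj b) ≅ (pull B.fib f).obj (F.obj (a ⊗ b)) :=
  (μIso (pull B.fib f) _ _).symm ≪≫ (c a ⊗ᵢ c b) ≪≫ μIso G.toFunctor a b ≪≫ (c _).symm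

theorem unitIsoOf_spec :
    ε (pull B.fib f) ≫ (unitIsoOf f F G c).hom ≫ (c _).hom = ε G.toFunctor := by
  simp [unitIsoOf]

theorem tensorIsoOf_spec (a b : A) :
    μ (pull B.fib f) _ _ ≫ (tensorIsoOf f F G c a b).hom ≫ (c _).hom =
      ((c a).hom ⊗ₘ (c b).hom) ≫ μ G.toFunctor a b := by
  simp [tensorIsoOf]

variable (g : Y ⟶ X) (f' : Y ⟶ S) (w : g ≫ f = f') (G' : TensorFunctor.{w} A (Fibre B.fib Y))
  (c' : ∀ a, (pull B.fib f').obj (F.obj a) ≅ G'.toFunctor.obj a)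
  (t : ∀ a, (pull B.fib g).obj (G.toFunctor.obj a) ⟶ G'.toFunctor.obj a)

/-- The isomorphisms `unitIsoOf` for two arrows `f` and `f' = f ∘ g` are compatible, so that they
define a morphism of cartesian sections when `F` is glued from tensor functors. -/
theorem unitIsoOf_comm
    (h : ∀ a, (pullComp B.fib f g f' w (F.obj a)).inv ≫ (c' a).hom =
      (pull B.fib g).map (c a).hom ≫ t a)
    (ht : ε (pull B.fib g) ≫ (pull B.fib g).map (ε G.toFunctor) ≫ t (𝟙_ A) = ε G'.toFunctor) :
    (pullComp B.fib f g f' w (𝟙_ _)).inv ≫ (unitIsoOf f' F G' c').hom =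
      (pull B.fib g).map (unitIsoOf f F G c).hom ≫
        (pullComp B.fib f g f' w (F.obj (𝟙_ A))).inv := by
  rw [← cancel_mono (c' _).hom, Category.assoc, Category.assoc, h,
    ← cancel_epi ((pull B.fib g).map (ε (pull B.fib f))), ← cancel_epi (ε (pull B.fib g)),
    ← Functor.map_comp_assoc, ← Functor.map_comp_assoc, Category.assoc, unitIsoOf_spec, ht,
    ← reassoc_of% (pullComp_unit (B := B) f g f' w), Iso.hom_inv_id_assoc, unitIsoOf_spec]

theorem tensorIsoOf_comm (a b : A)
    (h : ∀ a, (pullComp B.fib f g f' w (F.obj a)).inv ≫ (c' a).hom =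
      (pull B.fib g).map (c a).hom ≫ t a)
    (ht : μ (pull B.fib g) _ _ ≫ (pull B.fib g).map (μ G.toFunctor a b) ≫ t (a ⊗ b) =
      (t a ⊗ₘ t b) ≫ μ G'.toFunctor a b) :
    (pullComp B.fib f g f' w (F.obj a ⊗ F.obj b)).inv ≫ (tensorIsoOf f' F G' c' a b).hom =
      (pull B.fib g).map (tensorIsoOf f F G c a b).hom ≫
        (pullComp B.fib f g f' w (F.obj (a ⊗ b))).inv := by
  rw [← cancel_mono (c' _).hom, Category.assoc, Category.assoc, h,
    ← cancel_epi ((pull B.fib g).map (μ (pull B.fib f) _ _)), ← cancel_epi (μ (pull B.fib g) _ _),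
    ← cancel_epi ((pullComp B.fib f g f' w (F.obj a)).hom ⊗ₘ
      (pullComp B.fib f g f' w (F.obj b)).hom), ← reassoc_of% (pullComp_tensor (B := B) f g f' w),
    Iso.hom_inv_id_assoc, tensorIsoOf_spec, ← Functor.map_comp_assoc, ← Functor.map_comp_assoc,
    Category.assoc, tensorIsoOf_spec, Functor.map_comp_assoc, ← μ_natural_assoc, ht,
    tensorHom_comp_tensorHom_assoc, tensorHom_comp_tensorHom_assoc, Category.assoc,
    ← h, Category.assoc (pullComp B.fib f g f' w (F.obj b)).hom, ← h,
    Iso.hom_inv_id_assoc, Iso.hom_inv_id_assoc]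

end Square

variable {S : D} {R : Sieve S} [(toSec (F := B.fib) R).IsEquivalence]
  (s : Sec (B.homFib A) R.functor)

/-- The value of a section of tensor functors, as a tensor functor. -/
def Sec.tensorFunctor {Q : Dᵒᵖ ⥤ Type uX} (s : Sec (B.homFib A) Q) {e : D} (q : Q.obj (op e)) :
    TensorFunctor.{w} A (Fibre B.fib e) := s.obj e q

/-- The functor obtained by gluing the tensor functors of a section over a sieve: its value at
`a` is the object glued from the values at `a`. -/
noncomputable def gluedFunctor : A ⥤ Fibre B.fib S := s.evalAt ⋙ (toSec R).inv

/-- The restrictions of the glued functor are the given functors. -/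
noncomputable def gluedIso {e : D} (q : R.functor.obj (op e)) (a : A) :
    (pull B.fib (arrow q)).obj ((gluedFunctor s).obj a) ≅ (s.tensorFunctor q).toFunctor.obj a :=
  Sec.isoApp ((toSec R).asEquivalence.counitIso.app (s.evalAt.obj a)) e q

theorem gluedIso_naturality {e : D} (q : R.functor.obj (op e)) {a b : A} (f : a ⟶ b) :
    (pull B.fib (arrow q)).map ((gluedFunctor s).map f) ≫ (gluedIso s q b).hom =
      (gluedIso s q a).hom ≫ (s.tensorFunctor q).toFunctor.map f :=
  congrArg (fun t => Sec.Hom.hom t e q)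
    ((toSec R).asEquivalence.counitIso.hom.naturality (s.evalAt.map f))

/-- The restriction isomorphisms of the glued functor are compatible with the transition
isomorphisms of the section. -/
theorem gluedIso_comm {e e' : D} (g : e' ⟶ e) (q : R.functor.obj (op e))
    (q' : R.functor.obj (op e')) (w : R.functor.map g.op q = q') (a : A) :
    (pullComp B.fib (arrow q) g (arrow q') (arrow_map w) ((gluedFunctor s).obj a)).inv ≫
        (gluedIso s q' a).hom =
      (pull B.fib g).map (gluedIso s q a).hom ≫ (s.tr g q q' w).hom.iso.hom.app a :=
  ((toSec R).asEquivalence.counitIso.hom.app (s.evalAt.obj a)).comm g q q' w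

/-- The unit isomorphism of the glued functor. -/
noncomputable def gluedUnit : 𝟙_ _ ≅ (gluedFunctor s).obj (𝟙_ A) :=
  (toSec R).preimageIso (Sec.isoMk (fun _ q => unitIsoOf (arrow q) _ (s.tensorFunctor q)
    (gluedIso s q))
    fun g q q' w => unitIsoOf_comm (arrow q) _ (s.tensorFunctor q) _ g (arrow q') (arrow_map w)
      _ _ _ (gluedIso_comm s g q q' w)
      ((Category.assoc _ _ _).symm.trans (s.tr g q q' w).hom.isMonoidal.unit))

/-- The tensor isomorphisms of the glued functor. -/
noncomputable def gluedTensor (a b : A) :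
    (gluedFunctor s).obj a ⊗ (gluedFunctor s).obj b ≅ (gluedFunctor s).obj (a ⊗ b) :=
  (toSec R).preimageIso (Sec.isoMk
    (fun _ q => tensorIsoOf (arrow q) _ (s.tensorFunctor q) (gluedIso s q) a b)
    fun g q q' w => tensorIsoOf_comm (arrow q) _ (s.tensorFunctor q) _ g (arrow q') (arrow_map w)
      _ _ _ a b (gluedIso_comm s g q q' w)
      ((Category.assoc _ _ _).symm.trans ((s.tr g q q' w).hom.isMonoidal.tensor a b)))

theorem glued_detects {e : D} (q : R.functor.obj (op e)) :
    Detects (gluedFunctor s) (pull B.fib (arrow q)) (s.tensorFunctor q).toFunctor (gluedIso s q)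
      (gluedUnit s).hom (fun a b => (gluedTensor s a b).hom) where
  nat := gluedIso_naturality s q
  unit := by
    have : (pull B.fib (arrow q)).map (gluedUnit s).hom = (unitIsoOf (arrow q) _ (s.tensorFunctor q)
      (gluedIso s q)).hom := congrArg (fun t => Sec.Hom.hom t e q) ((toSec R).map_preimage _)
    exact (congrArg (fun t => ε (pull B.fib (arrow q)) ≫ t ≫ (gluedIso s q (𝟙_ A)).hom) this).trans
      (unitIsoOf_spec _ _ _ _)
  tensor a b := by
    have : (pull B.fib (arrow q)).map (gluedTensor s a b).hom =
      (tensorIsoOf (arrow q) _ (s.tensorFunctor q)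
      (gluedIso s q) a b).hom := congrArg (fun t => Sec.Hom.hom t e q) ((toSec R).map_preimage _)
    exact (congrArg (fun t => μ (pull B.fib (arrow q)) _ _ ≫ t ≫ (gluedIso s q (a ⊗ b)).hom)
      this).trans (tensorIsoOf_spec _ _ _ _ a b)

/-- Morphisms in a fibre are equal if their pull-backs along a sieve with effective descent are. -/
theorem hom_ext_of_sieve {x y : Fibre B.fib S} {f g : x ⟶ y}
    (h : ∀ (e : D) (q : R.functor.obj (op e)),
      (pull B.fib (arrow q)).map f = (pull B.fib (arrow q)).map g) : f = g :=
  (toSec (F := B.fib) R).map_injective (Sec.hom_ext h)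

noncomputable instance gluedMonoidal : (gluedFunctor s).Monoidal :=
  Functor.CoreMonoidal.toMonoidal
    { εIso := gluedUnit s
      μIso := gluedTensor s
      μIso_hom_natural_left := fun f x =>
        hom_ext_of_sieve (R := R) fun _ q => (glued_detects s q).map_natural_left f x
      μIso_hom_natural_right := fun x f =>
        hom_ext_of_sieve (R := R) fun _ q => (glued_detects s q).map_natural_right x f
      associativity := fun x y z =>
        hom_ext_of_sieve (R := R) fun _ q => (glued_detects s q).map_associativity x y z
      left_unitality := fun x =>
        hom_ext_of_sieve (R := R) fun _ q => (glued_detects s q).map_left_unitality x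
      right_unitality := fun x =>
        hom_ext_of_sieve (R := R) fun _ q => (glued_detects s q).map_right_unitality x }

noncomputable instance gluedBraided : (gluedFunctor s).Braided where
  braided x y := hom_ext_of_sieve (R := R) fun _ q => (glued_detects s q).map_braided x y

/-- A cocone in a fibre of a stack is a colimit if all its restrictions to a covering sieve are. -/
noncomputable def isColimitOfSieve {J : Type w} [Category.{w} J] {K : J ⥤ Fibre B.fib S}
    (c : Cocone K) (h : ∀ (e : D) (q : R.functor.obj (op e)),
      IsColimit ((pull B.fib (arrow q)).mapCocone c)) : IsColimit c where
  desc d := (toSec (F := B.fib) R).preimage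
    ⟨fun e q => (h e q).desc ((pull B.fib (arrow q)).mapCocone d), fun {e e'} g q q' w => by
      -- `g^*` preserves colimits, so a morphism out of `g^* q^* c.pt` is determined on the cocone
      have hg : IsColimit ((pull B.fib g).mapCocone ((pull B.fib (arrow q)).mapCocone c)) :=
        isColimitOfPreserves (pull B.fib g) (h e q)
      refine hg.hom_ext fun j => ?_
      have h₁ := (h e q).fac ((pull B.fib (arrow q)).mapCocone d) j
      have h₂ := (h e' q').fac ((pull B.fib (arrow q')).mapCocone d) j
      change (pull B.fib g).map ((pull B.fib (arrow q)).map (c.ι.app j)) ≫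
        (pullComp B.fib (arrow q) g (arrow q') (arrow_map w) c.pt).inv ≫ _ =
        (pull B.fib g).map ((pull B.fib (arrow q)).map (c.ι.app j)) ≫ _ ≫
        (pullComp B.fib (arrow q) g (arrow q') (arrow_map w) d.pt).inv
      refine (pullComp_inv_naturality_assoc (arrow q) g (arrow q') (arrow_map w) _ _).trans ?_
      refine (congrArg (_ ≫ ·) h₂).trans (Eq.trans ?_ (Functor.map_comp_assoc _ _ _ _))
      refine Eq.trans ?_ (congrArg (fun t => (pull B.fib g).map t ≫ _) h₁).symm
      exact (pullComp_inv_naturality (arrow q) g (arrow q') (arrow_map w) _).symm⟩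
  fac d j := hom_ext_of_sieve (R := R) fun e q => by
    refine ((pull B.fib (arrow q)).map_comp _ _).trans ?_
    refine (congrArg (_ ≫ ·) (congrArg (fun t => Sec.Hom.hom t e q)
      ((toSec R).map_preimage _))).trans ?_
    exact (h e q).fac _ j
  uniq d m hm := hom_ext_of_sieve (R := R) fun e q => by
    refine Eq.trans ?_ (congrArg (fun t => Sec.Hom.hom t e q) ((toSec R).map_preimage _)).symm
    refine (h e q).uniq ((pull B.fib (arrow q)).mapCocone d) _ fun j => ?_
    exact ((pull B.fib (arrow q)).map_comp _ _).symm.trans (congrArg _ (hm j))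

/-- The tensor functor obtained by gluing the tensor functors of a section over a sieve. -/
noncomputable def glued : TensorFunctor.{w} A (Fibre B.fib S) where
  toFunctor := gluedFunctor s
  braided := gluedBraided s
  preservesColimits := ⟨⟨⟨fun hc => ⟨isColimitOfSieve _ fun _ q =>
    have : PreservesColimitsOfSize.{w, w} (gluedFunctor s ⋙ pull B.fib (arrow q)) :=
      preservesColimits_of_natIso
        (NatIso.ofComponents (gluedIso s q) (gluedIso_naturality s q)).symm
    isColimitOfPreserves (gluedFunctor s ⋙ pull B.fib (arrow q)) hc⟩⟩⟩⟩

/-- The restrictions of the glued functor are the given functors, as tensor functors. -/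
noncomputable def gluedHom {e : D} (q : R.functor.obj (op e)) :
    (glued s).comp (B.pullback (arrow q).op.toLoc) ⟶ s.tensorFunctor q where
  iso := NatIso.ofComponents (gluedIso s q) (gluedIso_naturality s q)
  isMonoidal :=
    { unit := (Category.assoc _ _ _).trans (glued_detects s q).unit
      tensor := fun a b => (Category.assoc _ _ _).trans ((glued_detects s q).tensor a b) }

/-- A natural transformation of tensor functors is monoidal if its pull-backs along a sieve with
effective descent are. -/
theorem isMonoidal_of_sieve {F G : TensorFunctor.{w} A (Fibre B.fib S)}
    (t : F.toFunctor ⟶ G.toFunctor) (h : ∀ (e : D) (q : R.functor.obj (op e)),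
      NatTrans.IsMonoidal (F₁ := F.toFunctor ⋙ pull B.fib (arrow q))
        (F₂ := G.toFunctor ⋙ pull B.fib (arrow q)) (Functor.whiskerRight t _)) :
    NatTrans.IsMonoidal t where
  unit := hom_ext_of_sieve (R := R) fun e q => by
    have := (h e q).unit
    rw [← cancel_epi (ε (pull B.fib (arrow q))), Functor.map_comp]
    exact (Category.assoc _ _ _).symm.trans this
  tensor a b := hom_ext_of_sieve (R := R) fun e q => by
    have := (h e q).tensor a b
    rw [← cancel_epi (μ (pull B.fib (arrow q)) _ _), Functor.map_comp, Functor.map_comp,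
      ← μ_natural_assoc]
    exact (Category.assoc _ _ _).symm.trans this

instance homFib_faithful : (toSec (F := B.homFib A) R).Faithful where
  map_injective {F G} _ _ h := TensorFunctor.hom_ext fun a => hom_ext_of_sieve (R := R) fun e q =>
    congrArg (fun t : (toSec R).obj F ⟶ (toSec R).obj G =>
      (TensorFunctor.Hom.iso (t.hom e q)).hom.app a) h

/-- A morphism between the sections defined by two tensor functors, evaluated at an object. -/
def Sec.homAt {F G : Fibre (B.homFib A) S} (b : (toSec R).obj F ⟶ (toSec R).obj G) (a : A) :
    (toSec (F := B.fib) R).obj (F.toFunctor.obj a) ≅ (toSec R).obj (G.toFunctor.obj a) :=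
  Sec.isoMk (fun e q => (b.hom e q).iso.app a) fun {e e'} g q q' w => by
    have h := congrArg (fun t => TensorFunctor.Hom.iso t |>.hom.app a) (b.comm g q q' w)
    refine (congrArg (· ≫ _) (homFib_pullComp_inv_app B (arrow q) g (arrow q') (arrow_map w) F
      a).symm).trans (h.trans ?_)
    exact congrArg (_ ≫ ·) (homFib_pullComp_inv_app B (arrow q) g (arrow q') (arrow_map w) G a)

theorem map_preimage_homAt {F G : Fibre (B.homFib A) S} (b : (toSec R).obj F ⟶ (toSec R).obj G)
    (a : A) {e : D} (q : R.functor.obj (op e)) :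
    (pull B.fib (arrow q)).map ((toSec R).preimageIso (Sec.homAt b a)).hom =
      (b.hom e q).iso.hom.app a :=
  congrArg (fun t => Sec.Hom.hom t e q) ((toSec R).map_preimage _)

instance homFib_full : (toSec (F := B.homFib A) R).Full where
  map_surjective {F G} b := by
    let t : F.toFunctor ≅ G.toFunctor := NatIso.ofComponents
      (fun a => (toSec R).preimageIso (Sec.homAt b a)) fun {a a'} f =>
        hom_ext_of_sieve (R := R) fun e q => by
        refine ((pull B.fib (arrow q)).map_comp _ _).trans (Eq.trans ?_
          ((pull B.fib (arrow q)).map_comp _ _).symm)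
        refine (congrArg (_ ≫ ·) (map_preimage_homAt b a' q)).trans (Eq.trans ?_
          (congrArg (· ≫ _) (map_preimage_homAt b a q)).symm)
        exact (b.hom e q).iso.hom.naturality f
    refine ⟨⟨t, isMonoidal_of_sieve (R := R) (F := F) (G := G) t.hom fun e q => ?_⟩, ?_⟩
    · have : Functor.whiskerRight t.hom (pull B.fib (arrow q)) = (b.hom e q).iso.hom :=
        NatTrans.ext (funext fun a => map_preimage_homAt b a q)
      rw [this]
      exact (b.hom e q).isMonoidal
    · exact Sec.hom_ext fun e q => TensorFunctor.hom_ext fun a => map_preimage_homAt b a q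

instance homFib_essSurj : (toSec (F := B.homFib A) R).EssSurj where
  mem_essImage s := ⟨glued s, ⟨Sec.isoMk (fun _ q => TensorFunctor.isoMk (gluedHom s q))
    fun g q q' w => TensorFunctor.hom_ext fun a =>
      (congrArg (· ≫ _) (homFib_pullComp_inv_app B (arrow q) g (arrow q') (arrow_map w) (glued s)
        a)).trans (gluedIso_comm s g q q' w a)⟩⟩

end Glue

section Stack

variable {D : Type u} [Category.{v} D] {B : AbTensorFibration.{w, vB, uB} D}
  {A : Type u₁} [Category.{v₁} A] [MonoidalCategory A] [SymmetricCategory A]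

variable (A) in
/-- Tensor functors into a stack of tensor categories satisfy descent. -/
theorem homFib_isStackFor {S : D} {R : Sieve S} (h : B.fib.IsStackFor R.arrows) :
    (B.homFib A).IsStackFor R.arrows := by
  rw [isStackFor_iff] at h ⊢
  exact { }

instance tensorFunctor_isGroupoid {A' : Type u₂} [Category.{v₂} A'] [MonoidalCategory A']
    [SymmetricCategory A'] : IsGroupoid (TensorFunctor.{w} A A') where
  all_isIso f := (TensorFunctor.isoMk f).isIso_hom

variable (A) in
theorem localHom_isStackInGroupoids (J : GrothendieckTopology D) (hB : B.fib.IsStack J) (T : D) :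
    IsStackInGroupoids (J.over T) (localHom B A T) where
  isStack := .of_isStackFor fun _ R hR => homFib_isStackFor A <|
    (isLocalEquiv_overForget T).isStackFor_of_isStack J hB R ((J.mem_over_iff R).1 hR)
  isGroupoid S := tensorFunctor_isGroupoid (A' := Fibre B.fib S.left)

end Stack

/-! ### Constructing fibred categories -/

section Construct

variable (D : Type u) [Category.{v} D]

/-- The data of a cloven fibred category, in terms of its fibres and pull-back functors. The
isomorphisms `mapComp` are given for all factorisations `g ≫ f = h`, so that the coherence laws can
be stated without transports. -/
structure FibData where
  obj : D → Type uX
  cat : ∀ S, Category.{vX} (obj S)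
  map : ∀ {S S' : D} (_ : S' ⟶ S), obj S ⥤ obj S'
  mapId : ∀ S, map (𝟙 S) ≅ 𝟭 (obj S)
  mapComp : ∀ {S S' S'' : D} (f : S' ⟶ S) (g : S'' ⟶ S') (h : S'' ⟶ S) (_ : g ≫ f = h),
    map h ≅ map f ⋙ map g
  assoc : ∀ {S₀ S₁ S₂ S₃ : D} (f : S₁ ⟶ S₀) (g : S₂ ⟶ S₁) (k : S₃ ⟶ S₂)
    (gf : S₂ ⟶ S₀) (kg : S₃ ⟶ S₁) (h : S₃ ⟶ S₀) (w₁ : g ≫ f = gf) (w₂ : k ≫ g = kg)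
    (w₃ : kg ≫ f = h) (w₄ : k ≫ gf = h) (x : obj S₀),
    (mapComp f kg h w₃).hom.app x ≫ (mapComp g k kg w₂).hom.app ((map f).obj x) =
      (mapComp gf k h w₄).hom.app x ≫ (map k).map ((mapComp f g gf w₁).hom.app x)
  comp_id : ∀ {S S' : D} (f : S' ⟶ S) (w : 𝟙 S' ≫ f = f) (x : obj S),
    (mapComp f (𝟙 S') f w).hom.app x ≫ (mapId S').hom.app ((map f).obj x) = 𝟙 _
  id_comp : ∀ {S S' : D} (f : S' ⟶ S) (w : f ≫ 𝟙 S = f) (x : obj S),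
    (mapComp (𝟙 S) f f w).hom.app x ≫ (map f).map ((mapId S).hom.app x) = 𝟙 _

namespace FibData

attribute [instance] cat

variable {D} (Φ : FibData.{v, u, vX, uX} D)

theorem eqToHom_mapComp {S S' S'' : D} (f : S' ⟶ S) (g : S'' ⟶ S') (h h' : S'' ⟶ S)
    (w : g ≫ f = h) (e : h' = h) (x : Φ.obj S) :
    eqToHom (by rw [e]) ≫ (Φ.mapComp f g h w).hom.app x =
      (Φ.mapComp f g h' (w.trans e.symm)).hom.app x := by
  subst e; simp

/-- The associativity law in the form required of a pseudofunctor, where the two composites of three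
morphisms are identified by a transport. -/
theorem assoc_eqToHom {S₀ S₁ S₂ S₃ : D} (f : S₁ ⟶ S₀) (g : S₂ ⟶ S₁) (h : S₃ ⟶ S₂) (x : Φ.obj S₀) :
    (Φ.mapComp (g ≫ f) h (h ≫ g ≫ f) rfl).hom.app x ≫
      (Φ.map h).map ((Φ.mapComp f g (g ≫ f) rfl).hom.app x) ≫ 𝟙 _ ≫
      (Φ.mapComp g h (h ≫ g) rfl).inv.app ((Φ.map f).obj x) ≫
      (Φ.mapComp f (h ≫ g) ((h ≫ g) ≫ f) rfl).inv.app x = eqToHom (by rw [Category.assoc]) := by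
  have H := Φ.assoc f g h (g ≫ f) (h ≫ g) (h ≫ g ≫ f) rfl rfl (Category.assoc _ _ _) rfl x
  rw [Category.id_comp, ← reassoc_of% H, Iso.hom_inv_id_app_assoc,
    ← Φ.eqToHom_mapComp f (h ≫ g) ((h ≫ g) ≫ f) (h ≫ g ≫ f) rfl (Category.assoc _ _ _).symm]
  exact (Category.assoc _ _ _).trans <| (congrArg (_ ≫ ·) (Iso.hom_inv_id_app _ _)).trans
    (Category.comp_id _)

theorem id_comp_eqToHom {S S' : D} (f : S' ⟶ S) (x : Φ.obj S) :
    (Φ.mapComp (𝟙 S) f (f ≫ 𝟙 S) rfl).hom.app x ≫ (Φ.map f).map ((Φ.mapId S).hom.app x) ≫ 𝟙 _ =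
      eqToHom (by rw [Category.comp_id]; rfl) := by
  have H := Φ.eqToHom_mapComp (𝟙 S) f f (f ≫ 𝟙 S) (Category.comp_id _) (Category.comp_id _) x
  refine (congrArg (_ ≫ ·) (Category.comp_id _)).trans ?_
  exact (congrArg (· ≫ _) H.symm).trans ((Category.assoc _ _ _).trans
    ((congrArg (_ ≫ ·) (Φ.id_comp f _ x)).trans (Category.comp_id _)))

theorem comp_id_eqToHom {S S' : D} (f : S' ⟶ S) (x : Φ.obj S) :
    (Φ.mapComp f (𝟙 S') (𝟙 S' ≫ f) rfl).hom.app x ≫ (Φ.mapId S').hom.app ((Φ.map f).obj x) ≫ 𝟙 _ =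
      eqToHom (by rw [Category.id_comp]; rfl) := by
  have H := Φ.eqToHom_mapComp f (𝟙 S') f (𝟙 S' ≫ f) (Category.id_comp _) (Category.id_comp _) x
  refine (congrArg (_ ≫ ·) (Category.comp_id _)).trans ?_
  exact (congrArg (· ≫ _) H.symm).trans ((Category.assoc _ _ _).trans
    ((congrArg (_ ≫ ·) (Φ.comp_id f _ x)).trans (Category.comp_id _)))

/-- The pseudofunctor defined by fibres and pull-back functors. -/
def toPseudofunctor : Pseudofunctor (LocallyDiscrete Dᵒᵖ) Cat.{vX, uX} :=
  LocallyDiscrete.mkPseudofunctor (fun S => Cat.of (Φ.obj S.unop))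
    (fun f => (Φ.map f.unop).toCatHom) (fun S => Cat.Hom.isoMk (Φ.mapId S.unop))
    (fun f g => Cat.Hom.isoMk (Φ.mapComp f.unop g.unop (f ≫ g).unop rfl))
    (fun f g h => Cat.Hom₂.ext (NatTrans.ext (funext fun x => by
      rw [Cat.Hom₂.eqToHom_toNatTrans, eqToHom_app]
      exact Φ.assoc_eqToHom f.unop g.unop h.unop x)))
    (fun f => Cat.Hom₂.ext (NatTrans.ext (funext fun x => by
      rw [Cat.Hom₂.eqToHom_toNatTrans, eqToHom_app]
      exact Φ.id_comp_eqToHom f.unop x)))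
    (fun f => Cat.Hom₂.ext (NatTrans.ext (funext fun x => by
      rw [Cat.Hom₂.eqToHom_toNatTrans, eqToHom_app]
      exact Φ.comp_id_eqToHom f.unop x)))

theorem toPseudofunctor_pullComp_hom {S S' S'' : D} (f : S' ⟶ S) (g : S'' ⟶ S') (h : S'' ⟶ S)
    (w : g ≫ f = h) (x : Φ.obj S) :
    (pullComp Φ.toPseudofunctor f g h w x).hom = (Φ.mapComp f g h w).hom.app x := by
  subst w
  exact pullComp_hom_eq (F := Φ.toPseudofunctor) f g x

theorem toPseudofunctor_pullComp_inv {S S' S'' : D} (f : S' ⟶ S) (g : S'' ⟶ S') (h : S'' ⟶ S)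
    (w : g ≫ f = h) (x : Φ.obj S) :
    (pullComp Φ.toPseudofunctor f g h w x).inv = (Φ.mapComp f g h w).inv.app x := by
  subst w
  exact pullComp_inv_eq (F := Φ.toPseudofunctor) f g x

end FibData

end Construct

/-! ### Extension of cartesian sections along covering inclusions of presheaves -/

section Extend

universe t
variable {D : Type u} [Category.{v} D] {F : Pseudofunctor (LocallyDiscrete Dᵒᵖ) Cat.{vX, uX}}
  {Q' Q : Dᵒᵖ ⥤ Type t}

theorem map_app_of_map (φ : Q' ⟶ Q) {e e' : D} {g : e' ⟶ e} {q : Q'.obj (op e)}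
    {q' : Q'.obj (op e')} (w : Q'.map g.op q = q') :
    Q.map g.op (φ.app (op e) q) = φ.app (op e') q' := by
  rw [← w, NatTrans.naturality_apply]

/-- Restriction of cartesian sections along a morphism of presheaves. -/
def Sec.reindex (F : Pseudofunctor (LocallyDiscrete Dᵒᵖ) Cat.{vX, uX}) (φ : Q' ⟶ Q) :
    Sec F Q ⥤ Sec F Q' where
  obj s :=
    { obj := fun e q => s.obj e (φ.app (op e) q)
      tr := fun g q q' w => s.tr g _ _ (map_app_of_map φ w)
      tr_id := fun e q w => s.tr_id e _ _
      tr_comp := fun g g' h w q q' q'' w₁ w₂ w₃ => s.tr_comp g g' h w _ _ _ _ _ _ }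
  map f :=
    { hom := fun e q => f.hom e (φ.app (op e) q)
      comm := fun g q q' w => f.comm g _ _ _ }

/-- The sieve of arrows along which the pull-back of `q` lifts along `φ`. -/
def liftSieve (φ : Q' ⟶ Q) {e : D} (q : Q.obj (op e)) : Sieve e where
  arrows e' g := ∃ q' : Q'.obj (op e'), Q.map g.op q = φ.app (op e') q'
  downward_closed := by
    rintro e' e'' g ⟨q', h⟩ k
    exact ⟨Q'.map k.op q', by rw [NatTrans.naturality_apply, ← h]; simp⟩

theorem map_comp_of {e e' e'' : D} {g : e' ⟶ e} {k : e'' ⟶ e'} {h : e'' ⟶ e} (w : k ≫ g = h)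
    {q : Q.obj (op e)} {q₁ : Q.obj (op e')} {q₂ : Q.obj (op e'')} (w₁ : Q.map g.op q = q₁)
    (w₂ : Q.map k.op q₁ = q₂) : Q.map h.op q = q₂ := by
  subst w w₁ w₂; simp

/-! The lemmas of the following namespace concern an injective morphism `φ : Q' ⟶ Q` of presheaves
such that `F` has effective descent for the sieves `liftSieve φ q`. -/

namespace Extend

variable (φ : Q' ⟶ Q) (hφ : ∀ e : D, Function.Injective (φ.app (op e)))
  (hF : ∀ (e : D) (q : Q.obj (op e)), (toSec (F := F) (liftSieve φ q)).IsEquivalence)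

include hφ in
theorem map_eq {e e' : D} {g : e' ⟶ e} {q : Q'.obj (op e)} {q' : Q'.obj (op e')}
    (h : Q.map g.op (φ.app (op e) q) = φ.app (op e') q') : Q'.map g.op q = q' :=
  hφ _ (by rw [NatTrans.naturality_apply, h])

include hF in
/-- Morphisms in the fibre at an element of `Q` are determined by their pull-backs to elements of
`Q'`. -/
theorem hom_ext {e : D} (q : Q.obj (op e)) {x y : Fibre F e} {f f' : x ⟶ y}
    (h : ∀ (e' : D) (g : e' ⟶ e) (q' : Q'.obj (op e')), Q.map g.op q = φ.app (op e') q' →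
      (pull F g).map f = (pull F g).map f') : f = f' := by
  have := hF e q
  refine (toSec (F := F) (liftSieve φ q)).map_injective (Sec.hom_ext fun e' r => ?_)
  obtain ⟨q', hq'⟩ := arrow_mem r
  exact h e' (arrow r) q' hq'

include hφ hF in
/-- A compatible family of morphisms over the elements of `Q'` below an element of `Q` comes from a
morphism. -/
theorem exists_hom {e : D} (q : Q.obj (op e)) {x y : Fibre F e}
    (β : ∀ {e' : D} (g : e' ⟶ e) (q' : Q'.obj (op e')), Q.map g.op q = φ.app (op e') q' →
      ((pull F g).obj x ⟶ (pull F g).obj y))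
    (hβ : ∀ {e' e'' : D} (g : e' ⟶ e) (k : e'' ⟶ e') (h : e'' ⟶ e) (w : k ≫ g = h)
      (q₁ : Q'.obj (op e')) (q₂ : Q'.obj (op e'')) (w₁ : Q.map g.op q = φ.app (op e') q₁)
      (w₂ : Q.map h.op q = φ.app (op e'') q₂) (_ : Q'.map k.op q₁ = q₂),
      (pullComp F g k h w x).inv ≫ β h q₂ w₂ =
        (pull F k).map (β g q₁ w₁) ≫ (pullComp F g k h w y).inv) :
    ∃ t : x ⟶ y, ∀ {e' : D} (g : e' ⟶ e) (q' : Q'.obj (op e'))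
      (w : Q.map g.op q = φ.app (op e') q'), (pull F g).map t = β g q' w := by
  have := hF e q
  -- `l e' r` is the lift to `Q'` of the pull-back of `q` along the arrow `r`
  choose l hl using fun (e' : D) (r : (liftSieve φ q).functor.obj (op e')) => arrow_mem r
  obtain ⟨t, ht⟩ := (toSec (F := F) (liftSieve φ q)).map_surjective (X := x) (Y := y)
    ⟨fun e' r => β (arrow r) (l e' r) (hl e' r), fun g r r' w =>
      hβ (arrow r) g (arrow r') (arrow_map w) _ _ (hl _ r) (hl _ r') (map_eq φ hφ (by
        rw [← hl, ← hl]; exact map_comp_of (arrow_map w) rfl rfl |>.symm))⟩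
  refine ⟨t, fun {e'} g q' w => ?_⟩
  have h := congrArg (fun t => Sec.Hom.hom t e' (sieveElt (liftSieve φ q) g ⟨q', w⟩)) ht
  refine h.trans ?_
  have hq : ∀ (q₁ : Q'.obj (op e')) (w₁ : Q.map g.op q = φ.app (op e') q₁),
      β g q₁ w₁ = β g q' w := by
    intro q₁ w₁
    obtain rfl := hφ _ (w₁.symm.trans w)
    rfl
  exact hq _ _

include hφ hF in
theorem exists_iso {e : D} (q : Q.obj (op e)) {x y : Fibre F e}
    (β : ∀ {e' : D} (g : e' ⟶ e) (q' : Q'.obj (op e')), Q.map g.op q = φ.app (op e') q' →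
      ((pull F g).obj x ≅ (pull F g).obj y))
    (hβ : ∀ {e' e'' : D} (g : e' ⟶ e) (k : e'' ⟶ e') (h : e'' ⟶ e) (w : k ≫ g = h)
      (q₁ : Q'.obj (op e')) (q₂ : Q'.obj (op e'')) (w₁ : Q.map g.op q = φ.app (op e') q₁)
      (w₂ : Q.map h.op q = φ.app (op e'') q₂) (_ : Q'.map k.op q₁ = q₂),
      (pullComp F g k h w x).inv ≫ (β h q₂ w₂).hom =
        (pull F k).map (β g q₁ w₁).hom ≫ (pullComp F g k h w y).inv) :
    ∃ t : x ≅ y, ∀ {e' : D} (g : e' ⟶ e) (q' : Q'.obj (op e'))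
      (w : Q.map g.op q = φ.app (op e') q'), (pull F g).map t.hom = (β g q' w).hom := by
  obtain ⟨t, ht⟩ := exists_hom φ hφ hF q (fun g q' w => (β g q' w).hom) hβ
  obtain ⟨t', ht'⟩ := exists_hom φ hφ hF q (fun g q' w => (β g q' w).inv)
    fun g k h w q₁ q₂ w₁ w₂ w₃ => by
      rw [Iso.comp_inv_eq, Category.assoc, hβ g k h w q₁ q₂ w₁ w₂ w₃, ← Functor.map_comp_assoc,
        Iso.inv_hom_id, CategoryTheory.Functor.map_id, Category.id_comp]
  exact ⟨⟨t, t', hom_ext φ hF q fun _ g q' w => by simp [ht g q' w, ht' g q' w],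
    hom_ext φ hF q fun _ g q' w => by simp [ht g q' w, ht' g q' w]⟩, ht⟩

include hF in
theorem faithful : (Sec.reindex F φ).Faithful where
  map_injective {s s'} f f' h := Sec.hom_ext fun e q => hom_ext φ hF q fun e' g q' w => by
    have h' : f.hom e' (φ.app (op e') q') = f'.hom e' (φ.app (op e') q') :=
      congrArg (fun t : (Sec.reindex F φ).obj s ⟶ (Sec.reindex F φ).obj s' => t.hom e' q') h
    rw [← cancel_mono (s'.tr g q (φ.app (op e') q') w).hom, ← f.comm, ← f'.comm, h']

include hφ hF in
theorem full : (Sec.reindex F φ).Full where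
  map_surjective {s s'} b := by
    obtain ⟨β, hβ⟩ : ∃ β : ∀ (e : D) (q : Q'.obj (op e)),
        s.obj e (φ.app (op e) q) ⟶ s'.obj e (φ.app (op e) q), ∀ e q, β e q = b.hom e q :=
      ⟨_, fun _ _ => rfl⟩
    have hb : ∀ {e e' : D} (g : e' ⟶ e) (q : Q'.obj (op e)) (q' : Q'.obj (op e'))
      (w : Q'.map g.op q = q') , (s.tr g _ _ (map_app_of_map φ w)).hom ≫ β e' q' =
        (pull F g).map (β e q) ≫ (s'.tr g _ _ (map_app_of_map φ w)).hom := by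
      intro e e' g q q' w
      rw [hβ, hβ]; exact b.comm g q q' w
    have H : ∀ (e : D) (q : Q.obj (op e)), ∃ t : s.obj e q ⟶ s'.obj e q,
        ∀ {e' : D} (g : e' ⟶ e) (q' : Q'.obj (op e')) (w : Q.map g.op q = φ.app (op e') q'),
        (pull F g).map t = (s.tr g q _ w).hom ≫ β e' q' ≫ (s'.tr g q _ w).inv := fun e q =>
      exists_hom φ hφ hF q (fun g q' w => (s.tr g q _ w).hom ≫ β _ q' ≫ (s'.tr g q _ w).inv)
        (fun g k h w q₁ q₂ w₁ w₂ w₃ => by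
          rw [s.tr_comp g k h w q _ _ w₁ (map_app_of_map φ w₃) w₂,
            s'.tr_comp_inv g k h w q _ _ w₁ (map_app_of_map φ w₃) w₂, Category.assoc,
            Iso.inv_hom_id_assoc, Category.assoc, reassoc_of% (hb k q₁ q₂ w₃)]
          simp)
    choose t ht using H
    refine ⟨⟨t, fun {e e'} g q q' w => hom_ext φ hF q' fun e'' k q'' w' => ?_⟩,
      Sec.hom_ext fun e q => ?_⟩
    · have h₁ := ht e' q' k q'' w'
      have h₂ := ht e q (k ≫ g) q'' (map_comp_of rfl w w')
      rw [Functor.map_comp, Functor.map_comp, h₁,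
        ← cancel_epi (pullComp F g k (k ≫ g) rfl _).hom, ← pullComp_hom_naturality_assoc, h₂,
        ← cancel_mono (s'.tr k q' _ w').hom,
        s.tr_comp g k (k ≫ g) rfl q q' _ w w' (map_comp_of rfl w w')]
      simp only [Category.assoc, Iso.inv_hom_id, Category.comp_id]
      rw [← s'.tr_comp g k (k ≫ g) rfl q q' _ w w' (map_comp_of rfl w w')]
      simp
    · refine Eq.trans ?_ (hβ e q)
      have w : Q.map (𝟙 e).op (φ.app (op e) q) = φ.app (op e) q := by simp
      have h := ht e (φ.app (op e) q) (𝟙 e) q w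
      rw [← Category.assoc, Iso.eq_comp_inv, s.tr_id, s'.tr_id, pullId_hom_naturality] at h
      exact (cancel_epi (pullId F e (s.obj e (φ.app (op e) q))).hom).1 h

include hφ hF in
/-- The values of a section on `Q'` can be glued to a value `x` at every element of `Q`, with
restriction isomorphisms `c`. -/
theorem exists_obj (s : Sec F Q') {e : D} (q : Q.obj (op e)) :
    ∃ (x : Fibre F e) (c : ∀ {e' : D} (g : e' ⟶ e) (q' : Q'.obj (op e')),
      Q.map g.op q = φ.app (op e') q' → ((pull F g).obj x ≅ s.obj e' q')),
      ∀ {e' e'' : D} (g : e' ⟶ e) (k : e'' ⟶ e') (h : e'' ⟶ e) (w : k ≫ g = h)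
        (q₁ : Q'.obj (op e')) (q₂ : Q'.obj (op e'')) (w₁ : Q.map g.op q = φ.app (op e') q₁)
        (w₂ : Q.map h.op q = φ.app (op e'') q₂) (w₃ : Q'.map k.op q₁ = q₂),
        (pullComp F g k h w x).inv ≫ (c h q₂ w₂).hom =
          (pull F k).map (c g q₁ w₁).hom ≫ (s.tr k q₁ q₂ w₃).hom := by
  have := hF e q
  choose l hl using fun (e' : D) (r : (liftSieve φ q).functor.obj (op e')) => arrow_mem r
  have hl' : ∀ {e' e'' : D} (g : e'' ⟶ e') (r : (liftSieve φ q).functor.obj (op e'))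
      (r' : (liftSieve φ q).functor.obj (op e'')), (liftSieve φ q).functor.map g.op r = r' →
      Q'.map g.op (l e' r) = l e'' r' := fun g r r' w => map_eq φ hφ (by
    rw [← hl, ← hl]; exact map_comp_of (arrow_map w) rfl rfl |>.symm)
  -- the section over the sieve given by the values of `s` at the lifts
  let σ : Sec F (liftSieve φ q).functor :=
    { obj := fun e' r => s.obj e' (l e' r)
      tr := fun g r r' w => s.tr g _ _ (hl' g r r' w)
      tr_id := fun e' r w => s.tr_id e' _ _
      tr_comp := fun g g' h w r r' r'' w₁ w₂ w₃ => s.tr_comp g g' h w _ _ _ _ _ _ }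
  let i := (toSec (liftSieve φ q)).objObjPreimageIso σ
  have hq : ∀ {e' : D} (g : e' ⟶ e) (q' : Q'.obj (op e')) (w : Q.map g.op q = φ.app (op e') q'),
      l e' (sieveElt (liftSieve φ q) g ⟨q', w⟩) = q' := fun g q' w =>
    hφ _ ((hl _ (sieveElt (liftSieve φ q) g ⟨q', w⟩)).symm.trans w)
  refine ⟨(toSec (liftSieve φ q)).objPreimage σ, fun {e'} g q' w =>
    Sec.isoApp i e' (sieveElt (liftSieve φ q) g ⟨q', w⟩) ≪≫
      eqToIso (congrArg (s.obj e') (hq g q' w)),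
    fun {e' e''} g k h w q₁ q₂ w₁ w₂ w₃ => ?_⟩
  have wk : (liftSieve φ q).functor.map k.op (sieveElt (liftSieve φ q) g ⟨q₁, w₁⟩) =
    sieveElt (liftSieve φ q) h ⟨q₂, w₂⟩ := Subtype.ext w
  have H := i.hom.comm k (sieveElt (liftSieve φ q) g ⟨q₁, w₁⟩) _ wk
  refine (Category.assoc _ _ _).symm.trans ((congrArg (· ≫ _) H).trans
    ((Category.assoc _ _ _).trans ?_))
  refine Eq.trans ?_ (congrArg (· ≫ _) ((pull F k).map_comp _ _).symm)
  refine Eq.trans ?_ (Category.assoc _ _ _).symm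
  refine congrArg (_ ≫ ·) ?_
  refine (s.tr_eqToHom k _ _ _ _ (hq h q₂ w₂)).trans ?_
  exact (s.eqToHom_tr k _ _ _ w₃ (hq g q₁ w₁)).symm

include hφ hF in
theorem essSurj : (Sec.reindex F φ).EssSurj where
  mem_essImage s := by
    choose x c hc using fun (e : D) (q : Q.obj (op e)) => exists_obj φ hφ hF s q
    -- the transition isomorphisms `t` of the extended section are glued from the isomorphisms
    -- `k^* g^* x(q) ≅ s(q₂) ≅ k^* x(q₁)` over the elements of `Q'`
    have H : ∀ (e e' : D) (g : e' ⟶ e) (q : Q.obj (op e)) (q₁ : Q.obj (op e'))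
        (w : Q.map g.op q = q₁), ∃ t : (pull F g).obj (x e q) ≅ x e' q₁,
        ∀ {e'' : D} (k : e'' ⟶ e') (h : e'' ⟶ e) (hk : k ≫ g = h) (q₂ : Q'.obj (op e''))
          (w₁ : Q.map k.op q₁ = φ.app (op e'') q₂) (w₂ : Q.map h.op q = φ.app (op e'') q₂),
          (pull F k).map t.hom ≫ (c e' q₁ k q₂ w₁).hom =
            (pullComp F g k h hk (x e q)).inv ≫ (c e q h q₂ w₂).hom := by
      intro e e' g q q₁ w
      obtain ⟨t, ht⟩ := exists_iso φ hφ hF q₁ (x := (pull F g).obj (x e q)) (y := x e' q₁)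
        (fun k q₂ w₁ => (pullComp F g k (k ≫ g) rfl (x e q)).symm ≪≫
          c e q (k ≫ g) q₂ (map_comp_of rfl w w₁) ≪≫ (c e' q₁ k q₂ w₁).symm)
        (fun k l h hl q₂ q₃ w₂ w₃ wl => by
          subst hl
          have h₁ := hc e q (k ≫ g) l ((l ≫ k) ≫ g) (Category.assoc _ _ _).symm q₂ q₃
            (map_comp_of rfl w w₂) (map_comp_of rfl w w₃) wl
          have h₂ := hc e' q₁ k l (l ≫ k) rfl q₂ q₃ w₂ w₃ wl
          rw [← cancel_mono (c e' q₁ (l ≫ k) q₃ w₃).hom]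
          simp only [Iso.trans_hom, Iso.symm_hom, Category.assoc, Iso.inv_hom_id, Category.comp_id,
            Functor.map_comp]
          rw [h₂, ← Functor.map_comp_assoc _ (c e' q₁ k q₂ w₂).inv, Iso.inv_hom_id,
            CategoryTheory.Functor.map_id, Category.id_comp, ← h₁,
            pullComp_assoc_inv g k l (k ≫ g) (l ≫ k) ((l ≫ k) ≫ g) rfl rfl rfl
              (Category.assoc _ _ _).symm]
          simp)
      refine ⟨t, fun k h hk q₂ w₁ w₂ => ?_⟩
      subst hk
      rw [ht k q₂ w₁]
      simp
    choose t ht using H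
    let s' : Sec F Q :=
      { obj := x
        tr := fun {e e'} => t e e'
        tr_id := fun e q w => hom_ext φ hF q fun e' k q' w' => by
          have h := ht e e (𝟙 e) q q w k k (Category.comp_id k) q' w' w'
          rw [pullComp_id_comp_inv] at h
          exact (cancel_mono _).1 h
        tr_comp := fun {e e' e''} g g' h w q q' q'' w₁ w₂ w₃ => hom_ext φ hF q'' fun e₃ k r wr => by
          have h₁ := ht e e'' h q q'' w₃ k (k ≫ h) rfl r wr (map_comp_of rfl w₃ wr)
          have h₂ := ht e' e'' g' q' q'' w₂ k (k ≫ g') rfl r wr (map_comp_of rfl w₂ wr)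
          have h₃ := ht e e' g q q' w₁ (k ≫ g') (k ≫ h) (by rw [Category.assoc, w]) r
            (map_comp_of rfl w₂ wr) (map_comp_of rfl w₃ wr)
          rw [← cancel_mono (c e'' q'' k r wr).hom, h₁]
          simp only [Functor.map_comp, Category.assoc]
          rw [h₂, pullComp_inv_naturality_assoc, h₃,
            pullComp_assoc_inv g g' k h (k ≫ g') (k ≫ h) w rfl (by rw [Category.assoc, w]) rfl]
          simp [← Functor.map_comp_assoc] }
    refine ⟨s', ⟨Sec.isoMk (fun e q => (pullId F e _).symm ≪≫
      c e (φ.app (op e) q) (𝟙 e) q (by simp)) fun {e e'} g q q' w => ?_⟩⟩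
    have hq : Q.map g.op (φ.app (op e) q) = φ.app (op e') q' := map_app_of_map φ w
    have h₁ := ht e e' g (φ.app (op e) q) (φ.app (op e') q') hq (𝟙 e') g (Category.id_comp g) q'
      (by simp) hq
    have h₂ := hc e (φ.app (op e) q) (𝟙 e) g g (Category.comp_id g) q q' (by simp) hq w
    change (t e e' g _ _ hq).hom ≫ (pullId F e' _).inv ≫ _ =
      (pull F g).map ((pullId F e _).inv ≫ _) ≫ _
    rw [pullId_inv_naturality_assoc, h₁, Functor.map_comp, Category.assoc, ← h₂,
      pullComp_comp_id_inv, pullComp_id_comp_inv, Iso.inv_hom_id_assoc, ← Functor.map_comp_assoc,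
      Iso.inv_hom_id, CategoryTheory.Functor.map_id, Category.id_comp]

include hφ hF in
/-- Cartesian sections extend uniquely along an inclusion of presheaves which is covering in the
sense that the fibred category satisfies descent for all the sieves of liftable arrows. -/
theorem isEquivalence : (Sec.reindex F φ).IsEquivalence :=
  { faithful := faithful φ hF
    full := full φ hφ hF
    essSurj := essSurj φ hφ hF }

end Extend

end Extend

/-! ### Push-forward of fibred categories -/

section Cast

universe t
variable {D : Type u} [Category.{v} D] {F : Pseudofunctor (LocallyDiscrete Dᵒᵖ) Cat.{vX, uX}}
  {Q : Dᵒᵖ ⥤ Type t}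

namespace Sec

/-- The values of a section at equal elements are isomorphic. -/
def cast (s : Sec F Q) {e : D} {q q' : Q.obj (op e)} (h : q = q') : s.obj e q ≅ s.obj e q' :=
  eqToIso (by rw [h])

variable (s : Sec F Q)

theorem cast_inv {e : D} {q q' : Q.obj (op e)} (h : q = q') :
    (s.cast h).inv = (s.cast h.symm).hom := by
  subst h; rfl

theorem cast_cast {e : D} {q q' q'' : Q.obj (op e)} (h : q = q') (h' : q' = q'') :
    (s.cast h).hom ≫ (s.cast h').hom = (s.cast (h.trans h')).hom := by
  subst h h'; exact Category.id_comp _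

theorem tr_cast {e e' : D} (g : e' ⟶ e) (q : Q.obj (op e)) (q' q'' : Q.obj (op e'))
    (w : Q.map g.op q = q') (h : q' = q'') :
    (s.tr g q q' w).hom ≫ (s.cast h).hom = (s.tr g q q'' (w.trans h)).hom :=
  s.tr_eqToHom g q q' q'' w h

theorem cast_tr {e e' : D} (g : e' ⟶ e) (q₁ q : Q.obj (op e))
    (q' : Q.obj (op e')) (w : Q.map g.op q = q') (h : q₁ = q) :
    (pull F g).map (s.cast h).hom ≫ (s.tr g q q' w).hom = (s.tr g q₁ q' (by rw [h, w])).hom :=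
  s.eqToHom_tr g q₁ q q' w h

variable {s} in
theorem hom_cast {s' : Sec F Q} (f : s ⟶ s') {e : D} {q q' : Q.obj (op e)} (h : q = q') :
    f.hom e q ≫ (s'.cast h).hom = (s.cast h).hom ≫ f.hom e q' :=
  hom_eqToHom f h

theorem tr_id_cast {e : D} (q q' : Q.obj (op e)) (w : Q.map (𝟙 e).op q = q')
    (h : q = q') : (s.tr (𝟙 e) q q' w).hom = (pullId F e (s.obj e q)).hom ≫ (s.cast h).hom :=
  s.tr_id' q q' w h

variable {Q' Q'' : Dᵒᵖ ⥤ Type t}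

theorem app_of_comp {φ : Q' ⟶ Q} {ψ : Q'' ⟶ Q'} {χ : Q'' ⟶ Q} (h : ψ ≫ φ = χ) {e : D}
    (q : Q''.obj (op e)) : χ.app (op e) q = φ.app (op e) (ψ.app (op e) q) := by
  subst h; rfl

theorem app_of_id {φ : Q ⟶ Q} (h : φ = 𝟙 Q) {e : D} (q : Q.obj (op e)) : φ.app (op e) q = q := by
  subst h; rfl

variable (F) in
/-- Reindexing is functorial. The values agree only up to a propositional equality of elements,
whence the isomorphism. -/
def reindexComp (φ : Q' ⟶ Q) (ψ : Q'' ⟶ Q') (χ : Q'' ⟶ Q) (h : ψ ≫ φ = χ) :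
    reindex F χ ≅ reindex F φ ⋙ reindex F ψ :=
  NatIso.ofComponents (fun s => Sec.isoMk (fun _ q => s.cast (app_of_comp h q))
    (fun g _ _ _ => (s.tr_cast g _ _ _ _ _).trans (s.cast_tr g _ _ _ _ _).symm))
    (fun f => Sec.hom_ext fun _ q => Sec.hom_cast f (app_of_comp h q))

variable (F) in
/-- Reindexing along the identity. -/
def reindexId (φ : Q ⟶ Q) (h : φ = 𝟙 Q) : reindex F φ ≅ 𝟭 (Sec F Q) :=
  NatIso.ofComponents (fun s => Sec.isoMk (fun _ q => s.cast (app_of_id h q))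
    (fun g _ _ _ => (s.tr_cast g _ _ _ _ _).trans (s.cast_tr g _ _ _ _ _).symm))
    (fun f => Sec.hom_ext fun _ q => Sec.hom_cast f (app_of_id h q))

theorem reindexComp_assoc {Q₀ Q₁ Q₂ Q₃ : Dᵒᵖ ⥤ Type t} (f : Q₁ ⟶ Q₀) (g : Q₂ ⟶ Q₁) (k : Q₃ ⟶ Q₂)
    (gf : Q₂ ⟶ Q₀) (kg : Q₃ ⟶ Q₁) (h : Q₃ ⟶ Q₀) (w₁ : g ≫ f = gf) (w₂ : k ≫ g = kg)
    (w₃ : kg ≫ f = h) (w₄ : k ≫ gf = h) (x : Sec F Q₀) :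
    (reindexComp F f kg h w₃).hom.app x ≫ (reindexComp F g k kg w₂).hom.app ((reindex F f).obj x) =
      (reindexComp F gf k h w₄).hom.app x ≫
        (reindex F k).map ((reindexComp F f g gf w₁).hom.app x) :=
  hom_ext fun _ q => (x.cast_cast (app_of_comp w₃ q) (congrArg (f.app _) (app_of_comp w₂ q))).trans
    (x.cast_cast (app_of_comp w₄ q) (app_of_comp w₁ (k.app _ q))).symm

theorem reindexComp_comp_id (f : Q' ⟶ Q) (i : Q' ⟶ Q') (hi : i = 𝟙 Q') (w : i ≫ f = f)
    (x : Sec F Q) :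
    (reindexComp F f i f w).hom.app x ≫ (reindexId F i hi).hom.app ((reindex F f).obj x) = 𝟙 _ :=
  hom_ext fun _ q => x.cast_cast (app_of_comp w q) (congrArg (f.app _) (app_of_id hi q))

theorem reindexComp_id_comp (f : Q' ⟶ Q) (i : Q ⟶ Q) (hi : i = 𝟙 Q) (w : f ≫ i = f) (x : Sec F Q) :
    (reindexComp F i f f w).hom.app x ≫ (reindex F f).map ((reindexId F i hi).hom.app x) = 𝟙 _ :=
  hom_ext fun _ q => x.cast_cast (app_of_comp w q) (app_of_id hi (f.app _ q))

end Sec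

end Cast

section Push

variable {C : Type u} [Category.{v} C] {E : Type u₁} [Category.{v} E] (j : E ⥤ C)
  (Z : Pseudofunctor (LocallyDiscrete Eᵒᵖ) Cat.{vX, uX})

/-- The presheaf on `E` of morphisms to a fixed object `S` of `C`. -/
abbrev homTo (S : C) : Eᵒᵖ ⥤ Type v := j.op ⋙ yoneda.obj S

/-- Composition with a fixed morphism. -/
def homToMap {S S' : C} (g : S' ⟶ S) : homTo j S' ⟶ homTo j S :=
  Functor.whiskerLeft j.op (yoneda.map g)

theorem homToMap_id (S : C) : homToMap j (𝟙 S) = 𝟙 _ := by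
  rw [homToMap, yoneda.map_id]; rfl

theorem homToMap_comp {S S' S'' : C} {f : S' ⟶ S} {g : S'' ⟶ S'} {h : S'' ⟶ S} (w : g ≫ f = h) :
    homToMap j g ≫ homToMap j f = homToMap j h := by
  subst w; rw [homToMap, homToMap, homToMap, yoneda.map_comp]; rfl

/-- The data of the push-forward `j_* Z`, whose fibre over `S` consists of the cartesian sections
of `Z` over the category of objects of `E` with a morphism to `S`. -/
def pushData : FibData.{v, u, max u₁ v vX, max u₁ v vX uX} C where
  obj S := Sec Z (homTo j S)
  cat _ := inferInstance
  map g := Sec.reindex Z (homToMap j g)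
  mapId S := Sec.reindexId Z _ (homToMap_id j S)
  mapComp f g h w := Sec.reindexComp Z (homToMap j f) (homToMap j g) (homToMap j h)
    (homToMap_comp j w)
  assoc f g k gf kg h w₁ w₂ w₃ w₄ x := Sec.reindexComp_assoc (homToMap j f) (homToMap j g)
    (homToMap j k) (homToMap j gf) (homToMap j kg) (homToMap j h) (homToMap_comp j w₁)
    (homToMap_comp j w₂) (homToMap_comp j w₃) (homToMap_comp j w₄) x
  comp_id f _ x := Sec.reindexComp_comp_id (homToMap j f) _ (homToMap_id j _) _ x
  id_comp f _ x := Sec.reindexComp_id_comp (homToMap j f) _ (homToMap_id j _) _ x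

/-- The push-forward `j_* Z` of a fibred category `Z` along a functor `j`, see `pushData`. -/
def push : Pseudofunctor (LocallyDiscrete Cᵒᵖ) Cat.{max u₁ v vX, max u₁ v vX uX} :=
  (pushData j Z).toPseudofunctor

end Push

/-! ### Descent for push-forwards -/

section PushDescent

variable {C : Type u} [Category.{v} C] {E : Type u₁} [Category.{v} E] {j : E ⥤ C}
  {Z : Pseudofunctor (LocallyDiscrete Eᵒᵖ) Cat.{vX, uX}}

namespace Sec

section At

variable {S : C} (x : Sec Z (homTo j S))

/-- The value of a section at a morphism `q : j(e) ⟶ S`. Together with the following declarations it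
restates the structure of a section over `homTo j S` in terms of morphisms of `C`. -/
def at' {e : E} (q : j.obj e ⟶ S) : Fibre Z e := x.obj e q

/-- The transition isomorphisms between the values at morphisms. -/
def trAt {e e' : E} (g : e' ⟶ e) (q : j.obj e ⟶ S) (q' : j.obj e' ⟶ S) (w : j.map g ≫ q = q') :
    (pull Z g).obj (x.at' q) ≅ x.at' q' := x.tr g q q' w

/-- The values at equal morphisms are isomorphic. -/
def castAt {e : E} {q q' : j.obj e ⟶ S} (h : q = q') : x.at' q ≅ x.at' q' := x.cast h

@[simp]
theorem castAt_castAt {e : E} {q q' q'' : j.obj e ⟶ S} (h : q = q') (h' : q' = q'') :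
    (x.castAt h).hom ≫ (x.castAt h').hom = (x.castAt (h.trans h')).hom := x.cast_cast h h'

theorem trAt_castAt {e e' : E} (g : e' ⟶ e) (q : j.obj e ⟶ S) (q' q'' : j.obj e' ⟶ S)
    (w : j.map g ≫ q = q') (h : q' = q'') :
    (x.trAt g q q' w).hom ≫ (x.castAt h).hom = (x.trAt g q q'' (w.trans h)).hom :=
  x.tr_cast g _ _ _ w h

theorem trAt_id {e : E} (q q' : j.obj e ⟶ S) (w : j.map (𝟙 e) ≫ q = q') (h : q = q') :
    (x.trAt (𝟙 e) q q' w).hom = (pullId Z e (x.at' q)).hom ≫ (x.castAt h).hom :=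
  x.tr_id_cast q q' w h

theorem trAt_comp {e e' e'' : E} (g : e' ⟶ e) (g' : e'' ⟶ e') (h : e'' ⟶ e) (w : g' ≫ g = h)
    (q : j.obj e ⟶ S) (q' : j.obj e' ⟶ S) (q'' : j.obj e'' ⟶ S)
    (w₁ : j.map g ≫ q = q') (w₂ : j.map g' ≫ q' = q'') (w₃ : j.map h ≫ q = q'') :
    (x.trAt h q q'' w₃).hom = (pullComp Z g g' h w (x.at' q)).hom ≫
      (pull Z g').map (x.trAt g q q' w₁).hom ≫ (x.trAt g' q' q'' w₂).hom :=
  x.tr_comp g g' h w q q' q'' w₁ w₂ w₃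

variable {x} {x' : Sec Z (homTo j S)}

/-- The component of a morphism of sections at a morphism `q : j(e) ⟶ S`. -/
def homAt' (f : x ⟶ x') {e : E} (q : j.obj e ⟶ S) : x.at' q ⟶ x'.at' q := f.hom e q

theorem trAt_homAt' (f : x ⟶ x') {e e' : E} (g : e' ⟶ e) (q : j.obj e ⟶ S) (q' : j.obj e' ⟶ S)
    (w : j.map g ≫ q = q') :
    (x.trAt g q q' w).hom ≫ homAt' f q' = (pull Z g).map (homAt' f q) ≫ (x'.trAt g q q' w).hom :=
  f.comm g q q' w

end At

section Double

variable {Q : Cᵒᵖ ⥤ Type v} (y : Sec (push j Z) Q)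

/-- The value of a section of `j_* Z`, as a section of `Z`. -/
def sec {X : C} (f : Q.obj (op X)) : Sec Z (homTo j X) := y.obj X f

/-- The transition isomorphism of a section of `j_* Z`. -/
def trSec {X X' : C} (g : X' ⟶ X) (f : Q.obj (op X)) (f' : Q.obj (op X')) (w : Q.map g.op f = f') :
    (Sec.reindex Z (homToMap j g)).obj (y.sec f) ≅ y.sec f' := y.tr g f f' w

/-- The components of the transition isomorphisms of a section of `j_* Z`. -/
def tr₂ {X X' : C} (g : X' ⟶ X) (f : Q.obj (op X)) (f' : Q.obj (op X')) (w : Q.map g.op f = f')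
    {e : E} (q : j.obj e ⟶ X') (r : j.obj e ⟶ X) (hr : q ≫ g = r) :
    (y.sec f).at' r ≅ (y.sec f').at' q :=
  (y.sec f).castAt hr.symm ≪≫ isoApp (y.trSec g f f' w) e q

/-- The two kinds of transition isomorphisms of a section of `j_* Z` commute: those of its values,
which are sections of `Z`, and those between its values. -/
theorem tr₂_nat {X X' : C} (g : X' ⟶ X) (f : Q.obj (op X)) (f' : Q.obj (op X'))
    (w : Q.map g.op f = f') {e e' : E} (k : e' ⟶ e) (q : j.obj e ⟶ X') (r : j.obj e ⟶ X)
    (hr : q ≫ g = r) (q' : j.obj e' ⟶ X') (r' : j.obj e' ⟶ X) (hr' : q' ≫ g = r')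
    (wq : j.map k ≫ q = q') (wr : j.map k ≫ r = r') :
    ((y.sec f).trAt k r r' wr).hom ≫ (y.tr₂ g f f' w q' r' hr').hom =
      (pull Z k).map (y.tr₂ g f f' w q r hr).hom ≫ ((y.sec f').trAt k q q' wq).hom := by
  subst hr hr'
  exact ((congrArg (_ ≫ ·) (Category.id_comp _)).trans
    ((y.trSec g f f' w).hom.comm k q q' wq)).trans
    (congrArg (fun t => (pull Z k).map t ≫ _) (Category.id_comp _)).symm

theorem tr₂_id {X : C} (g : X ⟶ X) (hg : g = 𝟙 X) (f : Q.obj (op X)) (w : Q.map g.op f = f) {e : E}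
    (q r : j.obj e ⟶ X) (hr : q ≫ g = r) (h : r = q) :
    (y.tr₂ g f f w q r hr).hom = ((y.sec f).castAt h).hom := by
  subst hg
  have H := congrArg (fun t : (Sec.reindex Z (homToMap j (𝟙 X))).obj (y.sec f) ⟶ y.sec f =>
    t.hom e q) (y.tr_id X f w)
  refine (congrArg (_ ≫ ·) H).trans ?_
  exact (y.sec f).castAt_castAt hr.symm (Category.comp_id q)

theorem tr₂_comp {X X' X'' : C} (g : X' ⟶ X) (g' : X'' ⟶ X') (h : X'' ⟶ X) (w : g' ≫ g = h)
    (f : Q.obj (op X)) (f' : Q.obj (op X')) (f'' : Q.obj (op X''))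
    (w₁ : Q.map g.op f = f') (w₂ : Q.map g'.op f' = f'') (w₃ : Q.map h.op f = f'')
    {e : E} (q : j.obj e ⟶ X'') (q' : j.obj e ⟶ X') (r : j.obj e ⟶ X) (hq : q ≫ g' = q')
    (hr : q' ≫ g = r) (hr' : q ≫ h = r) :
    (y.tr₂ h f f'' w₃ q r hr').hom =
      (y.tr₂ g f f' w₁ q' r hr).hom ≫ (y.tr₂ g' f' f'' w₂ q q' hq).hom := by
  subst hr hq
  have H := congrArg (fun t : (Sec.reindex Z (homToMap j h)).obj (y.sec f) ⟶ y.sec f'' =>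
    t.hom e q) (y.tr_comp g g' h w f f' f'' w₁ w₂ w₃)
  refine (congrArg (_ ≫ ·) (H.trans (congrArg (fun t : (Sec.reindex Z (homToMap j h)).obj
    (y.sec f) ⟶ (Sec.reindex Z (homToMap j g')).obj ((Sec.reindex Z (homToMap j g)).obj
    (y.sec f)) => t.hom e q ≫ _)
      ((pushData j Z).toPseudofunctor_pullComp_hom g g' h w (y.sec f))))).trans ?_
  refine (Category.assoc _ _ _).symm.trans ?_
  refine (congrArg (· ≫ _) ((y.sec f).castAt_castAt hr'.symm hr')).trans ?_
  exact (Category.id_comp _).trans (congrArg₂ (· ≫ ·) (Category.id_comp _)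
    (Category.id_comp _)).symm

/-- Morphisms of sections of `j_* Z` are determined by their components in the fibres of `Z`. -/
theorem hom_ext₂ {y y' : Sec (push j Z) Q} {b b' : y ⟶ y'}
    (h : ∀ {X : C} (f : Q.obj (op X)) {e : E} (q : j.obj e ⟶ X),
      homAt' (x := y.sec f) (x' := y'.sec f) (b.hom X f) q =
        homAt' (x := y.sec f) (x' := y'.sec f) (b'.hom X f) q) : b = b' :=
  hom_ext fun _ f => Sec.hom_ext (F := Z) fun _ q => h f q

end Double

end Sec

end PushDescent

section PushDescent

variable {C : Type u} [Category.{v} C] {E : Type u₁} [Category.{v} E] {j : E ⥤ C}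
  {Z : Pseudofunctor (LocallyDiscrete Eᵒᵖ) Cat.{vX, uX}} {Q : Cᵒᵖ ⥤ Type v}

namespace Sec

theorem tr₂_homAt' {y y' : Sec (push j Z) Q} (b : y ⟶ y') {X X' : C} (g : X' ⟶ X)
    (f : Q.obj (op X)) (f' : Q.obj (op X')) (w : Q.map g.op f = f')
    {e : E} (q : j.obj e ⟶ X') (r : j.obj e ⟶ X) (hr : q ≫ g = r) :
    (y.tr₂ g f f' w q r hr).hom ≫ homAt' (x := y.sec f') (x' := y'.sec f') (b.hom X' f') q =
      homAt' (x := y.sec f) (x' := y'.sec f) (b.hom X f) r ≫ (y'.tr₂ g f f' w q r hr).hom := by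
  subst hr
  have H := congrArg (fun t : (Sec.reindex Z (homToMap j g)).obj (y.sec f) ⟶ y'.sec f' =>
    t.hom e q) (b.comm g f f' w)
  refine (congrArg (· ≫ _) (Category.id_comp _)).trans (H.trans ?_)
  exact congrArg (_ ≫ ·) (Category.id_comp _).symm

theorem tr₂_eqToHom (y : Sec (push j Z) Q) {X X' : C} (g : X' ⟶ X) (f : Q.obj (op X))
    (f' f'' : Q.obj (op X')) (w : Q.map g.op f = f') (h : f' = f'') {e : E} (q : j.obj e ⟶ X')
    (r : j.obj e ⟶ X) (hr : q ≫ g = r) :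
    (y.tr₂ g f f' w q r hr).hom ≫ eqToHom (by rw [h]) =
      (y.tr₂ g f f'' (w.trans h) q r hr).hom := by
  subst h; exact Category.comp_id _

/-- An isomorphism between sections of a push-forward is given by its components. -/
def isoMk₂ {y y' : Sec (push j Z) Q}
    (i : ∀ {X : C} (f : Q.obj (op X)) {e : E} (q : j.obj e ⟶ X),
      (y.sec f).at' q ≅ (y'.sec f).at' q)
    (h₁ : ∀ {X : C} (f : Q.obj (op X)) {e e' : E} (g : e' ⟶ e) (q : j.obj e ⟶ X)
      (q' : j.obj e' ⟶ X) (w : j.map g ≫ q = q'),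
      ((y.sec f).trAt g q q' w).hom ≫ (i f q').hom =
        (pull Z g).map (i f q).hom ≫ ((y'.sec f).trAt g q q' w).hom)
    (h₂ : ∀ {X X' : C} (g : X' ⟶ X) (f : Q.obj (op X)) (f' : Q.obj (op X'))
      (w : Q.map g.op f = f') {e : E} (q : j.obj e ⟶ X'),
      (y.tr₂ g f f' w q (q ≫ g) rfl).hom ≫ (i f' q).hom =
        (i f (q ≫ g)).hom ≫ (y'.tr₂ g f f' w q (q ≫ g) rfl).hom) : y ≅ y' :=
  Sec.isoMk (F := push j Z) (fun _ f => Sec.isoMk (F := Z) (s := y.sec f) (s' := y'.sec f)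
    (fun _ q => i f q) (h₁ f)) fun g f f' w => Sec.hom_ext (F := Z) fun _ q =>
      (congrArg (· ≫ _) (Category.id_comp _)).symm.trans ((h₂ g f f' w q).trans
        (congrArg (_ ≫ ·) (Category.id_comp _)))

/-- The pull-back of an element along a morphism `j(e) ⟶ X`. -/
def elt {X : C} (f : Q.obj (op X)) {e : E} (q : j.obj e ⟶ X) : (j.op ⋙ Q).obj (op e) := Q.map q.op f

theorem map_elt {X : C} (f : Q.obj (op X)) {e e' : E} (g : e' ⟶ e) (q : j.obj e ⟶ X)
    (q' : j.obj e' ⟶ X) (w : j.map g ≫ q = q') : (j.op ⋙ Q).map g.op (elt f q) = elt f q' :=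
  map_comp_of (Q := Q) w rfl rfl |>.symm

theorem elt_comp {X X' : C} {g : X' ⟶ X} {f : Q.obj (op X)} {f' : Q.obj (op X')}
    (w : Q.map g.op f = f') {e : E} {q : j.obj e ⟶ X'} {r : j.obj e ⟶ X} (hr : q ≫ g = r) :
    elt f r = elt f' q :=
  map_comp_of (Q := Q) hr w rfl

theorem elt_id {e : E} (p : (j.op ⋙ Q).obj (op e)) :
    elt (X := j.obj e) (Q := Q) p (𝟙 (j.obj e)) = p := by
  refine (ConcreteCategory.congr_hom (Q.map_id (op (j.obj e))) p).trans ?_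
  rfl

/-- The morphism of presheaves defined by an element. -/
def eltMap {X : C} (f : Q.obj (op X)) : homTo j X ⟶ j.op ⋙ Q :=
  Functor.whiskerLeft j.op (yonedaEquiv.symm f)

theorem eltMap_comp {X X' : C} {g : X' ⟶ X} {f : Q.obj (op X)} {f' : Q.obj (op X')}
    (w : Q.map g.op f = f') : homToMap j g ≫ eltMap f = eltMap f' := by
  ext e q
  exact elt_comp w rfl

end Sec

open Sec

/-- The functor from sections of `Z` over `j^* Q` to sections of `j_* Z` over `Q`. The value at an
element `f ∈ Q(X)` is the section of `Z` with the value at `q^* f` for each `q : j(e) ⟶ X`. -/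
def expand (Z : Pseudofunctor (LocallyDiscrete Eᵒᵖ) Cat.{vX, uX}) (Q : Cᵒᵖ ⥤ Type v) :
    Sec Z (j.op ⋙ Q) ⥤ Sec (push j Z) Q where
  obj z :=
    { obj := fun X f => (reindex Z (eltMap f)).obj z
      tr := fun g f f' w =>
        ((reindexComp Z (eltMap f) (homToMap j g) (eltMap f') (eltMap_comp w)).app z).symm
      tr_id := fun X f w => Sec.hom_ext (F := Z) fun e q =>
        z.cast_inv (elt_comp (j := j) w (q := q) rfl).symm
      tr_comp := fun {X X' X''} g g' h w f f' f'' w₁ w₂ w₃ => by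
        refine Sec.hom_ext (F := Z) fun e q => ?_
        refine Eq.trans ?_ (congrArg (fun t : (Sec.reindex Z (homToMap j h)).obj
          ((reindex Z (eltMap f)).obj z) ⟶ (Sec.reindex Z (homToMap j g')).obj
          ((Sec.reindex Z (homToMap j g)).obj ((reindex Z (eltMap f)).obj z)) => t.hom e q ≫ _)
          ((pushData j Z).toPseudofunctor_pullComp_hom g g' h w
            ((reindex Z (eltMap f)).obj z))).symm
        have h₁ : elt f (Q := Q) (e := e) (q ≫ h) = elt f ((q ≫ g') ≫ g) := by
          subst w; rw [Category.assoc]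
        have h₂ : elt f ((q ≫ g') ≫ g) = elt f' (q ≫ g') := elt_comp w₁ rfl
        have h₃ : elt f' (q ≫ g') = elt f'' q := elt_comp w₂ rfl
        refine (z.cast_inv (h₁.trans (h₂.trans h₃)).symm).trans ?_
        refine Eq.trans ?_ (congrArg ((z.cast h₁).hom ≫ ·)
          (congrArg₂ (· ≫ ·) (z.cast_inv h₂.symm) (z.cast_inv h₃.symm))).symm
        refine Eq.trans ?_ (congrArg ((z.cast h₁).hom ≫ ·) (z.cast_cast h₂ h₃)).symm
        exact (z.cast_cast h₁ (h₂.trans h₃)).symm }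
  map b :=
    { hom := fun X f => (reindex Z (eltMap f)).map b
      comm := fun g f f' w => ((reindexComp Z (eltMap f) (homToMap j g) (eltMap f')
        (eltMap_comp w)).inv.naturality b).symm }
  map_id z := rfl
  map_comp b b' := rfl

theorem expand_tr₂ (z : Sec Z (j.op ⋙ Q)) {X X' : C} (g : X' ⟶ X) (f : Q.obj (op X))
    (f' : Q.obj (op X')) (w : Q.map g.op f = f')
    {e : E} (q : j.obj e ⟶ X') (r : j.obj e ⟶ X) (hr : q ≫ g = r) :
    (((expand Z Q).obj z).tr₂ g f f' w q r hr).hom = (z.cast (elt_comp w hr)).hom := by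
  subst hr
  exact (Category.id_comp _).trans (z.cast_inv (elt_comp w rfl).symm)

theorem map_eq_elt {X : C} (f : Q.obj (op X)) {e : E} (q : j.obj e ⟶ X) :
    Q.map q.op f = elt f q := rfl

/-- A section over `j^* Q` is recovered from its image under `expand` at the identities of the
objects `j(e)`. -/
theorem expand_faithful : (expand (j := j) Z Q).Faithful where
  map_injective {z z'} b b' h := Sec.hom_ext fun e p => by
    have h₁ : b.hom e (elt (X := j.obj e) (Q := Q) p (𝟙 (j.obj e))) =
        b'.hom e (elt (X := j.obj e) (Q := Q) p (𝟙 (j.obj e))) :=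
      congrArg (fun t : (expand (j := j) Z Q).obj z ⟶ (expand (j := j) Z Q).obj z' =>
        homAt' (x := ((expand (j := j) Z Q).obj z).sec p)
          (x' := ((expand (j := j) Z Q).obj z').sec p) (t.hom (j.obj e) p) (𝟙 (j.obj e))) h
    rw [← cancel_mono (z'.cast (elt_id p).symm).hom, Sec.hom_cast, Sec.hom_cast, h₁]

/-- A family of morphisms indexed by all `f ∈ Q(X)` and `q : j(e) ⟶ X` comes from a family
indexed by the elements `q^* f`, if it is compatible with the pull-back of `f`. -/
theorem exists_hom_of_expand {z z' : Sec Z (j.op ⋙ Q)}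
    (β : ∀ {X : C} (f : Q.obj (op X)) {e : E} (q : j.obj e ⟶ X),
      z.obj e (elt f q) ⟶ z'.obj e (elt f q))
    (h₁ : ∀ {X : C} (f : Q.obj (op X)) {e e' : E} (g : e' ⟶ e) (q : j.obj e ⟶ X)
      (q' : j.obj e' ⟶ X) (w : j.map g ≫ q = q'),
      (z.tr g (elt f q) (elt f q') (map_elt f g q q' w)).hom ≫ β f q' =
        (pull Z g).map (β f q) ≫ (z'.tr g (elt f q) (elt f q') (map_elt f g q q' w)).hom)
    (h₂ : ∀ {X X' : C} (g : X' ⟶ X) (f : Q.obj (op X)) (f' : Q.obj (op X'))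
      (w : Q.map g.op f = f') {e : E} (q : j.obj e ⟶ X') (r : j.obj e ⟶ X) (hr : q ≫ g = r),
      (z.cast (elt_comp w hr)).hom ≫ β f' q = β f r ≫ (z'.cast (elt_comp w hr)).hom) :
    ∃ b : z ⟶ z', ∀ {X : C} (f : Q.obj (op X)) {e : E} (q : j.obj e ⟶ X),
      b.hom e (elt f q) = β f q := by
  refine ⟨⟨fun e p => (z.cast (elt_id p).symm).hom ≫ β p (𝟙 (j.obj e)) ≫
    (z'.cast (elt_id p)).hom, fun {e e'} g p p' w => ?_⟩, fun {X} f {e} q => ?_⟩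
  · have hw : elt (X := j.obj e) (Q := Q) p (j.map g) =
        elt (X := j.obj e') (Q := Q) p' (𝟙 (j.obj e')) :=
      elt_comp (X := j.obj e) (X' := j.obj e') (g := j.map g) w (Category.id_comp (j.map g))
    have H₁ := h₁ p g (𝟙 _) (j.map g) (Category.comp_id _)
    have H₂ := h₂ (j.map g) p p' w (𝟙 _) (j.map g) (Category.id_comp _)
    have hw' : (j.op ⋙ Q).map g.op p = elt (X := j.obj e) (Q := Q) p (j.map g) :=
      w.trans (hw.trans (elt_id (Q := Q) p')).symm
    refine (Category.assoc _ _ _).symm.trans ((congrArg (· ≫ _)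
      (z.tr_cast g p p' _ w (elt_id p').symm)).trans ?_)
    refine ((congrArg (· ≫ _) (z.tr_cast g p _ _ hw' hw)).symm.trans
      (Category.assoc _ _ _)).trans ?_
    refine (congrArg (_ ≫ ·) (((Category.assoc _ _ _).symm.trans (congrArg (· ≫ _) H₂)).trans
      ((Category.assoc _ _ _).trans (congrArg (_ ≫ ·) (z'.cast_cast _ _))))).trans ?_
    refine (congrArg (· ≫ _) (z.cast_tr g p _ _ (map_elt (X := j.obj e) (Q := Q) p g (𝟙 _) (j.map g)
      (Category.comp_id _)) (elt_id p).symm).symm).trans ?_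
    refine (Category.assoc _ _ _).trans ?_
    refine (congrArg (_ ≫ ·) ((Category.assoc _ _ _).symm.trans ((congrArg (· ≫ _) H₁).trans
      (Category.assoc _ _ _)))).trans ?_
    rw [Functor.map_comp, Functor.map_comp, Category.assoc, Category.assoc]
    refine congrArg (_ ≫ ·) (congrArg (_ ≫ ·) ?_)
    exact (z'.tr_cast _ _ _ _ _ _).trans (z'.cast_tr _ _ _ _ _ _).symm
  · have H₂ := h₂ q f (elt f q) (map_eq_elt f q) (𝟙 _) q (Category.id_comp _)
    change (z.cast (elt_id (elt f q)).symm).hom ≫ β (elt f q) (𝟙 (j.obj e)) ≫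
      (z'.cast (elt_id (elt f q))).hom = _
    rw [reassoc_of% H₂, z'.cast_cast]
    exact Category.comp_id _

theorem expand_full : (expand (j := j) Z Q).Full where
  map_surjective {z z'} B := by
    obtain ⟨b, hb⟩ := exists_hom_of_expand
      (fun {X} f {e} q => homAt' (x := ((expand (j := j) Z Q).obj z).sec f)
          (x' := ((expand (j := j) Z Q).obj z').sec f) (B.hom X f) q)
      (fun f e e' g q q' w => trAt_homAt' (x := ((expand (j := j) Z Q).obj z).sec f)
          (x' := ((expand (j := j) Z Q).obj z').sec f) (B.hom _ f) g q q' w)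
      (fun g f f' w e q r hr => by
        have H := tr₂_homAt' B g f f' w q r hr
        rw [expand_tr₂, expand_tr₂] at H
        exact H)
    exact ⟨b, hom_ext₂ fun f e q => hb f q⟩

/-- The section of `Z` over `j^* Q` defined by a section `y` of `j_* Z` over `Q`: its value at
`p ∈ Q(j(e))` is the value of the section `y(p)` at the identity of `j(e)`. -/
def contract (y : Sec (push j Z) Q) : Sec Z (j.op ⋙ Q) where
  obj e p := (y.sec (X := j.obj e) p).at' (𝟙 (j.obj e))
  tr {e e'} g p p' w := (y.sec (X := j.obj e) p).trAt g (𝟙 _) (j.map g) (Category.comp_id _) ≪≫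
    y.tr₂ (j.map g) p p' w (𝟙 _) (j.map g) (Category.id_comp _)
  tr_id e p w := by
    refine (congrArg₂ (· ≫ ·) ((y.sec (X := j.obj e) p).trAt_id (𝟙 _) (j.map (𝟙 e))
      (Category.comp_id _) (j.map_id e).symm) (y.tr₂_id (j.map (𝟙 e)) (j.map_id e) p w (𝟙 _)
      (j.map (𝟙 e)) (Category.id_comp _) (j.map_id e))).trans ?_
    rw [Category.assoc, castAt_castAt]
    exact Category.comp_id _
  tr_comp {e e' e''} g g' h w p p' p'' w₁ w₂ w₃ := by
    have hw : j.map g' ≫ j.map g = j.map h := by rw [← w, Functor.map_comp]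
    refine (congrArg₂ (· ≫ ·) ((y.sec (X := j.obj e) p).trAt_comp g g' h w (𝟙 _) (j.map g) (j.map h)
      (Category.comp_id _) hw (Category.comp_id _)) (y.tr₂_comp (j.map g) (j.map g') (j.map h) hw
      p p' p'' w₁ w₂ w₃ (𝟙 _) (j.map g') (j.map h) (Category.id_comp _) hw
      (Category.id_comp _))).trans ?_
    have H := y.tr₂_nat (j.map g) p p' w₁ g' (𝟙 _) (j.map g) (Category.id_comp _) (j.map g')
      (j.map h) hw (Category.comp_id _) hw
    simp only [Iso.trans_hom, Functor.map_comp, Category.assoc]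
    rw [reassoc_of% H]

theorem expand_essSurj : (expand (j := j) Z Q).EssSurj where
  mem_essImage y := by
    refine ⟨contract y, ⟨isoMk₂ (fun f e q =>
      (y.tr₂ q f (elt f q) (map_eq_elt f q) (𝟙 _) q (Category.id_comp _)).symm)
      (fun f e e' g q q' w => ?_) fun g f f' w e q => ?_⟩⟩
    · change ((contract y).tr g _ _ (map_elt f g q q' w)).hom ≫ _ = _
      have H₁ := y.tr₂_nat q f (elt f q) (map_eq_elt f q) g (𝟙 _) q (Category.id_comp _) (j.map g)
        q' w (Category.comp_id _) w
      have H₂ := y.tr₂_comp q (j.map g) q' w f (elt f q) (elt f q') (map_eq_elt f q)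
        (map_elt f g q q' w) (map_eq_elt f q')
        (𝟙 _) (j.map g) q' (Category.id_comp _) w (Category.id_comp _)
      refine (Iso.comp_inv_eq _).2 ?_
      refine Eq.trans ?_ (Category.assoc _ _ _).symm
      refine Eq.trans ?_ (congrArg (_ ≫ ·) (congrArg (_ ≫ ·) H₂.symm))
      refine Eq.trans ?_ (congrArg (_ ≫ ·)
        ((congrArg (· ≫ _) H₁.symm).trans (Category.assoc _ _ _)))
      refine Eq.trans ?_ (congrArg (_ ≫ ·) (Category.assoc _ _ _).symm)
      refine Eq.trans ?_ (Functor.map_comp_assoc _ _ _ _)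
      refine ((congrArg (· ≫ _) ((congrArg (pull Z g).map (Iso.inv_hom_id _)).trans
        (CategoryTheory.Functor.map_id _ _))).trans (Category.id_comp _)).symm
    · rw [expand_tr₂]
      have H₂ := y.tr₂_comp g q (q ≫ g) rfl f f' (elt f' q) w (map_eq_elt f' q)
        ((map_eq_elt f _).trans (elt_comp w rfl))
        (𝟙 _) q (q ≫ g) (Category.id_comp _) rfl (Category.id_comp _)
      refine (Iso.comp_inv_eq _).2 ?_
      refine Eq.trans ?_ (Category.assoc _ _ _).symm
      refine (Iso.eq_inv_comp _).2 ?_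
      refine Eq.trans ?_ H₂
      exact y.tr₂_eqToHom (q ≫ g) f _ _ (map_eq_elt f _) (elt_comp w rfl) (𝟙 _) (q ≫ g)
        (Category.id_comp _)

instance expand_isEquivalence : (expand (j := j) Z Q).IsEquivalence :=
  { faithful := expand_faithful
    full := expand_full
    essSurj := expand_essSurj }

end PushDescent

section PushDescent

variable {C : Type u} [Category.{v} C] {E : Type u₁} [Category.{v} E] {j : E ⥤ C}
  {Z : Pseudofunctor (LocallyDiscrete Eᵒᵖ) Cat.{vX, uX}}

open Sec

theorem toSec_push_tr₂ {S : C} (R : Sieve S) (y : Sec Z (homTo j S)) {X X' : C} (g : X' ⟶ X)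
    (f : R.functor.obj (op X)) (f' : R.functor.obj (op X')) (w : R.functor.map g.op f = f')
    {e : E} (q : j.obj e ⟶ X') (r : j.obj e ⟶ X) (hr : q ≫ g = r) (h : r ≫ arrow f = q ≫ arrow f') :
    (((toSec (F := push j Z) R).obj y).tr₂ g f f' w q r hr).hom = (y.castAt h).hom := by
  subst hr
  refine (Category.id_comp _).trans ?_
  refine (congrArg (fun t : (Sec.reindex Z (homToMap j g)).obj ((Sec.reindex Z
    (homToMap j (arrow f))).obj y) ⟶ (Sec.reindex Z (homToMap j (arrow f'))).obj y =>
    t.hom e q) ((pushData j Z).toPseudofunctor_pullComp_inv (arrow f) g (arrow f')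
    (arrow_map w) y)).trans ?_
  exact y.cast_inv h.symm

/-- Over a sieve, the sections of a push-forward defined by an object of the fibre come from the
restriction of this object. -/
def toSecPushIso {S : C} (R : Sieve S) :
    toSec (F := push j Z) R ≅
      Sec.reindex Z (Functor.whiskerLeft j.op R.functorInclusion) ⋙ expand (j := j) Z R.functor :=
  NatIso.ofComponents (fun y => isoMk₂ (y := (toSec (F := push j Z) R).obj y)
    (y' := (expand (j := j) Z R.functor).obj ((Sec.reindex Z
      (Functor.whiskerLeft j.op R.functorInclusion)).obj y))
      (fun f e q => Iso.refl (y.obj e (q ≫ arrow f)))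
    (fun _ _ _ _ _ _ _ => (Category.comp_id _).trans ((congrArg (· ≫ _)
      (CategoryTheory.Functor.map_id _ _)).trans (Category.id_comp _)).symm)
    (fun g f f' w _ q => (Category.comp_id _).trans
      ((toSec_push_tr₂ R y g f f' w q (q ≫ g) rfl
        ((Category.assoc _ _ _).trans (congrArg (q ≫ ·) (arrow_map w)))).trans
      ((expand_tr₂ ((Sec.reindex Z (Functor.whiskerLeft j.op R.functorInclusion)).obj y) g f f' w q
        (q ≫ g) rfl).symm.trans (Category.id_comp _).symm))))
    (fun _ => hom_ext₂ fun _ _ _ => (Category.comp_id _).trans (Category.id_comp _).symm)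

/-- A push-forward satisfies descent for a sieve as soon as the original fibred category satisfies
descent for all the sieves of arrows pulling it back. -/
theorem push_isStackFor {S : C} (R : Sieve S)
    (h : ∀ (e : E) (q : j.obj e ⟶ S), Z.IsStackFor ((R.pullback q).functorPullback j).arrows) :
    (push j Z).IsStackFor R.arrows := by
  rw [isStackFor_iff]
  have : (Sec.reindex Z (Functor.whiskerLeft j.op R.functorInclusion)).IsEquivalence := by
    refine Extend.isEquivalence _ (fun e => ?_) fun e q => ?_
    · intro a b hab; exact Subtype.ext hab
    · -- an arrow to `e` lifts if its composite with `q` is in the sieve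
      have hs : liftSieve (Functor.whiskerLeft j.op R.functorInclusion) q =
          (R.pullback (X := S) q).functorPullback j := by
        ext e' g
        constructor
        · rintro ⟨q', hq'⟩
          have : j.map g ≫ q = q'.1 := hq'
          change R.arrows (j.map g ≫ q)
          rw [this]; exact q'.2
        · intro hg
          exact ⟨⟨j.map g ≫ q, hg⟩, rfl⟩
      rw [hs]
      exact isStackFor_iff.1 (h e q)
  have : (Sec.reindex Z (Functor.whiskerLeft j.op R.functorInclusion) ⋙
      expand (j := j) Z R.functor).IsEquivalence :=
    @Functor.isEquivalence_trans _ _ _ _ _ _ _ _ this expand_isEquivalence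
  exact @Functor.isEquivalence_of_iso _ _ _ _ _ _ (toSecPushIso R).symm this

end PushDescent

section Groupoid

universe t
variable {D : Type u} [Category.{v} D] {F : Pseudofunctor (LocallyDiscrete Dᵒᵖ) Cat.{vX, uX}}
  {Q : Dᵒᵖ ⥤ Type t}

theorem Sec.isGroupoid (h : ∀ e : D, IsGroupoid (Fibre F e)) : IsGroupoid (Sec F Q) where
  all_isIso {s s'} f := by
    have := h
    have : f = (Sec.isoMk (fun e q => asIso (f.hom e q)) fun g q q' w => f.comm g q q' w).hom := rfl
    rw [this]; infer_instance

end Groupoid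

/-! ### Equivalences of fibred categories preserve descent -/

section FibredEquivalence

universe t
variable {D : Type u} [Category.{v} D] {X : Pseudofunctor (LocallyDiscrete Dᵒᵖ) Cat.{vX, uX}}
  {Y : Pseudofunctor (LocallyDiscrete Dᵒᵖ) Cat.{vY, uY}} (Φ : FibredFunctor X Y)

namespace FibredFunctor

/-- The isomorphism by which a morphism of fibred categories commutes with pull-backs. -/
def natIso {S S' : D} (g : S' ⟶ S) (x : Fibre X S) :
    (Φ.app S').obj ((pull X g).obj x) ≅ (pull Y g).obj ((Φ.app S).obj x) := (Φ.nat g).app x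

theorem natIso_naturality {S S' : D} (g : S' ⟶ S) {x y : Fibre X S} (a : x ⟶ y) :
    (Φ.app S').map ((pull X g).map a) ≫ (Φ.natIso g y).hom =
      (Φ.natIso g x).hom ≫ (pull Y g).map ((Φ.app S).map a) :=
  (Φ.nat g).hom.naturality a

theorem natIso_naturality_assoc {S S' : D} (g : S' ⟶ S) {x y : Fibre X S} (a : x ⟶ y)
    {z : Fibre Y S'} (b : (pull Y g).obj ((Φ.app S).obj y) ⟶ z) :
    (Φ.app S').map ((pull X g).map a) ≫ (Φ.natIso g y).hom ≫ b =
      (Φ.natIso g x).hom ≫ (pull Y g).map ((Φ.app S).map a) ≫ b :=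
  (reassoc_of% (Φ.natIso_naturality g a)) b

theorem natIso_id (S : D) (x : Fibre X S) : (Φ.natIso (𝟙 S) x).hom =
    (Φ.app S).map (pullId X S x).hom ≫ (pullId Y S ((Φ.app S).obj x)).inv := Φ.nat_id S x

theorem natIso_comp {S S' S'' : D} (f : S' ⟶ S) (g : S'' ⟶ S') (h : S'' ⟶ S) (w : g ≫ f = h)
    (x : Fibre X S) : (Φ.natIso h x).hom =
      (Φ.app S'').map (pullComp X f g h w x).hom ≫ (Φ.natIso g ((pull X f).obj x)).hom ≫
        (pull Y g).map (Φ.natIso f x).hom ≫ (pullComp Y f g h w ((Φ.app S).obj x)).inv := by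
  subst w
  rw [pullComp_hom_eq, pullComp_inv_eq]
  exact Φ.nat_comp f g x

/-- The functor on cartesian sections induced by a morphism of fibred categories. -/
def mapSec (Q : Dᵒᵖ ⥤ Type t) : Sec X Q ⥤ Sec Y Q where
  obj s :=
    { obj := fun e q => (Φ.app e).obj (s.obj e q)
      tr := fun g q q' w => (Φ.natIso g _).symm ≪≫ (Φ.app _).mapIso (s.tr g q q' w)
      tr_id := fun e q w => by
        refine (Iso.inv_comp_eq _).2 ?_
        rw [natIso_id, Category.assoc, Iso.inv_hom_id, Category.comp_id, Functor.mapIso_hom,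
          s.tr_id]
      tr_comp := fun g g' h w q q' q'' w₁ w₂ w₃ => by
        refine (Iso.inv_comp_eq _).2 ?_
        rw [Φ.natIso_comp g g' h w, Functor.mapIso_hom, s.tr_comp g g' h w q q' q'' w₁ w₂ w₃]
        simp only [Iso.trans_hom, Iso.symm_hom, Functor.mapIso_hom, Functor.map_comp,
          Category.assoc,
          Iso.inv_hom_id_assoc]
        rw [← Functor.map_comp_assoc (pull Y g') (Φ.natIso g _).hom, Iso.hom_inv_id,
          CategoryTheory.Functor.map_id, Category.id_comp, ← natIso_naturality_assoc,
          Iso.hom_inv_id_assoc] }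
  map f :=
    { hom := fun e q => (Φ.app e).map (f.hom e q)
      comm := fun g q q' w => by
        simp only [Iso.trans_hom, Iso.symm_hom, Functor.mapIso_hom, Category.assoc]
        rw [Iso.inv_comp_eq, ← natIso_naturality_assoc, Iso.hom_inv_id_assoc, ← Functor.map_comp,
          f.comm, Functor.map_comp] }
  map_id s := Sec.hom_ext fun e q => (Φ.app e).map_id _
  map_comp f f' := Sec.hom_ext fun e q => (Φ.app e).map_comp _ _

variable {Φ}

/-- An equivalence of fibred categories induces equivalences of the categories of sections. -/
theorem IsEquiv.mapSec (hΦ : Φ.IsEquiv) (Q : Dᵒᵖ ⥤ Type t) : (Φ.mapSec Q).IsEquivalence where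
  faithful.map_injective {s s'} f f' h := Sec.hom_ext fun e q => by
    have := hΦ e
    exact (Φ.app e).map_injective (congrArg
      (fun t : (Φ.mapSec Q).obj s ⟶ (Φ.mapSec Q).obj s' => t.hom e q) h)
  full.map_surjective {s s'} b := by
    have : ∀ e, (Φ.app e).IsEquivalence := hΦ
    choose f hf using fun (e : D) (q : Q.obj (op e)) =>
      (Φ.app e).map_surjective (X := s.obj e q) (Y := s'.obj e q) (b.hom e q)
    refine ⟨⟨f, fun {e e'} g q q' w => (Φ.app e').map_injective ?_⟩, Sec.hom_ext hf⟩
    have h : ((Φ.natIso g (s.obj e q)).inv ≫ (Φ.app e').map (s.tr g q q' w).hom) ≫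
        (Φ.app e').map (f e' q') = (pull Y g).map ((Φ.app e).map (f e q)) ≫
          (Φ.natIso g (s'.obj e q)).inv ≫ (Φ.app e').map (s'.tr g q q' w).hom := by
      rw [hf, hf]; exact b.comm g q q' w
    rw [Category.assoc, Iso.inv_comp_eq,
      ← natIso_naturality_assoc, Iso.hom_inv_id_assoc] at h
    rw [Functor.map_comp, Functor.map_comp]
    exact h
  essSurj.mem_essImage s := by
    have : ∀ e, (Φ.app e).IsEquivalence := hΦ
    obtain ⟨x, i, -⟩ : ∃ (x : ∀ (e : D) (_ : Q.obj (op e)), Fibre X e)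
        (_ : ∀ (e : D) (q : Q.obj (op e)), (Φ.app e).obj (x e q) ≅ s.obj e q), True :=
      ⟨_, fun e q => (Φ.app e).objObjPreimageIso (s.obj e q), trivial⟩
    -- the transition isomorphisms of `s` are lifted along the equivalences of the fibres
    have H : ∀ (e e' : D) (g : e' ⟶ e) (q : Q.obj (op e)) (q' : Q.obj (op e'))
        (w : Q.map g.op q = q'), ∃ t : (pull X g).obj (x e q) ≅ x e' q', (Φ.app e').map t.hom =
          (Φ.natIso g _).hom ≫ (pull Y g).map (i e q).hom ≫ (s.tr g q q' w).hom ≫ (i e' q').inv :=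
      fun e e' g q q' w => ⟨(Φ.app e').preimageIso (Φ.natIso g _ ≪≫ (pull Y g).mapIso (i e q) ≪≫
        s.tr g q q' w ≪≫ (i e' q').symm), (Φ.app e').map_preimage _⟩
    choose t ht using H
    refine ⟨⟨x, t _ _, fun e q w => (Φ.app e).map_injective ?_,
      fun {e e' e''} g g' h w q q' q'' w₁ w₂ w₃ => (Φ.app e'').map_injective ?_⟩,
      ⟨Sec.isoMk i fun {e e'} g q q' w => ?_⟩⟩
    · rw [ht, natIso_id, s.tr_id, pullId_hom_naturality_assoc]
      simp
    · rw [ht, Functor.map_comp, Functor.map_comp, ht, s.tr_comp g g' h w q q' q'' w₁ w₂ w₃,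
        Φ.natIso_comp g g' h w]
      have H : (Φ.app e'').map ((pull X g').map (t _ _ g q q' w₁).hom) =
          (Φ.natIso g' _).hom ≫ (pull Y g').map ((Φ.app e').map (t _ _ g q q' w₁).hom) ≫
            (Φ.natIso g' _).inv := by
        rw [← natIso_naturality_assoc, Iso.hom_inv_id, Category.comp_id]
      rw [H, ht]
      simp only [Category.assoc, Functor.map_comp, Iso.inv_hom_id_assoc]
      rw [← Functor.map_comp_assoc (pull Y g') (i e' q').inv, Iso.inv_hom_id,
        CategoryTheory.Functor.map_id, Category.id_comp, pullComp_hom_naturality_assoc,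
          Iso.inv_hom_id_assoc]
    · change ((Φ.natIso g (x e q)).inv ≫ (Φ.app e').map (t _ _ g q q' w).hom) ≫ (i e' q').hom =
        (pull Y g).map (i e q).hom ≫ (s.tr g q q' w).hom
      rw [ht]
      simp

variable (Φ) in
/-- The restriction to a sieve commutes with morphisms of fibred categories. -/
def toSecMapSecIso {S : D} (R : Sieve S) :
    toSec (F := X) R ⋙ Φ.mapSec R.functor ≅ Φ.app S ⋙ toSec (F := Y) R :=
  NatIso.ofComponents (fun x => Sec.isoMk (fun _ f => Φ.natIso (arrow f) x)
    fun {e e'} g f f' w => by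
      change ((Φ.natIso g _).inv ≫ (Φ.app e').map (pullComp X (arrow f) g (arrow f')
        (arrow_map w) x).inv) ≫ _ =
        (pull Y g).map _ ≫ (pullComp Y (arrow f) g (arrow f') (arrow_map w) _).inv
      rw [Φ.natIso_comp (arrow f) g (arrow f') (arrow_map w)]
      simp [← Functor.map_comp_assoc])
    (fun a => Sec.hom_ext fun _ f => Φ.natIso_naturality (arrow f) a)

/-- Descent for a sieve is invariant under equivalences of fibred categories. -/
theorem IsEquiv.isStackFor (hΦ : Φ.IsEquiv) {S : D} (R : Sieve S) (h : X.IsStackFor R.arrows) :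
    Y.IsStackFor R.arrows := by
  rw [isStackFor_iff] at h ⊢
  have := hΦ S
  have := hΦ.mapSec R.functor
  have := Functor.isEquivalence_of_iso (Φ.toSecMapSecIso R)
  exact Functor.isEquivalence_of_comp_left (Φ.app S) _

end FibredFunctor

end FibredEquivalence

/-! ### Twisting by a cocycle of tensor functors -/

section Cocycle

namespace TensorFunctor

variable (A : Type u₁) [Category.{v₁} A] [MonoidalCategory A] [SymmetricCategory A]

/-- The identity tensor functor. -/
def id : TensorFunctor.{w} A A where
  toFunctor := 𝟭 A
  braided := inferInstance
  preservesColimits := inferInstance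

variable {A}

/-- A morphism `m : H ⟶ id` of tensor functors induces an isomorphism `F ∘ H ≅ F`, with components
`F(m_a)`, natural in the tensor functor `F`. -/
def precompId {H : TensorFunctor.{w} A A} (m : H ⟶ id A) (D : Type uX) [Category.{vX} D]
    [MonoidalCategory D] [SymmetricCategory D] : precomp D H ≅ 𝟭 (TensorFunctor.{w} A D) :=
  NatIso.ofComponents (fun F => isoMk
    { iso := Functor.isoWhiskerRight m.iso F.toFunctor ≪≫ F.toFunctor.leftUnitor
      isMonoidal :=
        have : NatTrans.IsMonoidal (F₁ := H.toFunctor) (F₂ := 𝟭 A) m.iso.hom := m.isMonoidal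
        have := NatTrans.IsMonoidal.whiskerRight (F₁ := H.toFunctor)
          (F₂ := 𝟭 A) m.iso.hom (G₁ := F.toFunctor)
        @NatTrans.IsMonoidal.comp _ _ _ _ _ _ _ _ _
          (Functor.whiskerRight (G := H.toFunctor) (H := 𝟭 A) m.iso.hom
            F.toFunctor) _ _ _ F.toFunctor.leftUnitor.hom this inferInstance })
    (fun {_ _} t => hom_ext fun a =>
      (congrArg (_ ≫ ·) (Category.comp_id _)).trans
        ((t.iso.hom.naturality (m.iso.hom.app a)).symm.trans
          (congrArg (· ≫ _) (Category.comp_id _).symm)))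

theorem precompId_hom_app {H : TensorFunctor.{w} A A} (m : H ⟶ id A) (D : Type uX) [Category.{vX} D]
    [MonoidalCategory D] [SymmetricCategory D] (F : TensorFunctor.{w} A D) (a : A) :
    ((precompId m D).hom.app F).iso.hom.app a = F.toFunctor.map (m.iso.hom.app a) :=
  Category.comp_id _

end TensorFunctor

/-- A cocycle of tensor endofunctors `H i j` of `A`, with multiplications
`H i j ∘ H j k ≅ H i k` and units `H i i ≅ id` subject to the associativity and unit laws. All
morphisms of tensor functors are isomorphisms. -/
structure TensorCocycle (A : Type u₁) [Category.{v₁} A] [MonoidalCategory A] [SymmetricCategory A]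
    (ι : Type wι) where
  H : ι → ι → TensorFunctor.{w} A A
  m : ∀ i j k, (H j k).comp (H i j) ⟶ H i k
  u : ∀ i, H i i ⟶ TensorFunctor.id A
  assoc : ∀ (i j k l) (a : A), (H i j).toFunctor.map ((m j k l).iso.hom.app a) ≫
    (m i j l).iso.hom.app a = (m i j k).iso.hom.app ((H k l).toFunctor.obj a) ≫
      (m i k l).iso.hom.app a
  unit_left : ∀ (i j) (a : A), (m i i j).iso.hom.app a = (u i).iso.hom.app ((H i j).toFunctor.obj a)
  unit_right : ∀ (i j) (a : A), (m i j j).iso.hom.app a =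
    (H i j).toFunctor.map ((u j).iso.hom.app a)

variable {A : Type u₁} [Category.{v₁} A] [MonoidalCategory A] [SymmetricCategory A] {ι : Type wι}

namespace TensorCocycle

variable (c : TensorCocycle.{w} A ι)

/-- The value of the functor `H i j` of a cocycle. -/
abbrev tw (i j : ι) (a : A) : A := (c.H i j).toFunctor.obj a

/-- The multiplication of a cocycle. -/
def mul (i j k : ι) (a : A) : c.tw i j (c.tw j k a) ≅ c.tw i k a := (c.m i j k).iso.app a

/-- The unit of a cocycle. -/
def one (i : ι) (a : A) : c.tw i i a ≅ a := (c.u i).iso.app a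

theorem mul_assoc (i j k l : ι) (a : A) :
    (c.H i j).toFunctor.map (c.mul j k l a).hom ≫ (c.mul i j l a).hom =
      (c.mul i j k (c.tw k l a)).hom ≫ (c.mul i k l a).hom := c.assoc i j k l a

theorem mul_left (i j : ι) (a : A) : (c.mul i i j a).hom = (c.one i (c.tw i j a)).hom :=
  c.unit_left i j a

theorem mul_right (i j : ι) (a : A) :
    (c.mul i j j a).hom = (c.H i j).toFunctor.map (c.one j a).hom :=
  c.unit_right i j a

theorem mul_assoc_inv (i j k l : ι) (a : A) :
    (c.mul i j l a).inv ≫ (c.H i j).toFunctor.map (c.mul j k l a).inv =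
      (c.mul i k l a).inv ≫ (c.mul i j k (c.tw k l a)).inv :=
  (Iso.inv_eq_inv ((c.H i j).toFunctor.mapIso (c.mul j k l a) ≪≫ c.mul i j l a)
    (c.mul i j k (c.tw k l a) ≪≫ c.mul i k l a)).2 (c.mul_assoc i j k l a)

theorem mul_inv_left (i j : ι) (a : A) : (c.mul i i j a).inv = (c.one i (c.tw i j a)).inv :=
  (Iso.inv_eq_inv _ _).2 (c.mul_left i j a)

theorem mul_inv_right (i j : ι) (a : A) :
    (c.mul i j j a).inv = (c.H i j).toFunctor.map (c.one j a).inv :=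
  (Iso.inv_eq_inv (c.mul i j j a) ((c.H i j).toFunctor.mapIso (c.one j a))).2 (c.mul_right i j a)

/-- Composition with `H i j` is an equivalence: composition with `H j i` is a quasi-inverse. -/
theorem precomp_isEquivalence (i j : ι) (A' : Type u₂) [Category.{v₂} A'] [MonoidalCategory A']
    [SymmetricCategory A'] : (TensorFunctor.precomp A' (c.H i j)).IsEquivalence :=
  (CategoryTheory.Equivalence.mk (TensorFunctor.precomp A' (c.H i j))
    (TensorFunctor.precomp A' (c.H j i))
    ((TensorFunctor.precompId (c.u i) A').symm ≪≫ (TensorFunctor.precompComp (c.m i j i) A').symm)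
    (TensorFunctor.precompComp (c.m j i j) A' ≪≫
      TensorFunctor.precompId (c.u j) A')).isEquivalence_functor

end TensorCocycle

end Cocycle

/-! ### The twisted fibred category -/

section Twist

variable {D : Type u} [Category.{v} D]

/-- The coherence isomorphism `h^* ≅ g^* f^*`, as an isomorphism of functors. -/
def pullCompIso (F : Pseudofunctor (LocallyDiscrete Dᵒᵖ) Cat.{vX, uX}) {S S' S'' : D} (f : S' ⟶ S)
    (g : S'' ⟶ S') (h : S'' ⟶ S) (w : g ≫ f = h) : pull F h ≅ pull F f ⋙ pull F g :=
  NatIso.ofComponents (pullComp F f g h w) (pullComp_hom_naturality f g h w)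

/-- The cocycle condition for the coherence isomorphisms preceded by morphisms `p` and `p'` of
the fibre. With the inverse multiplications of a cocycle as `p`, `q`, `p'` and `q'` it is the
associativity law of the twisted fibred category. -/
theorem map_pullComp_assoc {F : Pseudofunctor (LocallyDiscrete Dᵒᵖ) Cat.{vX, uX}}
    {S₀ S₁ S₂ S₃ : D} (f : S₁ ⟶ S₀) (g : S₂ ⟶ S₁) (k : S₃ ⟶ S₂)
    (gf : S₂ ⟶ S₀) (kg : S₃ ⟶ S₁) (h : S₃ ⟶ S₀) (w₁ : g ≫ f = gf) (w₂ : k ≫ g = kg)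
    (w₃ : kg ≫ f = h) (w₄ : k ≫ gf = h) {x y y' z : Fibre F S₀} (p : x ⟶ y) (q : y ⟶ z)
    (p' : x ⟶ y') (q' : y' ⟶ z) (H : p ≫ q = p' ≫ q') :
    ((pull F h).map p ≫ (pullComp F f kg h w₃ y).hom) ≫ (pull F kg).map ((pull F f).map q) ≫
        (pullComp F g k kg w₂ ((pull F f).obj z)).hom =
      ((pull F h).map p' ≫ (pullComp F gf k h w₄ y').hom) ≫
        (pull F k).map ((pull F gf).map q' ≫ (pullComp F f g gf w₁ z).hom) := by
  rw [Category.assoc, Category.assoc, ← pullComp_hom_naturality_assoc, Functor.map_comp,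
    ← pullComp_hom_naturality_assoc, pullComp_assoc f g k gf kg h w₁ w₂ w₃ w₄,
    ← Functor.map_comp_assoc, ← Functor.map_comp_assoc, H]

theorem map_pullComp_comp_id {F : Pseudofunctor (LocallyDiscrete Dᵒᵖ) Cat.{vX, uX}}
    {S S' : D} (f : S' ⟶ S) (w : 𝟙 S' ≫ f = f) {x y z : Fibre F S} (p : x ⟶ y) (q : y ⟶ z) :
    ((pull F f).map p ≫ (pullComp F f (𝟙 S') f w y).hom) ≫ (pullId F S' ((pull F f).obj y)).hom ≫
      (pull F f).map q = (pull F f).map (p ≫ q) := by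
  rw [pullComp_comp_id, Category.assoc, Iso.inv_hom_id_assoc, Functor.map_comp]

theorem map_pullComp_id_comp {F : Pseudofunctor (LocallyDiscrete Dᵒᵖ) Cat.{vX, uX}}
    {S S' : D} (f : S' ⟶ S) (w : f ≫ 𝟙 S = f) {x y z : Fibre F S} (p : x ⟶ y) (q : y ⟶ z) :
    ((pull F f).map p ≫ (pullComp F (𝟙 S) f f w y).hom) ≫ (pull F f).map ((pullId F S y).hom ≫ q) =
      (pull F f).map (p ≫ q) := by
  rw [pullComp_id_comp, Category.assoc, ← Functor.map_comp, Iso.inv_hom_id_assoc, Functor.map_comp]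

variable (B : AbTensorFibration.{w, vB, uB} D)
  {A : Type u₁} [Category.{v₁} A] [MonoidalCategory A] [SymmetricCategory A] {ι : Type wι}
  (c : TensorCocycle.{w} A ι) (idx : D → ι)

/-- The pull-back functor of the twisted fibred category: `F ↦ f^* ∘ F ∘ H i i'`. -/
def twistMap {S S' : D} (f : S' ⟶ S) :
    TensorFunctor.{w} A (Fibre B.fib S) ⥤ TensorFunctor.{w} A (Fibre B.fib S') :=
  TensorFunctor.precomp _ (c.H (idx S) (idx S')) ⋙ TensorFunctor.postcomp A (B.pullback f.op.toLoc)

/-- The unit isomorphisms of the twisted fibred category. -/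
def twistId (S : D) : twistMap B c idx (𝟙 S) ≅ 𝟭 (TensorFunctor.{w} A (Fibre B.fib S)) :=
  Functor.isoWhiskerLeft (TensorFunctor.precomp _ (c.H (idx S) (idx S)))
    (B.homMapId A (.mk (op S))) ≪≫ TensorFunctor.precompId (c.u (idx S)) _

theorem twistId_hom_app (S : D) (F : TensorFunctor.{w} A (Fibre B.fib S)) (a : A) :
    ((twistId B c idx S).hom.app F).iso.hom.app a =
      (pullId B.fib S _).hom ≫ F.toFunctor.map (c.one (idx S) a).hom :=
  congrArg₂ (· ≫ ·) (B.homMapId_app A ((c.H (idx S) (idx S)).comp F) a)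
    (TensorFunctor.precompId_hom_app (c.u (idx S)) _ F a)

/-- The composition isomorphisms of the twisted fibred category: the inverse multiplication
`H i i'' ≅ H i i' ∘ H i' i''` followed by `h^* ≅ g^* f^*`. -/
def twistComp {S S' S'' : D} (f : S' ⟶ S) (g : S'' ⟶ S') (h : S'' ⟶ S) (w : g ≫ f = h) :
    twistMap B c idx h ≅ twistMap B c idx f ⋙ twistMap B c idx g :=
  Functor.isoWhiskerRight (TensorFunctor.precompComp (c.m (idx S) (idx S') (idx S'')) _).symm
      (TensorFunctor.postcomp A (B.pullback h.op.toLoc)) ≪≫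
    Functor.isoWhiskerLeft (TensorFunctor.precomp _ (c.H (idx S) (idx S')) ⋙
      TensorFunctor.precomp _ (c.H (idx S') (idx S''))) (pullCompIso (B.homFib A) f g h w) ≪≫
    Functor.isoWhiskerLeft (TensorFunctor.precomp _ (c.H (idx S) (idx S')))
      (Functor.isoWhiskerRight (TensorFunctor.precompPostcomp (c.H (idx S') (idx S''))
        (B.pullback f.op.toLoc)).symm (TensorFunctor.postcomp A (B.pullback g.op.toLoc)))

theorem twistComp_hom_app {S S' S'' : D} (f : S' ⟶ S) (g : S'' ⟶ S') (h : S'' ⟶ S) (w : g ≫ f = h)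
    (F : TensorFunctor.{w} A (Fibre B.fib S)) (a : A) :
    ((twistComp B c idx f g h w).hom.app F).iso.hom.app a =
      (pull B.fib h).map (F.toFunctor.map (c.mul (idx S) (idx S') (idx S'') a).inv) ≫
        (pullComp B.fib f g h w _).hom := by
  refine congrArg₂ (· ≫ ·) (congrArg (pull B.fib h).map (Category.comp_id _))
    ((congrArg₂ (· ≫ ·) (homFib_pullComp_hom_app B f g h w ((c.H (idx S') (idx S'')).comp
      ((c.H (idx S) (idx S')).comp F)) a) ((pull B.fib g).map_id _)).trans (Category.comp_id _))

/-- The fibred category of tensor functors, twisted by a cocycle: the pull-back of `F` along a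
morphism `f : S' ⟶ S` is `f^* ∘ F ∘ H i i'`, where `i` and `i'` are the indices of `S` and `S'`. -/
def twistData : FibData.{v, u, max u₁ vB, max u₁ v₁ vB uB} D where
  obj S := TensorFunctor.{w} A (Fibre B.fib S)
  cat _ := inferInstance
  map f := twistMap B c idx f
  mapId S := twistId B c idx S
  mapComp f g h w := twistComp B c idx f g h w
  assoc {S₀ S₁ S₂ S₃} f g k gf kg h w₁ w₂ w₃ w₄ F := TensorFunctor.hom_ext fun a => by
    refine (congrArg₂ (· ≫ ·) (twistComp_hom_app B c idx f kg h w₃ F a)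
      (twistComp_hom_app B c idx g k kg w₂ ((twistMap B c idx f).obj F) a)).trans
      (Eq.trans ?_ (congrArg₂ (· ≫ ·) (twistComp_hom_app B c idx gf k h w₄ F a)
        (congrArg (pull B.fib k).map (twistComp_hom_app B c idx f g gf w₁ F _))).symm)
    refine map_pullComp_assoc f g k gf kg h w₁ w₂ w₃ w₄ _ (F.toFunctor.map
      ((c.H (idx S₀) (idx S₁)).toFunctor.map (c.mul (idx S₁) (idx S₂) (idx S₃) a).inv)) _ _ ?_
    rw [← Functor.map_comp, ← Functor.map_comp, c.mul_assoc_inv]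
  comp_id {S S'} f w F := TensorFunctor.hom_ext fun a => by
    refine (congrArg₂ (· ≫ ·) (twistComp_hom_app B c idx f (𝟙 S') f w F a)
      (twistId_hom_app B c idx S' ((twistMap B c idx f).obj F) a)).trans ?_
    refine (map_pullComp_comp_id f w _ (F.toFunctor.map
      ((c.H (idx S) (idx S')).toFunctor.map (c.one (idx S') a).hom))).trans ?_
    rw [c.mul_inv_right, ← Functor.map_comp, ← Functor.map_comp, Iso.inv_hom_id]
    exact (((c.H (idx S) (idx S')).comp (F.comp (B.pullback f.op.toLoc))).toFunctor).map_id a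
  id_comp {S S'} f w F := TensorFunctor.hom_ext fun a => by
    refine (congrArg₂ (· ≫ ·) (twistComp_hom_app B c idx (𝟙 S) f f w F a)
      (congrArg (pull B.fib f).map (twistId_hom_app B c idx S F _))).trans ?_
    refine (map_pullComp_id_comp f w _ _).trans ?_
    rw [c.mul_inv_left, ← Functor.map_comp, Iso.inv_hom_id]
    exact (F.comp (B.pullback f.op.toLoc)).toFunctor.map_id _

end Twist

section OfPull

variable {D : Type u} [Category.{v} D] {X : Pseudofunctor (LocallyDiscrete Dᵒᵖ) Cat.{vX, uX}}
  {Y : Pseudofunctor (LocallyDiscrete Dᵒᵖ) Cat.{vY, uY}}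

/-- A constructor for morphisms of fibred categories, with the compatibilities stated in terms of
`pullId` and `pullComp`. -/
def FibredFunctor.ofPull (app : ∀ S : D, Fibre X S ⥤ Fibre Y S)
    (nat : ∀ {S S' : D} (g : S' ⟶ S), pull X g ⋙ app S' ≅ app S ⋙ pull Y g)
    (nat_id : ∀ (S : D) (x : Fibre X S), (nat (𝟙 S)).hom.app x =
      (app S).map (pullId X S x).hom ≫ (pullId Y S ((app S).obj x)).inv)
    (nat_comp : ∀ {S S' S'' : D} (f : S' ⟶ S) (g : S'' ⟶ S') (h : S'' ⟶ S) (w : g ≫ f = h)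
      (x : Fibre X S), (nat h).hom.app x =
        (app S'').map (pullComp X f g h w x).hom ≫ (nat g).hom.app ((pull X f).obj x) ≫
          (pull Y g).map ((nat f).hom.app x) ≫ (pullComp Y f g h w ((app S).obj x)).inv) :
    FibredFunctor X Y where
  app := app
  nat := nat
  nat_id := nat_id
  nat_comp f g x := by
    have := nat_comp f g (g ≫ f) rfl x
    rw [pullComp_hom_eq, pullComp_inv_eq] at this
    exact this

end OfPull

section Twist

variable {D : Type u} [Category.{v} D] (B : AbTensorFibration.{w, vB, uB} D)
  {A : Type u₁} [Category.{v₁} A] [MonoidalCategory A] [SymmetricCategory A] {ι : Type wι}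
  (c : TensorCocycle.{w} A ι) (idx : D → ι)

/-- The fibred category of tensor functors twisted by a cocycle, see `twistData`. -/
def twist : Pseudofunctor (LocallyDiscrete Dᵒᵖ) Cat.{max u₁ vB, max u₁ v₁ vB uB} :=
  (twistData B c idx).toPseudofunctor

theorem twist_pullComp_hom_app {S S' S'' : D} (f : S' ⟶ S) (g : S'' ⟶ S') (h : S'' ⟶ S)
    (w : g ≫ f = h) (F : TensorFunctor.{w} A (Fibre B.fib S)) (a : A) :
    (pullComp (twist B c idx) f g h w F).hom.iso.hom.app a =
      (pull B.fib h).map (F.toFunctor.map (c.mul (idx S) (idx S') (idx S'') a).inv) ≫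
        (pullComp B.fib f g h w _).hom :=
  (congrArg (fun t => TensorFunctor.Hom.iso t |>.hom.app a)
    ((twistData B c idx).toPseudofunctor_pullComp_hom f g h w F)).trans
      (twistComp_hom_app B c idx f g h w F a)

theorem twist_pullComp_inv_app {S S' S'' : D} (f : S' ⟶ S) (g : S'' ⟶ S') (h : S'' ⟶ S)
    (w : g ≫ f = h) (F : TensorFunctor.{w} A (Fibre B.fib S)) (a : A) :
    (pullComp (twist B c idx) f g h w F).inv.iso.hom.app a =
      (pullComp B.fib f g h w _).inv ≫
        (pull B.fib h).map (F.toFunctor.map (c.mul (idx S) (idx S') (idx S'') a).hom) := by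
  refine (TensorFunctor.iso_inv_app (pullComp (twist B c idx) f g h w F) a).trans ?_
  exact (Iso.inv_eq_inv ((pullComp (twist B c idx) f g h w F).hom.iso.app a)
    ((pull B.fib h).mapIso (F.toFunctor.mapIso (c.mul (idx S) (idx S') (idx S'') a).symm) ≪≫
      pullComp B.fib f g h w _)).2 (twist_pullComp_hom_app B c idx f g h w F a)

theorem twist_pullId_hom_app (S : D) (F : TensorFunctor.{w} A (Fibre B.fib S)) (a : A) :
    (pullId (twist B c idx) S F).hom.iso.hom.app a =
      (pullId B.fib S _).hom ≫ F.toFunctor.map (c.one (idx S) a).hom :=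
  twistId_hom_app B c idx S F a

theorem twist_pullId_inv_app (S : D) (F : TensorFunctor.{w} A (Fibre B.fib S)) (a : A) :
    (pullId (twist B c idx) S F).inv.iso.hom.app a =
      F.toFunctor.map (c.one (idx S) a).inv ≫ (pullId B.fib S _).inv := by
  refine (TensorFunctor.iso_inv_app (pullId (twist B c idx) S F) a).trans ?_
  exact (Iso.inv_eq_inv ((pullId (twist B c idx) S F).hom.iso.app a)
    (pullId B.fib S _ ≪≫ F.toFunctor.mapIso (c.one (idx S) a))).2
      (twist_pullId_hom_app B c idx S F a)

/-- The isomorphism by which composition with the functors of a cocycle commutes with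
pull-backs. -/
def frameNat (i₀ : ι) {S S' : D} (g : S' ⟶ S) :
    pull (B.homFib A) g ⋙ TensorFunctor.precomp _ (c.H i₀ (idx S')) ≅
      TensorFunctor.precomp _ (c.H i₀ (idx S)) ⋙ twistMap B c idx g :=
  TensorFunctor.precompPostcomp (c.H i₀ (idx S')) (B.pullback g.op.toLoc) ≪≫
    Functor.isoWhiskerRight (TensorFunctor.precompComp (c.m i₀ (idx S) (idx S')) _).symm
      (TensorFunctor.postcomp A (B.pullback g.op.toLoc))

theorem frameNat_hom_app (i₀ : ι) {S S' : D} (g : S' ⟶ S) (F : TensorFunctor.{w} A (Fibre B.fib S))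
    (a : A) : ((frameNat B c idx i₀ g).hom.app F).iso.hom.app a =
      (pull B.fib g).map (F.toFunctor.map (c.mul i₀ (idx S) (idx S') a).inv) :=
  (Category.id_comp _).trans (congrArg (pull B.fib g).map (Category.comp_id _))

/-- The compatibility with composition in a fibred category of morphisms `s = p ≫ q ≫ r`. For `s` an
inverse multiplication of a cocycle it is the compatibility of `frame` with composition. -/
theorem frame_comp {F : Pseudofunctor (LocallyDiscrete Dᵒᵖ) Cat.{vX, uX}} {S S' S'' : D}
    (f : S' ⟶ S) (g : S'' ⟶ S') (h : S'' ⟶ S) (w : g ≫ f = h) {x y z t : Fibre F S} (p : x ⟶ y)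
    (q : y ⟶ z) (r : z ⟶ t) (s : x ⟶ t) (H : s = p ≫ q ≫ r) :
    (pull F h).map s = (pullComp F f g h w x).hom ≫ (pull F g).map ((pull F f).map p) ≫
      (pull F g).map ((pull F f).map q) ≫ (pullComp F f g h w z).inv ≫ (pull F h).map r := by
  rw [← Functor.map_comp_assoc, ← Functor.map_comp, pullComp_inv_naturality_assoc,
    Iso.hom_inv_id_assoc, ← Functor.map_comp, H, Category.assoc]

/-- The functors `F ↦ F ∘ H i₀ i`, as a morphism from the fibred category of tensor functors to the
twisted one. -/
def frame (i₀ : ι) : FibredFunctor (B.homFib A) (twist B c idx) :=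
  .ofPull (fun S => TensorFunctor.precomp _ (c.H i₀ (idx S))) (frameNat B c idx i₀)
    (fun S F => TensorFunctor.hom_ext fun a => by
      refine (frameNat_hom_app B c idx i₀ (𝟙 S) F a).trans (Eq.trans ?_ (congrArg₂ (· ≫ ·)
        (homFib_pullId_hom_app B S F _)
        (twist_pullId_inv_app B c idx S ((c.H i₀ (idx S)).comp F) a)).symm)
      rw [c.mul_inv_right]
      refine (Iso.eq_comp_inv (pullId B.fib S (F.toFunctor.obj _))).2
        (pullId_hom_naturality S _) |>.trans (Category.assoc _ _ _))
    (fun {S S' S''} f g h w F => TensorFunctor.hom_ext fun a => by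
      refine (frameNat_hom_app B c idx i₀ h F a).trans (Eq.trans ?_ (congrArg₂ (· ≫ ·)
        (homFib_pullComp_hom_app B f g h w F _) (congrArg₂ (· ≫ ·)
          (frameNat_hom_app B c idx i₀ g ((pull (B.homFib A) f).obj F) a) (congrArg₂ (· ≫ ·)
            (congrArg (pull B.fib g).map (frameNat_hom_app B c idx i₀ f F _))
            (twist_pullComp_inv_app B c idx f g h w ((c.H i₀ (idx S)).comp F) a)))).symm)
      refine frame_comp f g h w _ _ _ _ ?_
      refine Eq.trans (congrArg F.toFunctor.map ?_) ((F.toFunctor.map_comp _ _).trans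
        (congrArg (_ ≫ ·) (F.toFunctor.map_comp _ _)))
      rw [← Category.assoc, ← c.mul_assoc_inv, Category.assoc]
      refine ((congrArg (_ ≫ ·) (((c.H i₀ (idx S)).toFunctor.map_comp _ _).symm.trans
        ((congrArg (c.H i₀ (idx S)).toFunctor.map (Iso.inv_hom_id _)).trans
          (CategoryTheory.Functor.map_id _ _)))).trans (Category.comp_id _)).symm)

theorem frame_isEquiv (i₀ : ι) : (frame B c idx i₀).IsEquiv :=
  fun _ => c.precomp_isEquivalence _ _ _

variable {B} in
/-- Twisted tensor functors satisfy descent. The index of the base object serves to untwist, but any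
index would do. -/
theorem twist_isStackFor {S : D} {R : Sieve S} (h : B.fib.IsStackFor R.arrows) :
    (twist B c idx).IsStackFor R.arrows :=
  (frame_isEquiv B c idx (idx S)).isStackFor R (homFib_isStackFor A h)

end Twist

/-! ### Sections over representable presheaves -/

section Yoneda

variable {D : Type u} [Category.{v} D] (F : Pseudofunctor (LocallyDiscrete Dᵒᵖ) Cat.{vX, uX})

/-- The section over a representable presheaf defined by an object of the fibre. -/
def ofFibre (e : D) : Fibre F e ⥤ Sec F (yoneda.obj e) where
  obj x :=
    { obj := fun _ f => (pull F f).obj x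
      tr := fun g f f' w => (pullComp F f g f' w x).symm
      tr_id := fun _ f w => pullComp_comp_id_inv f w x
      tr_comp := fun g g' h w f f' f'' w₁ w₂ w₃ =>
        pullComp_assoc_inv f g g' f' h f'' w₁ w w₃ w₂ x }
  map a :=
    { hom := fun _ f => (pull F f).map a
      comm := fun g f f' w => (pullComp_inv_naturality f g f' w a).symm }
  map_id _ := Sec.hom_ext fun _ f => (pull F f).map_id _
  map_comp _ _ := Sec.hom_ext fun _ f => (pull F f).map_comp _ _

/-- The Yoneda lemma for fibred categories: a section over a representable presheaf is determined by
its value at the identity. -/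
theorem eval_yoneda_isEquivalence (e : D) : (Sec.eval F (yoneda.obj e) e (𝟙 e)).IsEquivalence :=
  (CategoryTheory.Equivalence.mk (Sec.eval F (yoneda.obj e) e (𝟙 e)) (ofFibre F e)
    (NatIso.ofComponents (fun s => Sec.isoMk
      (fun e' g => (s.tr g (𝟙 e) g (Category.comp_id g)).symm) fun {e' e''} g f f' w => by
        change _ = (pull F g).map _ ≫ (pullComp F f g f' w _).inv
        have h := s.tr_comp_inv f g f' w (𝟙 e) f f' (Category.comp_id f) w (Category.comp_id f')
        exact ((congrArg (_ ≫ ·) h).trans (Iso.hom_inv_id_assoc _ _)))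
      fun f => Sec.hom_ext fun e' g => by
        exact (Iso.comp_inv_eq _).2 ((Category.assoc _ _ _).trans
          ((Iso.inv_comp_eq _).2 (f.comm g (𝟙 e) g (Category.comp_id g)).symm)).symm)
    (NatIso.ofComponents (pullId F e) (pullId_hom_naturality e))).isEquivalence_functor

end Yoneda

/-! ### Objects with a morphism to a member of the covering -/

section Chart

variable {C : Type u} [Category.{v} C] {ι : Type wι} (T : ι → C)

/-- An object of `C` together with a morphism to a member of the family `T`. -/
structure Chart where
  pt : C
  idx : ι
  map : pt ⟶ T idx

namespace Chart

/-- The morphisms are all the morphisms of `C`: the morphisms to the members of `T` need not be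
respected, nor need the indices agree. -/
instance : Category.{v} (Chart T) where
  Hom e' e := e'.pt ⟶ e.pt
  id e := 𝟙 e.pt
  comp {e₁ e₂ e₃} f g := CategoryStruct.comp (X := e₁.pt) (Y := e₂.pt) (Z := e₃.pt) f g
  id_comp {e₁ e₂} f := Category.id_comp (X := e₁.pt) (Y := e₂.pt) f
  comp_id {e₁ e₂} f := Category.comp_id (X := e₁.pt) (Y := e₂.pt) f
  assoc {e₁ e₂ e₃ e₄} f g h :=
    Category.assoc (W := e₁.pt) (X := e₂.pt) (Y := e₃.pt) (Z := e₄.pt) f g h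

/-- The functor forgetting the morphism to a member of `T`. -/
def forget : Chart T ⥤ C where
  obj e := e.pt
  map f := f

variable {T}

/-- An object over the base of a chart is the base of a chart, by composition. -/
theorem isLocalEquiv_forget : IsLocalEquiv (forget T) where
  faithful := ⟨fun h => h⟩
  lift_obj {d Y} q := ⟨⟨Y, d.idx, CategoryStruct.comp (Y := d.pt) q d.map⟩, q, Iso.refl _,
    Category.id_comp _⟩
  lift_map _ _ h w := ⟨h, rfl, w⟩

/-- The charts in a covering sieve of `S` cover every chart over `S`. -/
theorem functorPushforward_functorPullback_mem (J : GrothendieckTopology C) {S : C} {R : Sieve S}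
    (hR : R ∈ J S) (e : Chart T) (q : (forget T).obj e ⟶ S) :
    ((R.pullback q).functorPullback (forget T)).functorPushforward (forget T) ∈
      J ((forget T).obj e) := by
  refine J.superset_covering ?_ (J.pullback_stable q hR)
  intro Y f hf
  exact ⟨⟨Y, e.idx, CategoryStruct.comp (Y := e.pt) f e.map⟩, f, 𝟙 Y, hf, (Category.id_comp _).symm⟩

end Chart

end Chart

/-! ### The glued stack -/

section Glued

variable {C : Type u} [Category.{v} C] (B : AbTensorFibration.{w, vB, uB} C)
  {A : Type u₁} [Category.{v₁} A] [MonoidalCategory A] [SymmetricCategory A] {ι : Type wι}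
  (c : TensorCocycle.{w} A ι) (T : ι → C)

/-- The fibred category of tensor functors to the fibres of `B` over the charts, twisted by a
cocycle. -/
abbrev chartTwist : Pseudofunctor (LocallyDiscrete (Chart T)ᵒᵖ) Cat.{max u₁ vB, max u₁ v₁ vB uB} :=
  twist (B.restrict (Chart.forget T)) c Chart.idx

/-- The fibred category over `C` glued from the fibred categories of tensor functors by means of
a cocycle. An object over `S` is a family of tensor functors `F_e : A ⟶ B_e`, one for every chart
`e` over `S`, with compatible isomorphisms `f^* ∘ F_e ∘ H i i' ≅ F_e'` for all morphisms
`f : e' ⟶ e` over `S`. -/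
def gluedStack : Pseudofunctor (LocallyDiscrete Cᵒᵖ)
    Cat.{max u v wι u₁ vB, max u v wι u₁ v₁ vB uB} :=
  push (Chart.forget T) (chartTwist B c T)

variable {B} in
theorem gluedStack_isStackInGroupoids (J : GrothendieckTopology C) (hB : B.fib.IsStack J) :
    IsStackInGroupoids J (gluedStack B c T) where
  isStack := .of_isStackFor fun _ R hR => push_isStackFor R fun e q =>
    twist_isStackFor c Chart.idx <| Chart.isLocalEquiv_forget.isStackFor_of_isStack J hB _
      (Chart.functorPushforward_functorPullback_mem J hR e q)
  isGroupoid _ := Sec.isGroupoid fun e => tensorFunctor_isGroupoid (A' := Fibre B.fib e.pt)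

end Glued

/-! ### The 2-descent datum of a cocycle -/

section CocycleDatum

variable {C : Type u} [Category.{v} C] (B : AbTensorFibration.{w, vB, uB} C)
  {A : Type u₁} [Category.{v₁} A] [MonoidalCategory A] [SymmetricCategory A] {ι : Type wι}
  (c : TensorCocycle.{w} A ι) (T : ι → C)

/-- The triple defined by a cocycle of tensor functors: the stacks of tensor functors from `A` to
the restrictions of `B`, composition with the functors `H i j` and the isomorphisms given by the
multiplications of the cocycle. -/
def cocycleDatum : PreDescentDatum T where
  X i := localHom B A (T i)
  χ i j := localPrecomp B (c.H i j) (T i) (T j)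
  φ i j l {S} _ _ _ := TensorFunctor.precompComp (c.m i j l) (B.fib.obj (.mk (op S)))

theorem cocycleDatum_φ_hom_app (i j k : ι) {S : C} (p : S ⟶ T i) (q : S ⟶ T j) (r : S ⟶ T k)
    (x : TensorFunctor.{w} A (Fibre B.fib S)) (a : A) :
    (((cocycleDatum B c T).φ i j k p q r).hom.app x).iso.hom.app a =
      x.toFunctor.map (c.mul i j k a).hom :=
  TensorFunctor.precompComp_hom_app (c.m i j k) (Fibre B.fib S) x a

variable {B} in
theorem cocycleDatum_isTwoDescentDatum (J : GrothendieckTopology C) (hB : B.fib.IsStack J) :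
    IsTwoDescentDatum J (cocycleDatum B c T) where
  stack i := localHom_isStackInGroupoids A J hB (T i)
  equiv i j Z := c.precomp_isEquivalence i j (Fibre B.fib Z.pt)
  pullback i j k {S S'} g p q r x := TensorFunctor.hom_ext fun a => by
    -- `y` is `x` with its type unfolded
    obtain ⟨y, hy⟩ : ∃ y : TensorFunctor.{w} A (Fibre B.fib S), y = x := ⟨_, rfl⟩
    subst hy
    refine ((congrArg (· ≫ _) (cocycleDatum_φ_hom_app B c T i j k (g ≫ p) (g ≫ q) (g ≫ r)
      (y.comp (B.pullback g.op.toLoc)) a)).trans (Category.comp_id _)).trans ?_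
    exact ((Category.id_comp _).trans ((Category.id_comp _).trans (congrArg (pull B.fib g).map
      (cocycleDatum_φ_hom_app B c T i j k p q r y a)))).symm
  tetrahedron i j k l {S} p q r s x := TensorFunctor.hom_ext fun a => by
    -- `y` is `x` with its type unfolded
    obtain ⟨y, hy⟩ : ∃ y : TensorFunctor.{w} A (Fibre B.fib S), y = x := ⟨_, rfl⟩
    subst hy
    refine (congrArg₂ (· ≫ ·) (cocycleDatum_φ_hom_app B c T i j k p q r y (c.tw k l a))
      (cocycleDatum_φ_hom_app B c T i k l p r s y a)).trans (Eq.trans ?_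
      (congrArg₂ (· ≫ ·) (cocycleDatum_φ_hom_app B c T j k l q r s ((c.H i j).comp y) a)
        (cocycleDatum_φ_hom_app B c T i j l p q s y a)).symm)
    exact (y.toFunctor.map_comp _ _).symm.trans ((congrArg y.toFunctor.map
      (c.assoc i j k l a).symm).trans (y.toFunctor.map_comp _ _))

end CocycleDatum

/-! ### Components of objects of the glued stack -/

section PullId

variable {C : Type u} [Category.{v} C] (F : Pseudofunctor (LocallyDiscrete Cᵒᵖ) Cat.{vX, uX})

theorem baseChange_overForget_pullId_hom {T : C} (Z : Over T) (x : Fibre F Z.left) :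
    (pullId (baseChange (Over.forget T) F) Z x).hom = (pullId F Z.left x).hom := by
  refine (congrArg (fun t => (F.map₂ t).toNatTrans.app x ≫ (pullId F Z.left x).hom)
    (Subsingleton.elim (α := (𝟙 Z.left : Z.left ⟶ Z.left).op.toLoc ⟶
      (𝟙 Z.left : Z.left ⟶ Z.left).op.toLoc) _ (𝟙 _))).trans ?_
  rw [PrelaxFunctor.map₂_id]
  exact Category.id_comp _

theorem baseChange_chartForget_pullId_hom {ι : Type wι} {T : ι → C} (e : Chart T)
    (x : Fibre F e.pt) :
    (pullId (baseChange (Chart.forget T) F) e x).hom = (pullId F e.pt x).hom := by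
  refine (congrArg (fun t => (F.map₂ t).toNatTrans.app x ≫ (pullId F e.pt x).hom)
    (Subsingleton.elim (α := (𝟙 e.pt : e.pt ⟶ e.pt).op.toLoc ⟶
      (𝟙 e.pt : e.pt ⟶ e.pt).op.toLoc) _ (𝟙 _))).trans ?_
  rw [PrelaxFunctor.map₂_id]
  exact Category.id_comp _

end PullId

section Components

variable {C : Type u} [Category.{v} C] {B : AbTensorFibration.{w, vB, uB} C}
  {A : Type u₁} [Category.{v₁} A] [MonoidalCategory A] [SymmetricCategory A] {ι : Type wι}
  {c : TensorCocycle.{w} A ι} {T : ι → C} {S : C}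

theorem chartTwist_pullId_hom_app (e : Chart T) (F : TensorFunctor.{w} A (Fibre B.fib e.pt))
    (a : A) :
    (pullId (chartTwist B c T) e F).hom.iso.hom.app a =
      (pullId B.fib e.pt (F.toFunctor.obj (c.tw e.idx e.idx a))).hom ≫
        F.toFunctor.map (c.one e.idx a).hom :=
  (twist_pullId_hom_app (B.restrict (Chart.forget T)) c Chart.idx e F a).trans
    (congrArg (fun t => t ≫ F.toFunctor.map (c.one e.idx a).hom)
      (baseChange_chartForget_pullId_hom B.fib e (F.toFunctor.obj (c.tw e.idx e.idx a))))

theorem chartTwist_pullComp_hom_app (e e' e'' : Chart T) (f : e'.pt ⟶ e.pt) (g : e''.pt ⟶ e'.pt)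
    (h : e''.pt ⟶ e.pt) (w : g ≫ f = h) (F : TensorFunctor.{w} A (Fibre B.fib e.pt)) (a : A) :
    (pullComp (chartTwist B c T) (S := e) (S' := e') (S'' := e'') f g h w F).hom.iso.hom.app a =
      (pull B.fib h).map (F.toFunctor.map (c.mul e.idx e'.idx e''.idx a).inv) ≫
        (pullComp B.fib f g h w (F.toFunctor.obj
          (c.tw e.idx e'.idx (c.tw e'.idx e''.idx a)))).hom :=
  (twist_pullComp_hom_app (B.restrict (Chart.forget T)) c Chart.idx (S := e) (S' := e') (S'' := e'')
    f g h w F a).trans (congrArg (fun t => (pull B.fib h).map (F.toFunctor.map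
      (c.mul e.idx e'.idx e''.idx a).inv) ≫ t) (baseChange_pullComp_hom (p := Chart.forget T)
        (F := B.fib) (S := e) (S' := e') (S'' := e'') f g h w w _))

namespace Sec

variable (y : Sec (chartTwist B c T) (homTo (Chart.forget T) S))

/-- The tensor functor which is the value of an object of the glued stack at a chart. -/
def atChart (e : Chart T) (q : e.pt ⟶ S) : TensorFunctor.{w} A (Fibre B.fib e.pt) := y.obj e q

/-- The value at a chart and an object of `A`. -/
abbrev ev (e : Chart T) (q : e.pt ⟶ S) (a : A) : Fibre B.fib e.pt := (y.atChart e q).toFunctor.obj a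

/-- The components of the transition isomorphisms of an object of the glued stack. -/
def tran (e e' : Chart T) (g : e'.pt ⟶ e.pt) (q : e.pt ⟶ S) (q' : e'.pt ⟶ S) (w : g ≫ q = q')
    (a : A) : (pull B.fib g).obj (y.ev e q (c.tw e.idx e'.idx a)) ≅ y.ev e' q' a :=
  (y.trAt (j := Chart.forget T) (e := e) (e' := e') g q q' w).hom.iso.app a

/-- The identification of the values at equal morphisms. -/
def evCast (e : Chart T) {q q' : e.pt ⟶ S} (h : q = q') (a : A) : y.ev e q a ≅ y.ev e q' a :=
  (y.castAt (j := Chart.forget T) (e := e) h).hom.iso.app a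

theorem tran_naturality (e e' : Chart T) (g : e'.pt ⟶ e.pt) (q : e.pt ⟶ S) (q' : e'.pt ⟶ S)
    (w : g ≫ q = q') {a b : A} (f : a ⟶ b) :
    (pull B.fib g).map ((y.atChart e q).toFunctor.map ((c.H e.idx e'.idx).toFunctor.map f)) ≫
      (y.tran e e' g q q' w b).hom = (y.tran e e' g q q' w a).hom ≫
        (y.atChart e' q').toFunctor.map f :=
  (y.trAt (j := Chart.forget T) (e := e) (e' := e') g q q' w).hom.iso.hom.naturality f

theorem tran_evCast (e e' : Chart T) (g : e'.pt ⟶ e.pt) (q : e.pt ⟶ S) (q' q'' : e'.pt ⟶ S)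
    (w : g ≫ q = q') (h : q' = q'') (a : A) :
    (y.tran e e' g q q' w a).hom ≫ (y.evCast e' h a).hom =
      (y.tran e e' g q q'' (w.trans h) a).hom :=
  congrArg (fun t => TensorFunctor.Hom.iso t |>.hom.app a)
    (y.trAt_castAt (j := Chart.forget T) (e := e) (e' := e') g q q' q'' w h)

theorem tran_id (e : Chart T) (q q' : e.pt ⟶ S) (w : 𝟙 e.pt ≫ q = q') (h : q = q') (a : A) :
    (y.tran e e (𝟙 e.pt) q q' w a).hom = (pullId B.fib e.pt _).hom ≫
      (y.atChart e q).toFunctor.map (c.one e.idx a).hom ≫ (y.evCast e h a).hom := by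
  refine (congrArg (fun t => TensorFunctor.Hom.iso t |>.hom.app a)
    (y.trAt_id (j := Chart.forget T) (e := e) q q' w h)).trans ?_
  exact (congrArg (· ≫ (y.evCast e h a).hom) (chartTwist_pullId_hom_app e (y.atChart e q) a)).trans
    (Category.assoc _ _ _)

theorem tran_comp (e e' e'' : Chart T) (f : e'.pt ⟶ e.pt) (g : e''.pt ⟶ e'.pt) (h : e''.pt ⟶ e.pt)
    (w : g ≫ f = h) (q : e.pt ⟶ S) (q' : e'.pt ⟶ S) (q'' : e''.pt ⟶ S) (w₁ : f ≫ q = q')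
    (w₂ : g ≫ q' = q'') (w₃ : h ≫ q = q'') (a : A) :
    (y.tran e e'' h q q'' w₃ a).hom =
      (pull B.fib h).map ((y.atChart e q).toFunctor.map (c.mul e.idx e'.idx e''.idx a).inv) ≫
        (pullComp B.fib f g h w _).hom ≫
          (pull B.fib g).map (y.tran e e' f q q' w₁ (c.tw e'.idx e''.idx a)).hom ≫
            (y.tran e' e'' g q' q'' w₂ a).hom := by
  refine (congrArg (fun t => TensorFunctor.Hom.iso t |>.hom.app a)
    (y.trAt_comp (j := Chart.forget T) (e := e) (e' := e') (e'' := e'') f g h w q q' q''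
      w₁ w₂ w₃)).trans ?_
  exact (congrArg (· ≫ (pull B.fib g).map (y.tran e e' f q q' w₁ (c.tw e'.idx e''.idx a)).hom ≫
    (y.tran e' e'' g q' q'' w₂ a).hom)
      (chartTwist_pullComp_hom_app e e' e'' f g h w (y.atChart e q) a)).trans (Category.assoc _ _ _)

/-- The components of a morphism of the glued stack. -/
def evMap {y y' : Sec (chartTwist B c T) (homTo (Chart.forget T) S)} (b : y ⟶ y') (e : Chart T)
    (q : e.pt ⟶ S) (a : A) : y.ev e q a ⟶ y'.ev e q a :=
  (homAt' (j := Chart.forget T) (e := e) b q).iso.hom.app a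

theorem tran_evMap {y y' : Sec (chartTwist B c T) (homTo (Chart.forget T) S)} (b : y ⟶ y')
    (e e' : Chart T) (g : e'.pt ⟶ e.pt) (q : e.pt ⟶ S) (q' : e'.pt ⟶ S) (w : g ≫ q = q') (a : A) :
    (y.tran e e' g q q' w a).hom ≫ evMap b e' q' a =
      (pull B.fib g).map (evMap b e q (c.tw e.idx e'.idx a)) ≫ (y'.tran e e' g q q' w a).hom :=
  congrArg (fun t => TensorFunctor.Hom.iso t |>.hom.app a)
    (trAt_homAt' (j := Chart.forget T) (e := e) (e' := e') b g q q' w)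

theorem evMap_naturality {y y' : Sec (chartTwist B c T) (homTo (Chart.forget T) S)} (b : y ⟶ y')
    (e : Chart T) (q : e.pt ⟶ S) {a a' : A} (f : a ⟶ a') :
    (y.atChart e q).toFunctor.map f ≫ evMap b e q a' = evMap b e q a ≫
      (y'.atChart e q).toFunctor.map f :=
  (homAt' (j := Chart.forget T) (e := e) b q).iso.hom.naturality f

end Sec

end Components

/-! ### Evaluation of the glued stack over the members of the covering -/

section Gluing

variable {C : Type u} [Category.{v} C] {B : AbTensorFibration.{w, vB, uB} C}
  {A : Type u₁} [Category.{v₁} A] [MonoidalCategory A] [SymmetricCategory A] {ι : Type wι}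
  {c : TensorCocycle.{w} A ι} {T : ι → C}

open Sec

/-- The chart defined by an object over `T i`. -/
def chart {i : ι} (Z : Over (T i)) : Chart T := ⟨Z.left, i, Z.hom⟩

variable (B c) in
/-- Evaluation of the objects of the glued stack over `Z` at the chart `Z`, for `Z` over `T i`. -/
def evalOver (i : ι) (Z : Over (T i)) :
    Fibre (gluedStack B c T) Z.left ⥤ TensorFunctor.{w} A (Fibre B.fib Z.left) :=
  Sec.eval (chartTwist B c T) (homTo (Chart.forget T) Z.left) (chart Z) (𝟙 Z.left)

theorem evalOver_isEquivalence (i : ι) (Z : Over (T i)) : (evalOver B c i Z).IsEquivalence :=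
  eval_yoneda_isEquivalence (chartTwist B c T) (chart Z)

variable (B) in
/-- The isomorphism of pull-backs induced by the unit of the cocycle. It is needed as the pull-back
along a morphism of charts with the same index `i` is still twisted by `H i i`. -/
def unitPull (i : ι) {S S' : C} (g : S' ⟶ S) (F : TensorFunctor.{w} A (Fibre B.fib S)) :
    ((c.H i i).comp F).comp (B.pullback g.op.toLoc) ≅ F.comp (B.pullback g.op.toLoc) :=
  (TensorFunctor.postcomp A (B.pullback g.op.toLoc)).mapIso
    ((TensorFunctor.precompId (c.u i) (Fibre B.fib S)).app F)

theorem unitPull_hom_app (i : ι) {S S' : C} (g : S' ⟶ S) (F : TensorFunctor.{w} A (Fibre B.fib S))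
    (a : A) : (unitPull B (c := c) i g F).hom.iso.hom.app a =
      (pull B.fib g).map (F.toFunctor.map (c.one i a).hom) :=
  congrArg (pull B.fib g).map (TensorFunctor.precompId_hom_app (c.u i) (Fibre B.fib S) F a)

/-- The components of the isomorphism by which evaluation commutes with pull-backs. -/
def evalOverNatApp (i : ι) {Z Z' : Over (T i)} (g : Z' ⟶ Z)
    (y : Sec (chartTwist B c T) (homTo (Chart.forget T) Z.left)) :
    y.atChart (chart Z') (𝟙 Z'.left ≫ g.left) ≅
      (y.atChart (chart Z) (𝟙 Z.left)).comp (B.pullback g.left.op.toLoc) :=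
  (y.trAt (j := Chart.forget T) (e := chart Z) (e' := chart Z') g.left (𝟙 Z.left)
    (𝟙 Z'.left ≫ g.left) ((Category.comp_id _).trans (Category.id_comp _).symm)).symm ≪≫
      unitPull B i g.left (y.atChart (chart Z) (𝟙 Z.left))

theorem evalOverNatApp_hom_app (i : ι) {Z Z' : Over (T i)} (g : Z' ⟶ Z)
    (y : Sec (chartTwist B c T) (homTo (Chart.forget T) Z.left)) (a : A) :
    (evalOverNatApp i g y).hom.iso.hom.app a =
      (y.tran (chart Z) (chart Z') g.left (𝟙 Z.left) (𝟙 Z'.left ≫ g.left)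
        ((Category.comp_id _).trans (Category.id_comp _).symm) a).inv ≫
      (pull B.fib g.left).map ((y.atChart (chart Z) (𝟙 Z.left)).toFunctor.map (c.one i a).hom) :=
  congrArg₂ (· ≫ ·) (TensorFunctor.iso_inv_app _ a) (unitPull_hom_app i g.left _ a)

variable (B c) in
/-- Evaluation commutes with pull-backs. -/
def evalOverNat (i : ι) {Z Z' : Over (T i)} (g : Z' ⟶ Z) :
    pull (baseChange (Over.forget (T i)) (gluedStack B c T)) g ⋙ evalOver B c i Z' ≅
      evalOver B c i Z ⋙ pull (localHom B A (T i)) g :=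
  NatIso.ofComponents (fun y => evalOverNatApp i g y) fun {y y'} b =>
      TensorFunctor.hom_ext fun a => by
    refine (congrArg (_ ≫ ·) (evalOverNatApp_hom_app i g y' a)).trans (Eq.trans ?_
      (congrArg (· ≫ _) (evalOverNatApp_hom_app i g y a)).symm)
    change evMap b (chart Z') (𝟙 Z'.left ≫ g.left) a ≫ _ = _ ≫
      (pull B.fib g.left).map (evMap b (chart Z) (𝟙 Z.left) a)
    refine Eq.trans ?_ (Category.assoc _ _ _).symm
    refine (Iso.eq_inv_comp _).2 ?_
    refine (Category.assoc _ _ _).symm.trans ?_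
    refine (congrArg (· ≫ _) (tran_evMap b (chart Z) (chart Z') g.left _ _ _ a)).trans ?_
    refine (Category.assoc _ _ _).trans ((congrArg (_ ≫ ·) (Iso.hom_inv_id_assoc _ _)).trans ?_)
    refine ((pull B.fib g.left).map_comp _ _).symm.trans
      (Eq.trans ?_ ((pull B.fib g.left).map_comp _ _))
    exact congrArg (pull B.fib g.left).map (evMap_naturality b (chart Z) _ _).symm

end Gluing

section Gluing

variable {C : Type u} [Category.{v} C] {B : AbTensorFibration.{w, vB, uB} C}
  {A : Type u₁} [Category.{v₁} A] [MonoidalCategory A] [SymmetricCategory A] {ι : Type wι}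
  {c : TensorCocycle.{w} A ι} {T : ι → C}

open Sec

theorem localHom_pullId_inv_app {U : C} (Z : Over U) (F : TensorFunctor.{w} A (Fibre B.fib Z.left))
    (a : A) : (pullId (localHom B A U) Z F).inv.iso.hom.app a =
      (pullId B.fib Z.left (F.toFunctor.obj a)).inv := by
  refine (TensorFunctor.iso_inv_app (pullId (localHom B A U) Z F) a).trans ?_
  exact (Iso.inv_eq_inv ((pullId (localHom B A U) Z F).hom.iso.app a) (pullId B.fib Z.left _)).2
    ((homFib_pullId_hom_app (B.restrict (Over.forget U)) Z F a).trans
      (baseChange_overForget_pullId_hom B.fib Z _))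

theorem localHom_pullComp_inv_app {U : C} {Z Z' Z'' : Over U} (f : Z' ⟶ Z) (g : Z'' ⟶ Z')
    (h : Z'' ⟶ Z) (w : g ≫ f = h) (w' : g.left ≫ f.left = h.left)
    (F : TensorFunctor.{w} A (Fibre B.fib Z.left)) (a : A) :
    (pullComp (localHom B A U) f g h w F).inv.iso.hom.app a =
      (pullComp B.fib f.left g.left h.left w' (F.toFunctor.obj a)).inv :=
  (homFib_pullComp_inv_app (B.restrict (Over.forget U)) f g h w F a).trans
    (baseChange_pullComp_inv (p := Over.forget U) (F := B.fib) f g h w w' _)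

/-- The formal part of `Sec.tran_comp_inv`: from the cocycle condition `H'`, which involves the
twisting morphism `m`, to the condition for the inverses followed by the untwisting morphisms `n`
and `n'`. -/
theorem inv_comp_of_comp {F : Pseudofunctor (LocallyDiscrete Cᵒᵖ) Cat.{vX, uX}} {X X' X'' : C}
    (f : X' ⟶ X) (g : X'' ⟶ X') (h : X'' ⟶ X) (w : g ≫ f = h) {x₁ x₂ x₃ : Fibre F X}
    {y₁ y₂ : Fibre F X'} {z z' : Fibre F X''} (m : x₂ ⟶ x₁) (m' : x₁ ⟶ x₂) (n : x₂ ⟶ x₃)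
    (n' : y₁ ⟶ y₂) (t₁ : (pull F f).obj x₁ ≅ y₁) (t₂ : (pull F f).obj x₂ ≅ y₂)
    (t₃ : (pull F g).obj y₁ ≅ z) (t₄ : (pull F h).obj x₂ ≅ z') (k : z' ⟶ z) (hm : m ≫ m' = 𝟙 _)
    (H : (pull F f).map m' ≫ t₂.hom = t₁.hom ≫ n')
    (H' : t₄.hom ≫ k = (pull F h).map m ≫ (pullComp F f g h w x₁).hom ≫
      (pull F g).map t₁.hom ≫ t₃.hom) :
    t₄.inv ≫ (pull F h).map n = k ≫ (t₃.inv ≫ (pull F g).map n') ≫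
      (pull F g).map (t₂.inv ≫ (pull F f).map n) ≫ (pullComp F f g h w x₃).inv := by
  rw [Iso.inv_comp_eq, reassoc_of% H']
  simp only [Category.assoc, Iso.hom_inv_id_assoc, ← Functor.map_comp_assoc]
  rw [← reassoc_of% H, Iso.hom_inv_id_assoc, ← Functor.map_comp, pullComp_inv_naturality,
    Iso.hom_inv_id_assoc, ← Functor.map_comp, ← Category.assoc, hm, Category.id_comp]

namespace Sec

variable {S : C} (y : Sec (chartTwist B c T) (homTo (Chart.forget T) S))

theorem evCast_evCast (e : Chart T) {q q' : e.pt ⟶ S} (h : q = q') (h' : q' = q) (a : A) :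
    (y.evCast e h a).hom ≫ (y.evCast e h' a).hom = 𝟙 _ :=
  congrArg (fun t => TensorFunctor.Hom.iso t |>.hom.app a)
    (y.castAt_castAt (j := Chart.forget T) (e := e) h h')

/-- The untwisted inverse transition isomorphism along the identity is trivial. -/
theorem tran_id_inv (e : Chart T) (q q' : e.pt ⟶ S) (w : 𝟙 e.pt ≫ q = q') (h : q' = q) (a : A) :
    (y.tran e e (𝟙 e.pt) q q' w a).inv ≫
        (pull B.fib (𝟙 e.pt)).map ((y.atChart e q).toFunctor.map (c.one e.idx a).hom) =
      (y.evCast e h a).hom ≫ (pullId B.fib e.pt _).inv := by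
  rw [Iso.inv_comp_eq, y.tran_id e q q' w h.symm, Category.assoc, Category.assoc]
  rw [← Category.assoc (y.evCast e h.symm a).hom, evCast_evCast, Category.id_comp]
  exact (Iso.eq_comp_inv _).2 (pullId_hom_naturality e.pt _) |>.trans (Category.assoc _ _ _)

/-- The cocycle condition for the untwisted inverse transition isomorphisms between charts with the
same index. -/
theorem tran_comp_inv {i : ι} {X X' X'' : C} (p : X ⟶ T i) (p' : X' ⟶ T i) (p'' : X'' ⟶ T i)
    (f : X' ⟶ X) (g : X'' ⟶ X') (h : X'' ⟶ X)
    (w : g ≫ f = h) (q : X ⟶ S) (q' : X' ⟶ S) (q'' r : X'' ⟶ S) (w₁ : f ≫ q = q')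
    (w₂ : g ≫ q' = q'') (w₃ : h ≫ q = r) (k : r = q'') (a : A) :
    (y.tran ⟨X, i, p⟩ ⟨X'', i, p''⟩ h q r w₃ a).inv ≫
        (pull B.fib h).map ((y.atChart ⟨X, i, p⟩ q).toFunctor.map (c.one i a).hom) =
      (y.evCast ⟨X'', i, p''⟩ k a).hom ≫
        ((y.tran ⟨X', i, p'⟩ ⟨X'', i, p''⟩ g q' q'' w₂ a).inv ≫
          (pull B.fib g).map ((y.atChart ⟨X', i, p'⟩ q').toFunctor.map (c.one i a).hom)) ≫
        (pull B.fib g).map ((y.tran ⟨X, i, p⟩ ⟨X', i, p'⟩ f q q' w₁ a).inv ≫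
          (pull B.fib f).map ((y.atChart ⟨X, i, p⟩ q).toFunctor.map (c.one i a).hom)) ≫
        (pullComp B.fib f g h w _).inv := by
  have H := y.tran_naturality ⟨X, i, p⟩ ⟨X', i, p'⟩ f q q' w₁ (c.one i a).hom
  have H' := (y.tran_evCast ⟨X, i, p⟩ ⟨X'', i, p''⟩ h q r q'' w₃ k a).trans
    (y.tran_comp ⟨X, i, p⟩ ⟨X', i, p'⟩ ⟨X'', i, p''⟩ f g h w q q' q'' w₁ w₂ (w₃.trans k) a)
  have hm : (c.mul i i i a).inv ≫ (c.H i i).toFunctor.map (c.one i a).hom = 𝟙 _ := by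
    rw [c.mul_inv_right, ← Functor.map_comp, Iso.inv_hom_id, CategoryTheory.Functor.map_id]
  refine inv_comp_of_comp f g h w _ _ _ _ _ _ _ _ _ ?_ H H'
  exact ((y.atChart ⟨X, i, p⟩ q).toFunctor.map_comp _ _).symm.trans
    ((congrArg (y.atChart ⟨X, i, p⟩ q).toFunctor.map hm).trans (CategoryTheory.Functor.map_id _ _))

end Sec

variable (B c T) in
/-- The equivalence of the restriction of the glued stack to `C/T i` with the stack of tensor
functors to the restriction of `B`, given by the evaluation of sections. -/
def evalFunctor (i : ι) :
    FibredFunctor (baseChange (Over.forget (T i)) (gluedStack B c T)) (localHom B A (T i)) :=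
  .ofPull (evalOver B c i) (evalOverNat B c i)
    (fun Z y => TensorFunctor.hom_ext fun a => by
      refine (evalOverNatApp_hom_app i (𝟙 Z) y a).trans ?_
      refine Eq.trans ?_ (congrArg₂ (· ≫ ·) (congrArg (fun t =>
        ((evalOver B c i Z).map t).iso.hom.app a)
        (baseChange_overForget_pullId_hom (gluedStack B c T) Z y)) (localHom_pullId_inv_app Z
          (y.atChart (chart Z) (𝟙 Z.left)) a)).symm
      exact y.tran_id_inv (chart Z) (𝟙 Z.left) (𝟙 Z.left ≫ 𝟙 Z.left) rfl (Category.id_comp _) a)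
    (fun {Z Z' Z''} f g h w y => TensorFunctor.hom_ext fun a => by
      refine (evalOverNatApp_hom_app i h y a).trans ?_
      have w' : g.left ≫ f.left = h.left := congrArg (·.left) w
      refine Eq.trans ?_ (congrArg₂ (· ≫ ·) (congrArg (fun t =>
        ((evalOver B c i Z'').map t).iso.hom.app a) ((baseChange_pullComp_hom
          (p := Over.forget (T i)) (F := gluedStack B c T) f g h w w' y).trans
          ((pushData (Chart.forget T) (chartTwist B c T)).toPseudofunctor_pullComp_hom
            f.left g.left h.left w' y)))
        (congrArg₂ (· ≫ ·) (evalOverNatApp_hom_app i g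
          ((Sec.reindex (chartTwist B c T) (homToMap (Chart.forget T) f.left)).obj y) a)
          (congrArg₂ (· ≫ ·) (congrArg (pull B.fib g.left).map (evalOverNatApp_hom_app i f y a))
            (localHom_pullComp_inv_app f g h w w' (y.atChart (chart Z) (𝟙 Z.left)) a)))).symm
      exact y.tran_comp_inv Z.hom Z'.hom Z''.hom f.left g.left h.left w' (𝟙 Z.left)
        (𝟙 Z'.left ≫ f.left) ((𝟙 Z''.left ≫ g.left) ≫ f.left) (𝟙 Z''.left ≫ h.left)
        ((Category.comp_id _).trans (Category.id_comp _).symm)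
        ((congrArg (_ ≫ ·) (Category.id_comp _)).trans (congrArg (· ≫ _) (Category.id_comp _).symm))
        ((Category.comp_id _).trans (Category.id_comp _).symm)
        ((congrArg (𝟙 Z''.left ≫ ·) w'.symm).trans (Category.assoc _ _ _).symm) a)

end Gluing

/-! ### Change of charts -/

section Gluing

variable {C : Type u} [Category.{v} C] {B : AbTensorFibration.{w, vB, uB} C}
  {A : Type u₁} [Category.{v₁} A] [MonoidalCategory A] [SymmetricCategory A] {ι : Type wι}
  {c : TensorCocycle.{w} A ι} {T : ι → C}

open Sec

theorem pullComp_comp_id_hom_comp {F : Pseudofunctor (LocallyDiscrete Cᵒᵖ) Cat.{vX, uX}} {X X' : C}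
    (g : X' ⟶ X) (w : 𝟙 X' ≫ g = g) {x : Fibre F X} {y z : Fibre F X'} (t : (pull F g).obj x ⟶ y)
    (t' : (pull F (𝟙 X')).obj y ⟶ z) :
    (pullComp F g (𝟙 X') g w x).hom ≫ (pull F (𝟙 X')).map t ≫ t' =
      t ≫ (pullId F X' y).inv ≫ t' := by
  rw [pullComp_comp_id, ← pullId_inv_naturality_assoc]

theorem pullComp_id_comp_hom_comp {F : Pseudofunctor (LocallyDiscrete Cᵒᵖ) Cat.{vX, uX}} {X X' : C}
    (g : X' ⟶ X) (w : g ≫ 𝟙 X = g) {x y : Fibre F X} {z : Fibre F X'}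
    (t : (pull F (𝟙 X)).obj x ⟶ y) (t' : (pull F g).obj y ⟶ z) :
    (pullComp F (𝟙 X) g g w x).hom ≫ (pull F g).map t ≫ t' =
      (pull F g).map ((pullId F X x).inv ≫ t) ≫ t' := by
  rw [pullComp_id_comp, Functor.map_comp, Category.assoc]

theorem comp_inv_comp_of_eq {D : Type u} [Category.{v} D] {x x' x'' z z' o m : D}
    (U : x ≅ x') (tii : x' ≅ z) (θ' : z ⟶ z') (V : x ≅ x'') (Θ : x'' ⟶ o) (tjj : o ≅ z')
    (Θ₀ : x ⟶ m) (v : o ⟶ m) (H : U.hom ≫ tii.hom ≫ θ' = V.hom ≫ Θ ≫ tjj.hom)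
    (N : Θ ≫ v = V.inv ≫ Θ₀) : θ' ≫ tjj.inv ≫ v = (tii.inv ≫ U.inv) ≫ Θ₀ := by
  have h : θ' = tii.inv ≫ U.inv ≫ V.hom ≫ Θ ≫ tjj.hom := by rw [← H]; simp
  rw [h]
  simp [N]

namespace Sec

variable {S : C} (y : Sec (chartTwist B c T) (homTo (Chart.forget T) S)) {X X' : C} {i j k : ι}

/-- The change of the chart on a given object: the transition isomorphism along the identity of `X`,
viewed as a morphism between the charts `(X, i, p)` and `(X, j, p')`. -/
def theta (p : X ⟶ T i) (p' : X ⟶ T j) (q : X ⟶ S) (a : A) :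
    y.ev ⟨X, i, p⟩ q (c.tw i j a) ≅ y.ev ⟨X, j, p'⟩ q a :=
  (pullId B.fib X _).symm ≪≫
    y.tran ⟨X, i, p⟩ ⟨X, j, p'⟩ (𝟙 X) q q (Category.id_comp (X := X) q) a

theorem theta_naturality (p : X ⟶ T i) (p' : X ⟶ T j) (q : X ⟶ S) {a b : A} (f : a ⟶ b) :
    (y.atChart ⟨X, i, p⟩ q).toFunctor.map ((c.H i j).toFunctor.map f) ≫ (y.theta p p' q b).hom =
      (y.theta p p' q a).hom ≫ (y.atChart ⟨X, j, p'⟩ q).toFunctor.map f := by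
  refine (pullId_inv_naturality_assoc X _ _).trans ((congrArg ((pullId B.fib X _).inv ≫ ·)
    (y.tran_naturality ⟨X, i, p⟩ ⟨X, j, p'⟩ (𝟙 X) q q (Category.id_comp (X := X) q) f)).trans
      (Category.assoc _ _ _).symm)

/-- Transition to a chart on `X` factors through any other chart on `X`. -/
theorem tran_theta (e : Chart T) (p : X ⟶ T i) (p' : X ⟶ T j) (g : X ⟶ e.pt) (q : e.pt ⟶ S)
    (q' : X ⟶ S) (w : g ≫ q = q') (a : A) :
    (y.tran e ⟨X, j, p'⟩ g q q' w a).hom =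
      (pull B.fib g).map ((y.atChart e q).toFunctor.map (c.mul e.idx i j a).inv) ≫
        (y.tran e ⟨X, i, p⟩ g q q' w (c.tw i j a)).hom ≫ (y.theta p p' q' a).hom :=
  (y.tran_comp e ⟨X, i, p⟩ ⟨X, j, p'⟩ g (𝟙 X) g (Category.id_comp _) q q' q' w (Category.id_comp _)
    w a).trans (congrArg (_ ≫ ·) (pullComp_comp_id_hom_comp g (Category.id_comp _) _ _))

/-- Transition from a chart on `X` factors through any other chart on `X`. -/
theorem theta_tran (p : X ⟶ T i) (p' : X ⟶ T j) (e : Chart T) (g : e.pt ⟶ X) (q : X ⟶ S)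
    (q' : e.pt ⟶ S) (w : g ≫ q = q') (a : A) :
    (y.tran ⟨X, i, p⟩ e g q q' w a).hom =
      (pull B.fib g).map ((y.atChart ⟨X, i, p⟩ q).toFunctor.map (c.mul i j e.idx a).inv) ≫
        (pull B.fib g).map (y.theta p p' q (c.tw j e.idx a)).hom ≫
          (y.tran ⟨X, j, p'⟩ e g q q' w a).hom :=
  (y.tran_comp ⟨X, i, p⟩ ⟨X, j, p'⟩ e (𝟙 X) g g (Category.comp_id _) q q q' (Category.id_comp _) w
    w a).trans (congrArg (_ ≫ ·) (pullComp_id_comp_hom_comp g (Category.comp_id _) _ _))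

/-- The cocycle condition for changes of charts: the case of identities in the cocycle condition for
the transition isomorphisms. -/
theorem theta_theta (p : X ⟶ T i) (p' : X ⟶ T j) (p'' : X ⟶ T k) (q : X ⟶ S) (a : A) :
    (y.theta p p' q (c.tw j k a)).hom ≫ (y.theta p' p'' q a).hom =
      (y.atChart ⟨X, i, p⟩ q).toFunctor.map (c.mul i j k a).hom ≫ (y.theta p p'' q a).hom := by
  have H : (y.theta p p'' q a).hom = (y.atChart ⟨X, i, p⟩ q).toFunctor.map (c.mul i j k a).inv ≫
      (y.theta p p' q (c.tw j k a)).hom ≫ (y.theta p' p'' q a).hom := by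
    refine (congrArg ((pullId B.fib X _).inv ≫ ·) (y.tran_theta ⟨X, i, p⟩ p' p'' (𝟙 X) q q
      (Category.id_comp _) a)).trans ?_
    refine (pullId_inv_naturality_assoc X _ _).symm.trans (congrArg (_ ≫ ·) ?_)
    exact (Category.assoc _ _ _).symm
  refine ((Iso.eq_inv_comp ((y.atChart ⟨X, i, p⟩ q).toFunctor.mapIso (c.mul i j k a))).1 H).symm

/-- Changes of charts are compatible with pull-back: the transition isomorphism from `(X, i, p)` to
`(X', j, r')` factors through both `(X', i, r)` and `(X, j, p')`. -/
theorem theta_pullback (p : X ⟶ T i) (p' : X ⟶ T j) (r : X' ⟶ T i) (r' : X' ⟶ T j) (g : X' ⟶ X)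
    (q : X ⟶ S) (q' : X' ⟶ S) (w : g ≫ q = q') (a : A) :
    (y.theta r r' q' a).hom ≫ (y.tran ⟨X, j, p'⟩ ⟨X', j, r'⟩ g q q' w a).inv ≫
        (pull B.fib g).map ((y.atChart ⟨X, j, p'⟩ q).toFunctor.map (c.one j a).hom) =
      ((y.tran ⟨X, i, p⟩ ⟨X', i, r⟩ g q q' w (c.tw i j a)).inv ≫
        (pull B.fib g).map ((y.atChart ⟨X, i, p⟩ q).toFunctor.map (c.one i (c.tw i j a)).hom)) ≫
          (pull B.fib g).map (y.theta p p' q a).hom := by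
  have R₁ := y.tran_theta ⟨X, i, p⟩ r r' g q q' w a
  have R₂ := y.theta_tran p p' ⟨X', j, r'⟩ g q q' w a
  have N := congrArg (pull B.fib g).map (y.theta_naturality p p' q (c.one j a).hom)
  refine comp_inv_comp_of_eq
    ((pull B.fib g).mapIso ((y.atChart ⟨X, i, p⟩ q).toFunctor.mapIso (c.one i (c.tw i j a)).symm))
    _ _ ((pull B.fib g).mapIso ((y.atChart ⟨X, i, p⟩ q).toFunctor.mapIso
      ((c.H i j).toFunctor.mapIso (c.one j a).symm))) _ _ _ _ ?_
    (((pull B.fib g).map_comp _ _).symm.trans (N.symm.trans ((pull B.fib g).map_comp _ _)))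
  refine Eq.trans ?_ ((R₁.symm.trans R₂).trans ?_)
  · exact congrArg (fun t => (pull B.fib g).map ((y.atChart ⟨X, i, p⟩ q).toFunctor.map t) ≫ _)
      (c.mul_inv_left i j a).symm
  · exact congrArg (fun t => (pull B.fib g).map ((y.atChart ⟨X, i, p⟩ q).toFunctor.map t) ≫ _)
      (c.mul_inv_right i j a)

theorem evMap_theta {y y' : Sec (chartTwist B c T) (homTo (Chart.forget T) S)} (b : y ⟶ y')
    (p : X ⟶ T i) (p' : X ⟶ T j) (q : X ⟶ S) (a : A) :
    evMap b ⟨X, i, p⟩ q (c.tw i j a) ≫ (y'.theta p p' q a).hom =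
      (y.theta p p' q a).hom ≫ evMap b ⟨X, j, p'⟩ q a :=
  (pullId_inv_naturality_assoc X _ _).trans ((congrArg ((pullId B.fib X _).inv ≫ ·)
    (tran_evMap b ⟨X, i, p⟩ ⟨X, j, p'⟩ (𝟙 X) q q (Category.id_comp (X := X) q) a).symm).trans
      (Category.assoc _ _ _).symm)

end Sec

/-- The isomorphisms between the evaluations at different charts on the same object. -/
def thetaIso (i j : ι) {S : C} (p : S ⟶ T i) (p' : S ⟶ T j)
    (y : Sec (chartTwist B c T) (homTo (Chart.forget T) S)) :
    (c.H i j).comp (y.atChart ⟨S, i, p⟩ (𝟙 S)) ≅ y.atChart ⟨S, j, p'⟩ (𝟙 S) :=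
  (pullId (B.homFib A) S ((c.H i j).comp (y.atChart ⟨S, i, p⟩ (𝟙 S)))).symm ≪≫
    y.trAt (j := Chart.forget T) (e := ⟨S, i, p⟩) (e' := ⟨S, j, p'⟩) (𝟙 S) (𝟙 S) (𝟙 S)
      (Category.id_comp _)

theorem thetaIso_hom_app (i j : ι) {S : C} (p : S ⟶ T i) (p' : S ⟶ T j)
    (y : Sec (chartTwist B c T) (homTo (Chart.forget T) S)) (a : A) :
    (thetaIso i j p p' y).hom.iso.hom.app a = (y.theta p p' (𝟙 S) a).hom :=
  congrArg (· ≫ _) ((TensorFunctor.iso_inv_app (pullId (B.homFib A) S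
    ((c.H i j).comp (y.atChart ⟨S, i, p⟩ (𝟙 S)))) a).trans
      ((Iso.inv_eq_inv ((pullId (B.homFib A) S _).hom.iso.app a) (pullId B.fib S _)).2
        (homFib_pullId_hom_app B S _ a)))

variable (B c T) in
/-- The glued stack is glued from the stacks of tensor functors. -/
def gluing : Gluing (cocycleDatum B c T) (gluedStack B c T) where
  ψ := evalFunctor B c T
  ψ_equiv i Z := evalOver_isEquivalence i Z
  θ i j {S} p p' := NatIso.ofComponents (fun y => thetaIso i j p p' y)
    fun {y y'} b => TensorFunctor.hom_ext fun a => by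
      refine (congrArg (_ ≫ ·) (thetaIso_hom_app i j p p' y' a)).trans (Eq.trans ?_
        (congrArg (· ≫ _) (thetaIso_hom_app i j p p' y a)).symm)
      exact evMap_theta b p p' (𝟙 S) a
  θ_pullback i j {S S'} g p p' y := TensorFunctor.hom_ext fun a => by
    refine (congrArg₂ (· ≫ ·) (thetaIso_hom_app i j (g ≫ p) (g ≫ p')
      ((Sec.reindex (chartTwist B c T) (homToMap (Chart.forget T) g)).obj y) a)
      (evalOverNatApp_hom_app j (Over.homMk g : Over.mk (g ≫ p') ⟶ Over.mk p') y a)).trans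
      (Eq.trans ?_ (congrArg₂ (· ≫ ·)
        (evalOverNatApp_hom_app i (Over.homMk g : Over.mk (g ≫ p) ⟶ Over.mk p) y (c.tw i j a))
        ((Category.id_comp _).trans (congrArg (pull B.fib g).map
          (thetaIso_hom_app i j p p' y a)))).symm)
    exact y.theta_pullback p p' (g ≫ p) (g ≫ p') g (𝟙 S) (𝟙 S' ≫ g)
      ((Category.comp_id _).trans (Category.id_comp _).symm) a
  θ_comp i j k {S} p q r y := TensorFunctor.hom_ext fun a => by
    refine (congrArg₂ (· ≫ ·) (thetaIso_hom_app i j p q y (c.tw j k a))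
      (thetaIso_hom_app j k q r y a)).trans (Eq.trans ?_ (congrArg₂ (· ≫ ·)
        (cocycleDatum_φ_hom_app B c T i j k p q r (y.atChart ⟨S, i, p⟩ (𝟙 S)) a)
        (thetaIso_hom_app i k p r y a)).symm)
    exact y.theta_theta p q r (𝟙 S) a

end Gluing

/-! ### The cocycle of tensor functors attached to a cocycle of groups -/

section GroupCocycle

variable {G : Type uG} [Group G] {ι : Type wι} (α : ι → ι → MulAut G) (β : ι → ι → ι → G)
  (h₁ : ∀ a b c, α b c * α a b = α a c * MulAut.conj (β a b c)⁻¹)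
  (h₂ : ∀ a b c d, (α a b)⁻¹ (β b c d) * β a b d = β a b c * β a c d)

include h₁ in
theorem cocycle_diag (a : ι) : α a a = MulAut.conj (β a a a)⁻¹ :=
  mul_left_cancel (h₁ a a a)

include h₁ h₂ in
/-- The left unit law of the cocycle of tensor functors, for the unit `ρ(β_aaa)`. -/
theorem cocycle_diag_left (a b : ι) : β a a b = β a a a := by
  have h : (α a a)⁻¹ (β a a b) = β a a a := mul_right_cancel (h₂ a a a b)
  have h' : β a a b = α a a (β a a a) := by
    rw [← h]; exact (MulAut.apply_inv_self _ _ _).symm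
  rw [h', cocycle_diag α β h₁ a]; simp

include h₂ in
/-- The right unit law of the cocycle of tensor functors, for the unit `ρ(β_aaa)`. -/
theorem cocycle_diag_right (a b : ι) : α a b (β a b b) = β b b b := by
  have h : (α a b)⁻¹ (β b b b) = β a b b := mul_right_cancel (h₂ a b b b)
  rw [← h]; exact MulAut.apply_inv_self _ _ _

include h₁ h₂ in
/-- The associativity law of the cocycle of tensor functors: by `h₁` both sides are images under
`α_ad`, and their arguments agree by `h₂`. -/
theorem cocycle_assoc (a b c d : ι) :
    α a d (β a b d) * α b d (β b c d) = α a d (β a c d) * α c d (α a c (β a b c)) := by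
  have e₁ : α b d (β b c d) = α a d ((β a b d)⁻¹ * (α a b)⁻¹ (β b c d) * β a b d) := by
    have := DFunLike.congr_fun (h₁ a b d) ((α a b)⁻¹ (β b c d))
    simpa using this
  have e₂ : α c d (α a c (β a b c)) = α a d ((β a c d)⁻¹ * β a b c * β a c d) := by
    have := DFunLike.congr_fun (h₁ a c d) (β a b c)
    simpa using this
  rw [e₁, e₂, ← map_mul, ← map_mul]
  simp only [mul_assoc, mul_inv_cancel_left, h₂]

variable (k : Type uk) [Field k] [Finite G]

/-- If `α = ι(β)` with `ι(β)(x) = β⁻¹xβ`, the isomorphism of tensor functors `κ(α) ⟶ id` given on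
`ρ` by `ρ(β)`. -/
def kappaInner {α : MulAut G} {β : G} (h : α = MulAut.conj β⁻¹) :
    kappa.{w} k α ⟶ TensorFunctor.id (FDRep k G) where
  iso := NatIso.ofComponents
    (fun ρ => Action.mkIso (Action.ρAut ρ β) fun g => by
      have e : β * α g = g * β := by subst h; simp [mul_assoc]
      exact ((Action.ρ ρ).map_mul _ _).symm.trans
        ((congrArg (Action.ρ ρ) e).trans ((Action.ρ ρ).map_mul _ _)))
    fun f => Action.Hom.ext (f.comm β).symm
  isMonoidal :=
    { unit := Action.Hom.ext (Category.comp_id _)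
      tensor := fun _ _ => Action.Hom.ext
        ((Category.id_comp _).trans (Category.comp_id _).symm) }

/-- The functors `λ_ij = κ(α_ij)` with the isomorphisms `ρ(α_ik(β_ijk))`. The unit is given on `ρ`
by `ρ(β_iii)`. -/
def groupCocycle : TensorCocycle.{w} (FDRep k G) ι where
  H i j := kappa.{w} k (α i j)
  m i j l := mu.{w} k (h₁ i j l)
  u i := kappaInner.{w} k (cocycle_diag α β h₁ i)
  assoc i j l n ρ := Action.Hom.ext (((Action.ρ ρ).map_mul _ _).symm.trans
    ((congrArg (Action.ρ ρ) (cocycle_assoc α β h₁ h₂ i j l n)).trans ((Action.ρ ρ).map_mul _ _)))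
  unit_left i j ρ := Action.Hom.ext
    (congrArg (fun g => Action.ρ ρ (α i j g)) (cocycle_diag_left α β h₁ h₂ i j))
  unit_right i j ρ := Action.Hom.ext (congrArg (Action.ρ ρ) (cocycle_diag_right α β h₂ i j))

end GroupCocycle

end TensorStack

/-! ### Gluing the stacks of tensor functors on representations -/

theorem mainTheorem6 {C : Type u} [Category.{v} C] (J : GrothendieckTopology C)
    (S₀ : C) (hS₀ : IsTerminal S₀)
    (B : TensorStack.AbTensorFibration.{w, vB, uB} C) (hB : B.fib.IsStack J)
    {ι : Type wι} (T : ι → C) (p : ∀ i, T i ⟶ S₀) (hp : Sieve.ofArrows T p ∈ J S₀)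
    (k : Type uk) [Field k] (G : Type uG) [Group G] [Finite G]
    (α : ι → ι → MulAut G) (β : ι → ι → ι → G)
    (h₁ : ∀ a b c, α b c * α a b = α a c * MulAut.conj (β a b c)⁻¹)
    (h₂ : ∀ a b c d, (α a b)⁻¹ (β b c d) * β a b d = β a b c * β a c d) :
    TensorStack.IsTwoDescentDatum J (TensorStack.gerbeDatum B k T α β h₁) ∧
      ∃ Y : Pseudofunctor (LocallyDiscrete Cᵒᵖ)
          Cat.{max u v wι (uk + 1) uG vB, max u v wι (uk + 1) uG vB uB},
        TensorStack.IsStackInGroupoids J Y ∧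
          Nonempty (TensorStack.Gluing (TensorStack.gerbeDatum B k T α β h₁) Y) := by
  -- the datum of the statement is `cocycleDatum B c T` by definition
  let c := TensorStack.groupCocycle.{w} α β h₁ h₂ k
  exact ⟨TensorStack.cocycleDatum_isTwoDescentDatum c T J hB, TensorStack.gluedStack B c T,
    TensorStack.gluedStack_isStackInGroupoids c T J hB, ⟨TensorStack.gluing B c T⟩⟩
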